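/- Let $q:[0,\pi]\to\mathbb R$ belong to the Sobolev space $W_2^1[0,\pi]$ (that is, $q$ is absolutely continuous with $q'\in L_2(0,\pi)$), and let $h,h_1,h_2,H,H_1,H_2\in\mathbb R$ satisfy $\delta=hh_1-h_2>0$ and $\rho=HH_1-H_2>0$. Consider the boundary value problem \[ -y''(x)+q(x)y(x)=\lambda y(x),\quad x\in[0,\pi], \] \[ \lambda\,(y'(0)-h\,y(0))=h_1y'(0)-h_2y(0),\qquad \lambda\,(y'(\pi)+H\,y(\pi))=H_1y'(\pi)+H_2y(\pi), \] where $\lambda\in\mathbb C$ is called an eigenvalue if the problem has a complex-valued solution $y$ that is not identically zero. Put $\omega=h+H+\frac12\int_0^\pi q(t)\,dt$. Then the eigenvalues are real and form an infinite, strictly increasing sequence $\lambda_0<\lambda_1<\lambda_2<\cdots$, and 1. there is a sequence $\{\xi_n\}\in\ell_2$ such that \[ \lambda_n=(n-2)^2+\frac{2\omega}{\pi}+\frac{\xi_n}{n}\qquad(n\ge 1); \] 2. the series $\sum_{n\ge2}\bigl(\lambda_n-(n-2)^2-\frac{2\omega}{\pi}\bigr)$ converges absolutely, and \[ \lambda_0+\lambda_1+\sum_{n=2}^\infty\Bigl(\lambda_n-(n-2)^2-\frac{2\omega}{\pi}\Bigr)=h_1+H_1+\frac{q(0)+q(\pi)}{4}-\frac{h+H}{\pi}-\frac{h^2+H^2}{2}-\frac1{2\pi}\int_0^\pi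 q(t)\,dt. \] -/

import Mathlib

open Set MeasureTheory

/-- `q` belongs to the Sobolev space `W_2^1[0,π]`: it is absolutely continuous on `[0,π]` and its
(almost everywhere defined) derivative is square integrable there. -/
def MemW21 (q : ℝ → ℝ) : Prop :=
  AbsolutelyContinuousOnInterval q 0 Real.pi ∧
    MemLp (deriv q) 2 (volume.restrict (Icc 0 Real.pi))

/-- `y` is a (classical, complex-valued) solution of `-y'' + q y = μ y` on `[0,π]` with
derivative `y' = dy`; at the endpoints the derivatives are one-sided. -/
def IsSLSolution (q : ℝ → ℝ) (μ : ℂ) (y dy : ℝ → ℂ) : Prop :=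
  ∀ x ∈ Icc (0 : ℝ) Real.pi,
    HasDerivWithinAt y (dy x) (Icc 0 Real.pi) x ∧
    ∃ ddy : ℂ, HasDerivWithinAt dy ddy (Icc 0 Real.pi) x ∧ -ddy + (q x : ℂ) * y x = μ * y x

/-- `μ : ℂ` is an eigenvalue of the problem `-y'' + q y = μ y` on `[0,π]`,
`μ (y'(0) - h y(0)) = h₁ y'(0) - h₂ y(0)`, `μ (y'(π) + H y(π)) = H₁ y'(π) + H₂ y(π)`:
there is a solution that does not vanish identically on `[0,π]`. -/
def IsSLEigenvalue (q : ℝ → ℝ) (h h₁ h₂ H H₁ H₂ : ℝ) (μ : ℂ) : Prop :=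
  ∃ y dy : ℝ → ℂ, IsSLSolution q μ y dy ∧
    μ * (dy 0 - (h : ℂ) * y 0) = (h₁ : ℂ) * dy 0 - (h₂ : ℂ) * y 0 ∧
    μ * (dy Real.pi + (H : ℂ) * y Real.pi) =
      (H₁ : ℂ) * dy Real.pi + (H₂ : ℂ) * y Real.pi ∧
    ∃ x ∈ Icc (0 : ℝ) Real.pi, y x ≠ 0

/-- The constant `ω = h + H + (1/2) ∫_0^π q`. -/
noncomputable def slOmega (q : ℝ → ℝ) (h H : ℝ) : ℝ :=
  h + H + (1 / 2) * ∫ x in (0 : ℝ)..Real.pi, q x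

/-! The eigenvalues are the zeros of an entire function f = `charFn`: take the solution φ_μ =
`leftSol` fixed by the condition at 0 and insert it into the condition at π. Everything is read off
from the zeros and the growth of f.

Reality and simplicity. At a zero ν, Lagrange's identity gives -k f(μ) = (μ - ν) g(μ)
(`exists_charFn_identity`). At μ = conj ν the factor g equals δ + ∫|φ_ν|² + |k|²ρ, which is positive
because δ, ρ > 0. This is self-adjointness on L² ⊕ ℂ², carried out without that space
(`conj_eq_of_charFn_eq_zero`, `deriv_charFn_ne_zero`).

Growth. With μ = -z², up to O(|z|⁻³ exp(π|Re z|)), f(-z²)/z⁵ = sinh(πz)(1 + κ/z²) + ω cosh(πz)/z -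
(1/4z²) ∫ q'(t) sinh(z(2t - π)) dt (`isBigO_charFn_sub`). It is obtained by splitting the solution
with data (1, z) into its exp(zx) and exp(-zx) components and integrating by parts once, which is
where q ∈ W₂¹ enters.

Location. For z = is the right side is close to i sin(πs), so f has a zero σ_m² with σ_m near each
large integer m, and σ_m² - m² - 2ω/π = O(|J(m)|/m + 1/m²), where J(m) is a sine coefficient of q'
(`exists_zeros_near_integers`). Bessel's inequality makes J square summable; this yields the ℓ₂
remainder and the absolute convergence.

Counting. Divide f by the canonical product over the located zeros. On the circles |z| = N + 1/2 the
quotient grows like a power of z², so it is a polynomial whose exact degree gives the number of the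
remaining eigenvalues. Dividing by the product over all zeros leaves a constant
(`exists_enumeration`).

Trace. Hence f(-t²)/(t⁵ sinh πt) = ∏(1 + d_n/(b_n + t²)), with b_n = `slBase n` and d_n = λ_n - b_n.
Taking t² log of both sides as t → ∞ and using the partial fractions of coth gives the sum of the
d_n - 2ω/π (`trace_of_tendsto`). -/

lemma differentiable_inverse_one_sub {R : Type*} [NormedRing R] [HasSummableGeomSeries R]
    [NormedAlgebra ℂ R] (a b : R) (h : ∀ μ : ℂ, IsUnit (1 - (a + μ • b))) :
    Differentiable ℂ fun μ : ℂ => Ring.inverse (1 - (a + μ • b)) := by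
  intro μ
  have h1 : DifferentiableAt ℂ (fun μ : ℂ => 1 - (a + μ • b)) μ := by fun_prop
  exact DifferentiableAt.fun_comp' (f := fun μ : ℂ => 1 - (a + μ • b)) μ
    (differentiableAt_inverse (h μ)) h1

/-! ### Linear differential equations depending affinely on a complex parameter, by inverting
Volterra operators. -/

section LinearODE

variable {E : Type*} [NormedAddCommGroup E]

/-- The extension of a continuous function on `[0,π]` to the real line by its boundary values. -/
noncomputable def extendPi (g : C(Icc (0 : ℝ) Real.pi, E)) (t : ℝ) : E :=
  IccExtend Real.pi_pos.le g t

lemma continuous_extendPi (g : C(Icc (0 : ℝ) Real.pi, E)) : Continuous (extendPi g) :=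
  g.continuous.Icc_extend'

lemma extendPi_of_mem (g : C(Icc (0 : ℝ) Real.pi, E)) {t : ℝ} (ht : t ∈ Icc (0 : ℝ) Real.pi) :
    extendPi g t = g ⟨t, ht⟩ := IccExtend_of_mem _ _ ht

lemma norm_extendPi_le (g : C(Icc (0 : ℝ) Real.pi, E)) (t : ℝ) : ‖extendPi g t‖ ≤ ‖g‖ :=
  g.norm_coe_le_norm _

variable [NormedSpace ℂ E]

/-- The Volterra operator `g ↦ ∫_0^x M(t) g(t) dt` on `C([0,π], E)`. -/
noncomputable def volterra (M : ℝ → E →L[ℂ] E) (hM : Continuous M) :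
    C(Icc (0 : ℝ) Real.pi, E) →L[ℂ] C(Icc (0 : ℝ) Real.pi, E) :=
  LinearMap.mkContinuousOfExistsBound
    { toFun := fun g =>
        ⟨fun x => ∫ t in (0 : ℝ)..x, M t (extendPi g t),
          (intervalIntegral.continuous_primitive (fun a b =>
            (hM.clm_apply (continuous_extendPi g)).intervalIntegrable a b) 0).comp
            continuous_subtype_val⟩
      map_add' := fun f g => by
        ext x
        simp only [ContinuousMap.coe_mk, ContinuousMap.add_apply]
        rw [← intervalIntegral.integral_add
          ((hM.clm_apply (continuous_extendPi f)).intervalIntegrable _ _)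
          ((hM.clm_apply (continuous_extendPi g)).intervalIntegrable _ _)]
        simp only [extendPi, IccExtend, Function.comp_apply, ContinuousMap.add_apply, map_add]
      map_smul' := fun c g => by
        ext x
        simp only [ContinuousMap.coe_mk, ContinuousMap.smul_apply, RingHom.id_apply]
        rw [← intervalIntegral.integral_smul]
        simp only [extendPi, IccExtend, Function.comp_apply, ContinuousMap.smul_apply, map_smul] }
    (by
      obtain ⟨K, hK⟩ := isCompact_Icc.exists_bound_of_continuousOn
        (s := Icc (0 : ℝ) Real.pi) hM.continuousOn
      have hK0 : 0 ≤ K := (norm_nonneg _).trans (hK 0 ⟨le_rfl, Real.pi_pos.le⟩)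
      refine ⟨K * Real.pi, fun g => ?_⟩
      refine (ContinuousMap.norm_le _ (by positivity)).2 fun x => ?_
      simp only [LinearMap.coe_mk, AddHom.coe_mk, ContinuousMap.coe_mk]
      refine (intervalIntegral.norm_integral_le_of_norm_le_const (C := K * ‖g‖)
        fun t ht => ?_).trans ?_
      · rw [uIoc_of_le x.2.1] at ht
        refine ((M t).le_opNorm _).trans ?_
        gcongr
        · exact hK t ⟨ht.1.le, ht.2.trans x.2.2⟩
        · exact norm_extendPi_le g t
      · rw [sub_zero, abs_of_nonneg x.2.1]
        have := x.2.2
        calc K * ‖g‖ * x ≤ K * ‖g‖ * Real.pi := by gcongr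
          _ = _ := by ring)

lemma volterra_apply (M : ℝ → E →L[ℂ] E) (hM : Continuous M) (g : C(Icc (0 : ℝ) Real.pi, E))
    (x : Icc (0 : ℝ) Real.pi) :
    volterra M hM g x = ∫ t in (0 : ℝ)..x, M t (extendPi g t) := rfl

/-- Each iteration integrates one more power of `t`, which produces the factorial. The operator
itself need not be a contraction, but its high powers are. -/
lemma norm_volterra_pow_apply_le (M : ℝ → E →L[ℂ] E) (hM : Continuous M) {K : ℝ}
    (hK : ∀ t ∈ Icc (0 : ℝ) Real.pi, ‖M t‖ ≤ K) (g : C(Icc (0 : ℝ) Real.pi, E)) (n : ℕ)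
    (x : Icc (0 : ℝ) Real.pi) :
    ‖(volterra M hM ^ n) g x‖ ≤ ‖g‖ * (K ^ n * (x : ℝ) ^ n / n.factorial) := by
  have hK0 : 0 ≤ K := (norm_nonneg _).trans (hK 0 ⟨le_rfl, Real.pi_pos.le⟩)
  induction n generalizing x with
  | zero => simpa using g.norm_coe_le_norm x
  | succ n ih =>
    rw [pow_succ']
    change ‖volterra M hM ((volterra M hM ^ n) g) x‖ ≤ _
    rw [volterra_apply]
    have h1 : ∀ t ∈ Icc (0 : ℝ) x, ‖M t (extendPi ((volterra M hM ^ n) g) t)‖ ≤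
        ‖g‖ * (K ^ (n + 1) / n.factorial) * t ^ n := by
      intro t ht
      have ht' : t ∈ Icc (0 : ℝ) Real.pi := ⟨ht.1, ht.2.trans x.2.2⟩
      rw [extendPi_of_mem _ ht']
      refine ((M t).le_opNorm _).trans ?_
      calc ‖M t‖ * _ ≤ K * (‖g‖ * (K ^ n * t ^ n / n.factorial)) := by
            gcongr
            · exact hK t ht'
            · exact ih ⟨t, ht'⟩
        _ = _ := by ring
    refine (intervalIntegral.norm_integral_le_of_norm_le x.2.1
      (Filter.Eventually.of_forall fun t ht => h1 t ⟨ht.1.le, ht.2⟩)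
      ((continuous_const.mul (continuous_pow n)).intervalIntegrable _ _)).trans (le_of_eq ?_)
    rw [intervalIntegral.integral_const_mul, integral_pow, Nat.factorial_succ]
    push_cast
    field_simp
    simp

/-- Some power Tⁿ has norm less than 1, so 1 - Tⁿ = (1 - T)(1 + T + ⋯ + Tⁿ⁻¹) is invertible;
commuting factors of a unit are units. -/
lemma isUnit_one_sub_volterra [CompleteSpace E] (M : ℝ → E →L[ℂ] E) (hM : Continuous M) :
    IsUnit (1 - volterra M hM) := by
  obtain ⟨K, hK⟩ := isCompact_Icc.exists_bound_of_continuousOn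
    (s := Icc (0 : ℝ) Real.pi) hM.continuousOn
  have hK0 : 0 ≤ K := (norm_nonneg _).trans (hK 0 ⟨le_rfl, Real.pi_pos.le⟩)
  obtain ⟨n, hn⟩ := ((FloorSemiring.tendsto_pow_div_factorial_atTop (K * Real.pi)).eventually
    (gt_mem_nhds one_pos)).exists
  have hT : ‖volterra M hM ^ n‖ < 1 := by
    refine lt_of_le_of_lt (ContinuousLinearMap.opNorm_le_bound _ (by positivity) fun g => ?_) hn
    refine (ContinuousMap.norm_le _ (by positivity)).2 fun x => ?_
    refine (norm_volterra_pow_apply_le M hM hK g n x).trans ?_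
    rw [mul_comm, mul_pow]
    have := x.2.1
    have := x.2.2
    gcongr
  have h1 : IsUnit (1 - volterra M hM ^ n) :=
    isUnit_one_sub_of_norm_lt_one (x := volterra M hM ^ n) hT
  rw [← mul_neg_geom_sum] at h1
  have hc : Commute (1 - volterra M hM) (∑ i ∈ Finset.range n, volterra M hM ^ i) := by
    refine Commute.sum_right _ _ _ fun i _ => ?_
    exact ((Commute.one_left _).sub_left (Commute.refl _)).pow_right i
  exact (hc.isUnit_mul_iff.1 h1).1

/-- Solutions of linear differential equations depend holomorphically on a parameter. -/
theorem exists_linearODE_solution [CompleteSpace E] (A B : ℝ → E →L[ℂ] E) (hA : Continuous A)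
    (hB : Continuous B) (v : E) :
    ∃ Y : ℂ → ℝ → E, Continuous (Function.uncurry Y) ∧ (∀ μ, Y μ 0 = v) ∧
      (∀ μ, ∀ x ∈ Icc (0 : ℝ) Real.pi, HasDerivAt (Y μ) ((A x + μ • B x) (Y μ x)) x) ∧
      ∀ x ∈ Icc (0 : ℝ) Real.pi, Differentiable ℂ fun μ => Y μ x := by
  set T : ℂ → C(Icc (0 : ℝ) Real.pi, E) →L[ℂ] C(Icc (0 : ℝ) Real.pi, E) :=
    fun μ => volterra A hA + μ • volterra B hB with hT
  have hM : ∀ μ : ℂ, Continuous fun t => A t + μ • B t := fun μ => by fun_prop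
  have hTM : ∀ μ, T μ = volterra (fun t => A t + μ • B t) (hM μ) := by
    intro μ
    ext g x
    simp only [hT, add_apply, ContinuousMap.add_apply,
      smul_apply, ContinuousMap.smul_apply, volterra_apply]
    rw [← intervalIntegral.integral_smul, ← intervalIntegral.integral_add]
    · exact (hA.clm_apply (continuous_extendPi g)).intervalIntegrable _ _
    · exact ((hB.clm_apply (continuous_extendPi g)).const_smul μ).intervalIntegrable _ _
  set u : ℂ → C(Icc (0 : ℝ) Real.pi, E) :=
    fun μ => Ring.inverse (1 - T μ) (ContinuousMap.const _ v) with hu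
  have hunit : ∀ μ, IsUnit (1 - T μ) := fun μ => by
    rw [hTM]; exact isUnit_one_sub_volterra _ _
  have hfix : ∀ μ, u μ = ContinuousMap.const _ v + T μ (u μ) := by
    intro μ
    have h1 : ((1 - T μ) * Ring.inverse (1 - T μ)) (ContinuousMap.const _ v) =
        ContinuousMap.const _ v := by rw [Ring.mul_inverse_cancel _ (hunit μ)]; rfl
    have h2 : u μ - T μ (u μ) = ContinuousMap.const _ v := h1
    exact sub_eq_iff_eq_add.1 h2
  have hdu : Differentiable ℂ u := by
    intro μ
    have h2 : DifferentiableAt ℂ (fun μ => Ring.inverse (1 - T μ)) μ :=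
      differentiable_inverse_one_sub (volterra A hA) (volterra B hB) hunit μ
    exact h2.clm_apply (differentiableAt_const _)
  have hcont : Continuous fun p : ℂ × ℝ => extendPi (u p.1) p.2 := by
    have h1 : Continuous fun p : ℂ × ℝ => (u p.1) (projIcc 0 Real.pi Real.pi_pos.le p.2) :=
      (hdu.continuous.comp continuous_fst).eval (continuous_projIcc.comp continuous_snd)
    exact h1
  -- On `[0,π]` this integral equals `extendPi (u μ)`. The integral form is taken because its
  -- integrand is continuous on the whole line, so two-sided derivatives exist also at `0` and `π`,
  -- where the constant extension could have a corner.
  refine ⟨fun μ x => v + ∫ t in (0 : ℝ)..x, (A t + μ • B t) (extendPi (u μ) t), ?_, ?_, ?_, ?_⟩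
  · refine continuous_const.add ?_
    refine intervalIntegral.continuous_parametric_intervalIntegral_of_continuous
      (f := fun (p : ℂ × ℝ) t => (A t + p.1 • B t) (extendPi (u p.1) t)) ?_ continuous_snd
    refine Continuous.clm_apply (by fun_prop) ?_
    exact hcont.comp (continuous_fst.fst.prodMk continuous_snd)
  · intro μ
    simp
  · intro μ x hx
    have hval : v + ∫ t in (0 : ℝ)..x, (A t + μ • B t) (extendPi (u μ) t) =
        extendPi (u μ) x := by
      rw [extendPi_of_mem _ hx]
      conv_rhs => rw [hfix μ, hTM μ]
      simp [volterra_apply]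
    beta_reduce
    rw [hval]
    exact (intervalIntegral.integral_hasDerivAt_right
      (((hM μ).clm_apply (continuous_extendPi _)).intervalIntegrable _ _)
      (((hM μ).clm_apply (continuous_extendPi _)).stronglyMeasurableAtFilter _ _)
      ((hM μ).clm_apply (continuous_extendPi _)).continuousAt).const_add v
  · intro x hx
    have hval : (fun μ => v + ∫ t in (0 : ℝ)..x, (A t + μ • B t) (extendPi (u μ) t)) =
        fun μ => u μ ⟨x, hx⟩ := by
      funext μ
      conv_rhs => rw [hfix μ, hTM μ]
      simp [volterra_apply]
    beta_reduce
    rw [hval]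
    exact fun μ => DifferentiableAt.fun_comp' (f := u) μ
      (ContinuousMap.evalCLM ℂ (⟨x, hx⟩ : Icc (0 : ℝ) Real.pi)).differentiableAt (hdu μ)

end LinearODE

/-! ### Initial value problems for -y'' + qy = μy: uniqueness, Wronskians, conjugation. -/

section Solutions

variable {q : ℝ → ℝ}

lemma zero_mem_Icc_pi : (0 : ℝ) ∈ Icc (0 : ℝ) Real.pi := ⟨le_rfl, Real.pi_pos.le⟩

lemma pi_mem_Icc_pi : Real.pi ∈ Icc (0 : ℝ) Real.pi := ⟨Real.pi_pos.le, le_rfl⟩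

/-- A family of solutions of `-y'' + q y = μ y`, holomorphic in `μ`, with initial data `v`, `w`. -/
structure IsSolutionFamily (q : ℝ → ℝ) (v w : ℂ) (y dy : ℂ → ℝ → ℂ) : Prop where
  cont : Continuous (Function.uncurry y)
  dcont : Continuous (Function.uncurry dy)
  zero : ∀ μ, y μ 0 = v
  dzero : ∀ μ, dy μ 0 = w
  hasDeriv : ∀ μ, ∀ x ∈ Icc (0 : ℝ) Real.pi, HasDerivAt (y μ) (dy μ x) x
  hasDeriv' : ∀ μ, ∀ x ∈ Icc (0 : ℝ) Real.pi, HasDerivAt (dy μ) ((q x - μ) * y μ x) x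
  diff : ∀ x ∈ Icc (0 : ℝ) Real.pi, Differentiable ℂ fun μ => y μ x
  diff' : ∀ x ∈ Icc (0 : ℝ) Real.pi, Differentiable ℂ fun μ => dy μ x

lemma exists_isSolutionFamily (hq : Continuous q) (v w : ℂ) :
    ∃ y dy : ℂ → ℝ → ℂ, IsSolutionFamily q v w y dy := by
  obtain ⟨Y, hc, h0, hd, hdiff⟩ := exists_linearODE_solution
    (fun t => (ContinuousLinearMap.snd ℂ ℂ ℂ).prod 0 +
      (q t : ℂ) • (0 : ℂ × ℂ →L[ℂ] ℂ).prod (ContinuousLinearMap.fst ℂ ℂ ℂ))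
    (fun _ => (0 : ℂ × ℂ →L[ℂ] ℂ).prod (-ContinuousLinearMap.fst ℂ ℂ ℂ))
    (by fun_prop) continuous_const (v, w)
  refine ⟨fun μ x => (Y μ x).1, fun μ x => (Y μ x).2, hc.fst, hc.snd, fun μ => by simp [h0],
    fun μ => by simp [h0], fun μ x hx => ?_, fun μ x hx => ?_, fun x hx μ => ?_,
    fun x hx μ => ?_⟩
  · have := (ContinuousLinearMap.fst ℝ ℂ ℂ).hasFDerivAt.comp_hasDerivAt x (hd μ x hx)
    exact this.congr_deriv (by simp)
  · have := (ContinuousLinearMap.snd ℝ ℂ ℂ).hasFDerivAt.comp_hasDerivAt x (hd μ x hx)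
    refine this.congr_deriv ?_
    simp
    ring
  · exact (hdiff x hx μ).fst
  · exact (hdiff x hx μ).snd

/-- The solution of `-y'' + q y = μ y` with `y(0) = 1`, `y'(0) = 0`. -/
noncomputable def cosSol (hq : Continuous q) : ℂ → ℝ → ℂ := (exists_isSolutionFamily hq 1 0).choose

/-- The derivative of `cosSol`. -/
noncomputable def dcosSol (hq : Continuous q) : ℂ → ℝ → ℂ :=
  (exists_isSolutionFamily hq 1 0).choose_spec.choose

/-- The solution of `-y'' + q y = μ y` with `y(0) = 0`, `y'(0) = 1`. -/
noncomputable def sinSol (hq : Continuous q) : ℂ → ℝ → ℂ := (exists_isSolutionFamily hq 0 1).choose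

/-- The derivative of `sinSol`. -/
noncomputable def dsinSol (hq : Continuous q) : ℂ → ℝ → ℂ :=
  (exists_isSolutionFamily hq 0 1).choose_spec.choose

/-- The solution of `-y'' + q y = μ y` with `y(0) = v`, `y'(0) = w`. -/
noncomputable def ivpSol (hq : Continuous q) (v w μ : ℂ) (x : ℝ) : ℂ :=
  v * cosSol hq μ x + w * sinSol hq μ x

/-- The derivative of `ivpSol`. -/
noncomputable def divpSol (hq : Continuous q) (v w μ : ℂ) (x : ℝ) : ℂ :=
  v * dcosSol hq μ x + w * dsinSol hq μ x

lemma cosSol_spec (hq : Continuous q) :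
    IsSolutionFamily q 1 0 (cosSol hq) (dcosSol hq) :=
  (exists_isSolutionFamily hq 1 0).choose_spec.choose_spec

lemma sinSol_spec (hq : Continuous q) :
    IsSolutionFamily q 0 1 (sinSol hq) (dsinSol hq) :=
  (exists_isSolutionFamily hq 0 1).choose_spec.choose_spec

lemma ivpSol_zero (hq : Continuous q) (v w μ : ℂ) : ivpSol hq v w μ 0 = v := by
  have h1 : cosSol hq μ 0 = 1 := (cosSol_spec hq).zero μ
  have h2 : sinSol hq μ 0 = 0 := (sinSol_spec hq).zero μ
  simp [ivpSol, h1, h2]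

lemma divpSol_zero (hq : Continuous q) (v w μ : ℂ) : divpSol hq v w μ 0 = w := by
  have h1 : dcosSol hq μ 0 = 0 := (cosSol_spec hq).dzero μ
  have h2 : dsinSol hq μ 0 = 1 := (sinSol_spec hq).dzero μ
  simp [divpSol, h1, h2]

lemma hasDerivAt_ivpSol (hq : Continuous q) (v w μ : ℂ) {x : ℝ} (hx : x ∈ Icc (0 : ℝ) Real.pi) :
    HasDerivAt (ivpSol hq v w μ) (divpSol hq v w μ x) x :=
  (((cosSol_spec hq).hasDeriv μ x hx).const_mul v).add
    (((sinSol_spec hq).hasDeriv μ x hx).const_mul w)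

lemma hasDerivAt_divpSol (hq : Continuous q) (v w μ : ℂ) {x : ℝ} (hx : x ∈ Icc (0 : ℝ) Real.pi) :
    HasDerivAt (divpSol hq v w μ) ((q x - μ) * ivpSol hq v w μ x) x := by
  refine ((((cosSol_spec hq).hasDeriv' μ x hx).const_mul v).add
    (((sinSol_spec hq).hasDeriv' μ x hx).const_mul w)).congr_deriv ?_
  simp only [ivpSol]
  ring

lemma isSLSolution_ivpSol (hq : Continuous q) (v w μ : ℂ) :
    IsSLSolution q μ (ivpSol hq v w μ) (divpSol hq v w μ) := fun x hx =>
  ⟨(hasDerivAt_ivpSol hq v w μ hx).hasDerivWithinAt, _,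
    (hasDerivAt_divpSol hq v w μ hx).hasDerivWithinAt, by ring⟩

lemma continuous_ivpSol (hq : Continuous q) {v w : ℂ → ℂ} (hv : Continuous v)
    (hw : Continuous w) : Continuous fun p : ℂ × ℝ => ivpSol hq (v p.1) (w p.1) p.1 p.2 :=
  ((hv.comp continuous_fst).mul (cosSol_spec hq).cont).add
    ((hw.comp continuous_fst).mul (sinSol_spec hq).cont)

lemma continuous_ivpSol_apply (hq : Continuous q) (v w μ : ℂ) : Continuous (ivpSol hq v w μ) :=
  (continuous_ivpSol hq (v := fun _ => v) (w := fun _ => w) continuous_const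
    continuous_const).comp (continuous_const.prodMk continuous_id)

lemma continuous_divpSol_apply (hq : Continuous q) (v w μ : ℂ) :
    Continuous (divpSol hq v w μ) := by
  have h1 := (cosSol_spec hq).dcont.comp ((continuous_const (y := μ)).prodMk continuous_id)
  have h2 := (sinSol_spec hq).dcont.comp ((continuous_const (y := μ)).prodMk continuous_id)
  exact (continuous_const.mul h1).add (continuous_const.mul h2)

lemma differentiable_ivpSol (hq : Continuous q) {v w : ℂ → ℂ} (hv : Differentiable ℂ v)
    (hw : Differentiable ℂ w) {x : ℝ} (hx : x ∈ Icc (0 : ℝ) Real.pi) :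
    Differentiable ℂ fun μ => ivpSol hq (v μ) (w μ) μ x :=
  (hv.mul ((cosSol_spec hq).diff x hx)).add
    (hw.mul ((sinSol_spec hq).diff x hx))

lemma differentiable_divpSol (hq : Continuous q) {v w : ℂ → ℂ} (hv : Differentiable ℂ v)
    (hw : Differentiable ℂ w) {x : ℝ} (hx : x ∈ Icc (0 : ℝ) Real.pi) :
    Differentiable ℂ fun μ => divpSol hq (v μ) (w μ) μ x :=
  (hv.mul ((cosSol_spec hq).diff' x hx)).add
    (hw.mul ((sinSol_spec hq).diff' x hx))

/-- The Wronskian of two solutions of the same equation is constant. -/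
lemma IsSLSolution.wronskian_eq {μ : ℂ} {y dy u du : ℝ → ℂ} (hy : IsSLSolution q μ y dy)
    (hu : IsSLSolution q μ u du) {x : ℝ} (hx : x ∈ Icc (0 : ℝ) Real.pi) :
    y x * du x - dy x * u x = y 0 * du 0 - dy 0 * u 0 := by
  have hd : ∀ x ∈ Icc (0 : ℝ) Real.pi,
      HasDerivWithinAt (fun x => y x * du x - dy x * u x) 0 (Icc 0 Real.pi) x := by
    intro x hx
    obtain ⟨h1, d1, h2, e1⟩ := hy x hx
    obtain ⟨h3, d2, h4, e2⟩ := hu x hx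
    refine ((h1.mul h4).sub (h2.mul h3)).congr_deriv ?_
    linear_combination (u x) * e1 - (y x) * e2
  refine constant_of_derivWithin_zero (f := fun x => y x * du x - dy x * u x)
    (fun x hx => (hd x hx).differentiableWithinAt) (fun x hx => ?_) x hx
  exact (hd x ⟨hx.1, hx.2.le⟩).derivWithin
    (uniqueDiffOn_Icc Real.pi_pos x ⟨hx.1, hx.2.le⟩)

/-- Solutions are determined by their initial data. -/
lemma IsSLSolution.eq_ivpSol (hq : Continuous q) {μ : ℂ} {y dy : ℝ → ℂ}
    (hy : IsSLSolution q μ y dy) {x : ℝ} (hx : x ∈ Icc (0 : ℝ) Real.pi) :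
    y x = ivpSol hq (y 0) (dy 0) μ x ∧ dy x = divpSol hq (y 0) (dy 0) μ x := by
  have h1 := hy.wronskian_eq (isSLSolution_ivpSol hq 1 0 μ) hx
  have h2 := hy.wronskian_eq (isSLSolution_ivpSol hq 0 1 μ) hx
  have h3 := (isSLSolution_ivpSol hq 1 0 μ).wronskian_eq (isSLSolution_ivpSol hq 0 1 μ) hx
  simp only [ivpSol_zero, divpSol_zero] at h1 h2 h3
  simp only [ivpSol, divpSol, one_mul, zero_mul, add_zero, zero_add, mul_one, mul_zero,
    sub_zero, zero_sub] at h1 h2 h3 ⊢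
  -- `h3` says that the fundamental pair has Wronskian `1`; Cramer's rule applied to `h1` and `h2`
  -- then recovers `y` and `dy`.
  constructor
  · linear_combination (-y x) * h3 + (cosSol hq μ x) * h2 - (sinSol hq μ x) * h1
  · linear_combination (-dy x) * h3 + (dcosSol hq μ x) * h2 - (dsinSol hq μ x) * h1

/-- Since `q` is real, the conjugate of a solution for `μ` solves the equation for the conjugate
parameter; uniqueness does the rest. -/
lemma conj_ivpSol (hq : Continuous q) (v w μ : ℂ) {x : ℝ} (hx : x ∈ Icc (0 : ℝ) Real.pi) :
    starRingEnd ℂ (ivpSol hq v w μ x) =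
        ivpSol hq (starRingEnd ℂ v) (starRingEnd ℂ w) (starRingEnd ℂ μ) x ∧
      starRingEnd ℂ (divpSol hq v w μ x) =
        divpSol hq (starRingEnd ℂ v) (starRingEnd ℂ w) (starRingEnd ℂ μ) x := by
  have key : IsSLSolution q (starRingEnd ℂ μ) (fun x => starRingEnd ℂ (ivpSol hq v w μ x))
      (fun x => starRingEnd ℂ (divpSol hq v w μ x)) := by
    intro x hx
    refine ⟨(hasDerivAt_ivpSol hq v w μ hx).hasDerivWithinAt.star, _,
      (hasDerivAt_divpSol hq v w μ hx).hasDerivWithinAt.star, ?_⟩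
    have e : starRingEnd ℂ ((q x - μ) * ivpSol hq v w μ x) =
        (q x - starRingEnd ℂ μ) * starRingEnd ℂ (ivpSol hq v w μ x) := by simp
    change -(starRingEnd ℂ _) + _ = _
    rw [e]
    ring
  have := key.eq_ivpSol hq hx
  simpa only [ivpSol_zero, divpSol_zero] using this

/-- Lagrange's identity for solutions with different spectral parameters. -/
lemma wronskian_pi_sub (hq : Continuous q) (v w v' w' μ ν : ℂ) :
    (ivpSol hq v w μ Real.pi * divpSol hq v' w' ν Real.pi -
        divpSol hq v w μ Real.pi * ivpSol hq v' w' ν Real.pi) - (v * w' - w * v') =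
      (μ - ν) * ∫ x in (0 : ℝ)..Real.pi, ivpSol hq v w μ x * ivpSol hq v' w' ν x := by
  rw [← intervalIntegral.integral_const_mul]
  have hd : ∀ x ∈ uIcc (0 : ℝ) Real.pi,
      HasDerivAt (fun x => ivpSol hq v w μ x * divpSol hq v' w' ν x -
        divpSol hq v w μ x * ivpSol hq v' w' ν x)
        ((μ - ν) * (ivpSol hq v w μ x * ivpSol hq v' w' ν x)) x := by
    intro x hx
    rw [uIcc_of_le Real.pi_pos.le] at hx
    refine (((hasDerivAt_ivpSol hq v w μ hx).mul (hasDerivAt_divpSol hq v' w' ν hx)).sub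
      ((hasDerivAt_divpSol hq v w μ hx).mul (hasDerivAt_ivpSol hq v' w' ν hx))).congr_deriv ?_
    ring
  rw [intervalIntegral.integral_eq_sub_of_hasDerivAt hd]
  · simp only [ivpSol_zero, divpSol_zero]
  · exact (continuous_const.mul ((continuous_ivpSol_apply hq v w μ).mul
      (continuous_ivpSol_apply hq v' w' ν))).intervalIntegrable _ _

end Solutions

/-! ### The characteristic function: its zeros are the eigenvalues, and they are real and simple. -/

section CharacteristicFunction

variable {q : ℝ → ℝ}

/-- The value at `x` of the solution satisfying the boundary condition at `0`. -/
noncomputable def leftSol (hq : Continuous q) (h h₁ h₂ : ℝ) (μ : ℂ) (x : ℝ) : ℂ :=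
  ivpSol hq (μ - h₁) (μ * h - h₂) μ x

/-- The derivative of `leftSol`. -/
noncomputable def dleftSol (hq : Continuous q) (h h₁ h₂ : ℝ) (μ : ℂ) (x : ℝ) : ℂ :=
  divpSol hq (μ - h₁) (μ * h - h₂) μ x

/-- The characteristic function, whose zeros are the eigenvalues. -/
noncomputable def charFn (hq : Continuous q) (h h₁ h₂ H H₁ H₂ : ℝ) (μ : ℂ) : ℂ :=
  (μ - H₁) * dleftSol hq h h₁ h₂ μ Real.pi + (μ * H - H₂) * leftSol hq h h₁ h₂ μ Real.pi

variable {h h₁ h₂ H H₁ H₂ : ℝ}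

lemma differentiable_charFn (hq : Continuous q) :
    Differentiable ℂ (charFn hq h h₁ h₂ H H₁ H₂) := by
  have hv : Differentiable ℂ fun μ : ℂ => μ - h₁ := by fun_prop
  have hw : Differentiable ℂ fun μ : ℂ => μ * h - h₂ := by fun_prop
  have hV : Differentiable ℂ fun μ : ℂ => μ - H₁ := by fun_prop
  have hW : Differentiable ℂ fun μ : ℂ => μ * H - H₂ := by fun_prop
  exact (hV.mul (differentiable_divpSol hq hv hw pi_mem_Icc_pi)).add
    (hW.mul (differentiable_ivpSol hq hv hw pi_mem_Icc_pi))

lemma charFn_conj (hq : Continuous q) (μ : ℂ) :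
    charFn hq h h₁ h₂ H H₁ H₂ (starRingEnd ℂ μ) =
      starRingEnd ℂ (charFn hq h h₁ h₂ H H₁ H₂ μ) := by
  have h1 := conj_ivpSol hq (μ - h₁) (μ * h - h₂) μ pi_mem_Icc_pi
  simp only [map_sub, map_mul, Complex.conj_ofReal] at h1
  simp only [charFn, leftSol, dleftSol, map_add, map_mul, map_sub, Complex.conj_ofReal, h1]

/-- A common zero would force `μ = b` and `a * b = c`. Thus positivity of δ and ρ keeps each
boundary condition a nontrivial linear condition for every `μ`. -/
lemma linearForm_ne_zero {a b c : ℝ} (hab : 0 < a * b - c) (μ : ℂ) :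
    μ - b ≠ 0 ∨ μ * a - c ≠ 0 := by
  by_contra! hcon
  have h1 : ((a * b - c : ℝ) : ℂ) = 0 := by
    push_cast
    linear_combination hcon.2 - a * hcon.1
  exact hab.ne' (by exact_mod_cast h1)

/-- The kernel of a nonzero functional on ℂ² is a line. -/
lemma exists_eq_smul_of_mul_eq {a b y z : ℂ} (hab : a ≠ 0 ∨ b ≠ 0) (h : a * z = b * y) :
    ∃ k : ℂ, y = k * a ∧ z = k * b := by
  rcases hab with ha | hb
  · exact ⟨y / a, by field_simp, by field_simp; linear_combination h⟩
  · exact ⟨z / b, by field_simp; linear_combination -h, by field_simp⟩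

/-- The condition at `0` makes the initial data proportional to `(μ - h₁, μ h - h₂)`, so every
eigenfunction is a multiple of `leftSol`. Conversely `leftSol` is not identically zero, since its
initial data do not both vanish. -/
lemma isSLEigenvalue_iff (hq : Continuous q) (hδ : 0 < h * h₁ - h₂) (μ : ℂ) :
    IsSLEigenvalue q h h₁ h₂ H H₁ H₂ μ ↔ charFn hq h h₁ h₂ H H₁ H₂ μ = 0 := by
  constructor
  · rintro ⟨y, dy, hy, hb0, hbpi, x, hx, hne⟩
    obtain ⟨k, hk1, hk2⟩ := exists_eq_smul_of_mul_eq (linearForm_ne_zero hδ μ)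
      (y := y 0) (z := dy 0) (by linear_combination hb0)
    have hyx := fun x hx => hy.eq_ivpSol hq (x := x) hx
    have hscale : ∀ x, ivpSol hq (y 0) (dy 0) μ x = k * leftSol hq h h₁ h₂ μ x ∧
        divpSol hq (y 0) (dy 0) μ x = k * dleftSol hq h h₁ h₂ μ x := by
      intro x
      simp only [leftSol, dleftSol, ivpSol, divpSol, hk1, hk2]
      constructor <;> ring
    have hk : k ≠ 0 := by
      rintro rfl
      exact hne (by rw [(hyx x hx).1, (hscale x).1, zero_mul])
    rw [(hyx _ pi_mem_Icc_pi).1, (hyx _ pi_mem_Icc_pi).2, (hscale _).1, (hscale _).2] at hbpi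
    refine (mul_eq_zero.1 (?_ : k * _ = 0)).resolve_left hk
    rw [charFn]
    linear_combination hbpi
  · intro h0
    refine ⟨leftSol hq h h₁ h₂ μ, dleftSol hq h h₁ h₂ μ, isSLSolution_ivpSol hq _ _ μ, ?_, ?_, ?_⟩
    · simp only [leftSol, dleftSol, ivpSol_zero, divpSol_zero]
      ring
    · rw [charFn] at h0
      linear_combination h0
    · by_contra! hcon
      have h1 := hcon 0 zero_mem_Icc_pi
      have h2 : HasDerivWithinAt (leftSol hq h h₁ h₂ μ) 0 (Icc 0 Real.pi) 0 :=
        (hasDerivWithinAt_const (0 : ℝ) (Icc 0 Real.pi) (0 : ℂ)).congr hcon h1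
      have h3 := (uniqueDiffOn_Icc Real.pi_pos 0 zero_mem_Icc_pi).eq_deriv _ h2
        (hasDerivAt_ivpSol hq (μ - h₁) (μ * h - h₂) μ zero_mem_Icc_pi).hasDerivWithinAt
      rw [divpSol_zero] at h3
      rw [leftSol, ivpSol_zero] at h1
      exact (linearForm_ne_zero hδ μ).elim (fun h => h h1) (fun h => h h3.symm)

/-- At a zero `ν`, the characteristic function is expressed through Lagrange's identity. -/
lemma exists_charFn_identity (hq : Continuous q) (hρ : 0 < H * H₁ - H₂) {ν : ℂ}
    (hν : charFn hq h h₁ h₂ H H₁ H₂ ν = 0) :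
    ∃ k : ℂ, leftSol hq h h₁ h₂ ν Real.pi = k * (ν - H₁) ∧
      dleftSol hq h h₁ h₂ ν Real.pi = -(k * (ν * H - H₂)) ∧
      ∀ μ, -k * charFn hq h h₁ h₂ H H₁ H₂ μ = (μ - ν) * ((h * h₁ - h₂) +
        (∫ x in (0 : ℝ)..Real.pi, leftSol hq h h₁ h₂ μ x * leftSol hq h h₁ h₂ ν x) -
        k * (dleftSol hq h h₁ h₂ μ Real.pi + H * leftSol hq h h₁ h₂ μ Real.pi)) := by
  -- At a zero the pair `(leftSol, -dleftSol)` at `π` is a multiple `k` of `(ν - H₁, ν H - H₂)`;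
  -- then `-k * charFn μ` is, up to a multiple of `μ - ν`, the Wronskian at `π`.
  obtain ⟨k, hk1, hk2⟩ := exists_eq_smul_of_mul_eq (linearForm_ne_zero hρ ν)
    (y := leftSol hq h h₁ h₂ ν Real.pi) (z := -dleftSol hq h h₁ h₂ ν Real.pi)
    (by rw [charFn] at hν; linear_combination -hν)
  have hk3 : dleftSol hq h h₁ h₂ ν Real.pi = -(k * (ν * H - H₂)) := by
    linear_combination -hk2
  refine ⟨k, hk1, hk3, fun μ => ?_⟩
  have h1 := wronskian_pi_sub hq (μ - h₁) (μ * h - h₂) (ν - h₁) (ν * h - h₂) μ ν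
  simp only [← leftSol.eq_1, ← dleftSol.eq_1] at h1
  rw [hk1, hk3] at h1
  rw [charFn]
  linear_combination h1

lemma leftSol_conj (hq : Continuous q) (μ : ℂ) {x : ℝ} (hx : x ∈ Icc (0 : ℝ) Real.pi) :
    leftSol hq h h₁ h₂ (starRingEnd ℂ μ) x = starRingEnd ℂ (leftSol hq h h₁ h₂ μ x) ∧
      dleftSol hq h h₁ h₂ (starRingEnd ℂ μ) x = starRingEnd ℂ (dleftSol hq h h₁ h₂ μ x) := by
  have h1 := conj_ivpSol hq (μ - h₁) (μ * h - h₂) μ hx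
  simp only [map_sub, map_mul, Complex.conj_ofReal] at h1
  exact ⟨h1.1.symm, h1.2.symm⟩

lemma integral_conj_mul_self (hq : Continuous q) (ν : ℂ) :
    ∃ r : ℝ, 0 ≤ r ∧ (∫ x in (0 : ℝ)..Real.pi,
      leftSol hq h h₁ h₂ (starRingEnd ℂ ν) x * leftSol hq h h₁ h₂ ν x) = r := by
  refine ⟨∫ x in (0 : ℝ)..Real.pi, ‖leftSol hq h h₁ h₂ ν x‖ ^ 2,
    intervalIntegral.integral_nonneg Real.pi_pos.le fun x _ => by positivity, ?_⟩
  rw [← intervalIntegral.integral_ofReal]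
  refine intervalIntegral.integral_congr fun x hx => ?_
  rw [uIcc_of_le Real.pi_pos.le] at hx
  simp only [(leftSol_conj hq ν hx).1]
  rw [← Complex.normSq_eq_norm_sq, Complex.normSq_eq_conj_mul_self]

/-- The zeros of the characteristic function are real. -/
lemma conj_eq_of_charFn_eq_zero (hq : Continuous q) (hδ : 0 < h * h₁ - h₂)
    (hρ : 0 < H * H₁ - H₂) {ν : ℂ} (hν : charFn hq h h₁ h₂ H H₁ H₂ ν = 0) :
    starRingEnd ℂ ν = ν := by
  obtain ⟨k, hk1, hk2, hk⟩ := exists_charFn_identity hq hρ hν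
  obtain ⟨r, hr0, hr⟩ := integral_conj_mul_self (h := h) (h₁ := h₁) (h₂ := h₂) hq ν
  -- At `μ = conj ν` the left side vanishes, because `charFn` commutes with conjugation, while the
  -- second factor on the right is δ + ∫|φ|² + |k|²ρ > 0.
  have h1 := hk (starRingEnd ℂ ν)
  rw [charFn_conj, hν, map_zero, mul_zero, hr, (leftSol_conj hq ν pi_mem_Icc_pi).1,
    (leftSol_conj hq ν pi_mem_Icc_pi).2, hk1, hk2] at h1
  have h2 : ((h * h₁ - h₂ : ℝ) : ℂ) + r - k * (starRingEnd ℂ (-(k * (ν * H - H₂))) +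
      H * starRingEnd ℂ (k * (ν - H₁))) =
      ((h * h₁ - h₂ + r + Complex.normSq k * (H * H₁ - H₂) : ℝ) : ℂ) := by
    push_cast
    rw [Complex.normSq_eq_conj_mul_self]
    simp only [map_neg, map_mul, map_sub, Complex.conj_ofReal]
    ring
  push_cast at h1 h2
  rw [h2] at h1
  have h3 : (0 : ℝ) < h * h₁ - h₂ + r + Complex.normSq k * (H * H₁ - H₂) := by
    have := Complex.normSq_nonneg k
    positivity
  refine sub_eq_zero.1 ((mul_eq_zero.1 h1.symm).resolve_right ?_)
  exact_mod_cast h3.ne'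

/-- The zeros of the characteristic function are simple. -/
lemma deriv_charFn_ne_zero (hq : Continuous q) (hδ : 0 < h * h₁ - h₂)
    (hρ : 0 < H * H₁ - H₂) {ν : ℂ} (hν : charFn hq h h₁ h₂ H H₁ H₂ ν = 0) :
    deriv (charFn hq h h₁ h₂ H H₁ H₂) ν ≠ 0 := by
  have hreal := conj_eq_of_charFn_eq_zero hq hδ hρ hν
  obtain ⟨k, hk1, hk2, hk⟩ := exists_charFn_identity hq hρ hν
  obtain ⟨r, hr0, hr⟩ := integral_conj_mul_self (h := h) (h₁ := h₁) (h₂ := h₂) hq ν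
  rw [hreal] at hr
  intro hd
  -- The identity reads `-k f(μ) = (μ - ν) g(μ)`, so continuity of `g` alone identifies the
  -- derivative of `-k f` at `ν` with `g ν`; no differentiation under the integral is needed.
  set g : ℂ → ℂ := fun μ => (h * h₁ - h₂) +
        (∫ x in (0 : ℝ)..Real.pi, leftSol hq h h₁ h₂ μ x * leftSol hq h h₁ h₂ ν x) -
        k * (dleftSol hq h h₁ h₂ μ Real.pi + H * leftSol hq h h₁ h₂ μ Real.pi) with hg
  have hv : Differentiable ℂ fun μ : ℂ => μ - h₁ := by fun_prop
  have hw : Differentiable ℂ fun μ : ℂ => μ * h - h₂ := by fun_prop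
  have hgc : Continuous g := by
    have h1 : Continuous fun μ => ∫ x in (0 : ℝ)..Real.pi,
        leftSol hq h h₁ h₂ μ x * leftSol hq h h₁ h₂ ν x := by
      refine intervalIntegral.continuous_parametric_intervalIntegral_of_continuous
        (f := fun μ x => leftSol hq h h₁ h₂ μ x * leftSol hq h h₁ h₂ ν x) ?_ continuous_const
      exact (continuous_ivpSol hq hv.continuous hw.continuous).mul
        ((continuous_ivpSol_apply hq _ _ ν).comp continuous_snd)
    have h2 := (differentiable_ivpSol hq hv hw pi_mem_Icc_pi).continuous
    have h3 := (differentiable_divpSol hq hv hw pi_mem_Icc_pi).continuous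
    exact (continuous_const.add h1).sub
      (continuous_const.mul (h3.add (continuous_const.mul h2)))
  have h1 : HasDerivAt (fun μ => -k * charFn hq h h₁ h₂ H H₁ H₂ μ) (-k * 0) ν := by
    have := ((differentiable_charFn (h := h) (h₁ := h₁) (h₂ := h₂) (H := H) (H₁ := H₁)
      (H₂ := H₂) hq) ν).hasDerivAt
    rw [hd] at this
    exact this.const_mul _
  have h2 : HasDerivAt (fun μ => -k * charFn hq h h₁ h₂ H H₁ H₂ μ) (g ν) ν := by
    rw [hasDerivAt_iff_tendsto_slope]
    refine ((hgc.tendsto ν).mono_left nhdsWithin_le_nhds).congr' ?_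
    filter_upwards [self_mem_nhdsWithin] with μ hμ
    rw [slope_def_field, hk μ, hν, mul_zero, sub_zero, mul_div_cancel_left₀]
    exact sub_ne_zero.2 hμ
  have h3 := h1.unique h2
  rw [mul_zero, hg] at h3
  simp only [hr, hk1, hk2] at h3
  have hkk : (starRingEnd ℂ k) * (ν - H₁) = k * (ν - H₁) ∧
      (starRingEnd ℂ k) * (ν * H - H₂) = k * (ν * H - H₂) := by
    have e := leftSol_conj (h := h) (h₁ := h₁) (h₂ := h₂) hq ν pi_mem_Icc_pi
    rw [hreal, hk1, hk2] at e
    simp only [map_neg, map_mul, map_sub, Complex.conj_ofReal, hreal] at e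
    exact ⟨e.1.symm, by linear_combination e.2⟩
  -- For real `ν` the solution is real, hence so is `k`; this turns the `k ^ 2` occurring in `g ν`
  -- into `|k|²`.
  have hkreal : starRingEnd ℂ k = k := by
    rcases linearForm_ne_zero hρ ν with hne | hne
    · exact mul_right_cancel₀ hne hkk.1
    · exact mul_right_cancel₀ hne hkk.2
  have h4 : ((h * h₁ - h₂ + r + Complex.normSq k * (H * H₁ - H₂) : ℝ) : ℂ) = 0 := by
    push_cast
    rw [Complex.normSq_eq_conj_mul_self, hkreal]
    linear_combination -h3
  have h5 : (0 : ℝ) < h * h₁ - h₂ + r + Complex.normSq k * (H * H₁ - H₂) := by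
    have := Complex.normSq_nonneg k
    positivity
  exact h5.ne' (by exact_mod_cast h4)

end CharacteristicFunction

/-! ### The exponential solution: a priori bounds for its two components. -/

section Asymptotics

/-- Variation of constants. -/
lemma variation_of_constants {f K k r : ℝ → ℂ}
    (hK : ∀ x ∈ Icc (0 : ℝ) Real.pi, HasDerivAt K (k x) x)
    (hf : ∀ x ∈ Icc (0 : ℝ) Real.pi, HasDerivAt f (k x * f x + r x) x)
    (hr : ContinuousOn r (Icc (0 : ℝ) Real.pi)) {x : ℝ} (hx : x ∈ Icc (0 : ℝ) Real.pi) :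
    f x = Complex.exp (K x - K 0) * f 0 +
      ∫ t in (0 : ℝ)..x, Complex.exp (K x - K t) * r t := by
  have hsub : uIcc 0 x ⊆ Icc (0 : ℝ) Real.pi := by
    rw [uIcc_of_le hx.1]; exact Icc_subset_Icc_right hx.2
  have hKc : ContinuousOn K (Icc (0 : ℝ) Real.pi) := fun y hy =>
    (hK y hy).continuousAt.continuousWithinAt
  have h1 : ∀ t ∈ uIcc 0 x, HasDerivAt (fun t => Complex.exp (K x - K t) * f t)
      (Complex.exp (K x - K t) * r t) t := by
    intro t ht
    refine ((((hK t (hsub ht)).const_sub (K x)).cexp).mul (hf t (hsub ht))).congr_deriv ?_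
    ring
  rw [intervalIntegral.integral_eq_sub_of_hasDerivAt h1]
  · simp
  · refine ContinuousOn.intervalIntegrable (ContinuousOn.mul ?_ (hr.mono hsub))
    exact Complex.continuous_exp.comp_continuousOn (continuousOn_const.sub (hKc.mono hsub))

/-- The weights exp(τ(x - t)) and exp(τt) multiply to one independent of `t`, so the
variation-of-constants integral costs only a factor `π`. All remainder bounds below for the two
components come from here. -/
lemma norm_sub_exp_mul_le {f K k r : ℝ → ℂ}
    (hK : ∀ x ∈ Icc (0 : ℝ) Real.pi, HasDerivAt K (k x) x)
    (hf : ∀ x ∈ Icc (0 : ℝ) Real.pi, HasDerivAt f (k x * f x + r x) x)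
    (hr : ContinuousOn r (Icc (0 : ℝ) Real.pi)) {τ D B : ℝ} (hD0 : 0 ≤ D)
    (hD : ∀ x ∈ Icc (0 : ℝ) Real.pi, ∀ t ∈ Icc 0 x,
      ‖Complex.exp (K x - K t)‖ ≤ D * Real.exp (τ * (x - t)))
    (hB : ∀ t ∈ Icc (0 : ℝ) Real.pi, ‖r t‖ ≤ B * Real.exp (τ * t))
    {x : ℝ} (hx : x ∈ Icc (0 : ℝ) Real.pi) :
    ‖f x - Complex.exp (K x - K 0) * f 0‖ ≤ Real.pi * D * B * Real.exp (τ * x) := by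
  have hB0 : 0 ≤ B := by
    have := (norm_nonneg _).trans (hB 0 zero_mem_Icc_pi)
    simpa using this
  rw [variation_of_constants hK hf hr hx, add_sub_cancel_left]
  refine (intervalIntegral.norm_integral_le_of_norm_le_const
    (C := D * B * Real.exp (τ * x)) fun t ht => ?_).trans ?_
  · rw [uIoc_of_le hx.1] at ht
    rw [norm_mul]
    calc _ ≤ (D * Real.exp (τ * (x - t))) * (B * Real.exp (τ * t)) := by
          gcongr
          · exact hD x hx t ⟨ht.1.le, ht.2⟩
          · exact hB t ⟨ht.1.le, ht.2.trans hx.2⟩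
      _ = D * B * (Real.exp (τ * (x - t)) * Real.exp (τ * t)) := by ring
      _ = _ := by rw [← Real.exp_add]; ring_nf
  · rw [sub_zero, abs_of_nonneg hx.1]
    have := hx.2
    have h0 : 0 ≤ D * B * Real.exp (τ * x) := by positivity
    nlinarith

lemma norm_exp_mul_sub_le (z : ℂ) {x t : ℝ} (ht : |t| ≤ x) :
    ‖Complex.exp (z * t)‖ ≤ Real.exp (|z.re| * x) := by
  rw [Complex.norm_exp]
  refine Real.exp_le_exp.2 ?_
  have h1 : (z * t).re = z.re * t := by simp
  rw [h1]
  calc z.re * t ≤ |z.re * t| := le_abs_self _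
    _ = |z.re| * |t| := abs_mul _ _
    _ ≤ _ := by gcongr

/-- Integration by parts of an absolutely continuous function against a smooth one. -/
lemma integral_deriv_mul_add {q : ℝ → ℝ} (hac : AbsolutelyContinuousOnInterval q 0 Real.pi)
    (hqc : Continuous q)
    {E E' : ℝ → ℂ} (hE : ∀ t, HasDerivAt E (E' t) t) (hE' : Continuous E') {x : ℝ}
    (hx : x ∈ Icc (0 : ℝ) Real.pi) :
    (∫ t in (0 : ℝ)..x, ((deriv q t : ℝ) : ℂ) * E t) + (∫ t in (0 : ℝ)..x, (q t : ℂ) * E' t) =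
      q x * E x - q 0 * E 0 := by
  have hsub : uIcc 0 x ⊆ uIcc (0 : ℝ) Real.pi := by
    rw [uIcc_of_le hx.1, uIcc_of_le Real.pi_pos.le]; exact Icc_subset_Icc_right hx.2
  have hacx := hac.mono hsub
  have hEc : Continuous E := continuous_iff_continuousAt.2 fun t => (hE t).continuousAt
  have hderiv : deriv E = E' := funext fun t => (hE t).deriv
  have hre : ∀ t, HasDerivAt (fun t => (E t).re) (E' t).re t := fun t =>
    (Complex.reCLM.hasFDerivAt.comp_hasDerivAt t (hE t)).congr_deriv (by simp)
  have him : ∀ t, HasDerivAt (fun t => (E t).im) (E' t).im t := fun t =>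
    (Complex.imCLM.hasFDerivAt.comp_hasDerivAt t (hE t)).congr_deriv (by simp)
  have hacr : AbsolutelyContinuousOnInterval (fun t => (E t).re) 0 x := by
    refine (ContDiff.contDiffOn ?_).absolutelyContinuousOnInterval
    refine contDiff_one_iff_deriv.2 ⟨fun t => (hre t).differentiableAt, ?_⟩
    rw [funext fun t => (hre t).deriv]
    exact Complex.continuous_re.comp hE'
  have haci : AbsolutelyContinuousOnInterval (fun t => (E t).im) 0 x := by
    refine (ContDiff.contDiffOn ?_).absolutelyContinuousOnInterval
    refine contDiff_one_iff_deriv.2 ⟨fun t => (him t).differentiableAt, ?_⟩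
    rw [funext fun t => (him t).deriv]
    exact Complex.continuous_im.comp hE'
  have hint : IntervalIntegrable (deriv q) volume 0 x := hacx.intervalIntegrable_deriv
  have hintc : IntervalIntegrable (fun t => ((deriv q t : ℝ) : ℂ)) volume 0 x :=
    ⟨hint.1.ofReal, hint.2.ofReal⟩
  have hI1 : IntervalIntegrable (fun t => ((deriv q t : ℝ) : ℂ) * E t) volume 0 x :=
    hintc.mul_continuousOn hEc.continuousOn
  have hI2 : IntervalIntegrable (fun t => (q t : ℂ) * E' t) volume 0 x :=
    ((Complex.continuous_ofReal.comp hqc).mul hE').intervalIntegrable _ _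
  rw [← intervalIntegral.integral_add hI1 hI2]
  have hI3 := hI1.add hI2
  have h1 := hacx.integral_deriv_mul_eq_sub hacr
  have h2 := hacx.integral_deriv_mul_eq_sub haci
  have e1 := Complex.reCLM.intervalIntegral_comp_comm hI3
  have e2 := Complex.imCLM.intervalIntegral_comp_comm hI3
  apply Complex.ext
  · simp only [Complex.reCLM_apply] at e1
    rw [← e1]
    simp only [Complex.sub_re, Complex.re_ofReal_mul]
    rw [← h1]
    refine intervalIntegral.integral_congr fun t _ => ?_
    simp [(hre t).deriv]
  · simp only [Complex.imCLM_apply] at e2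
    rw [← e2]
    simp only [Complex.sub_im, Complex.im_ofReal_mul]
    rw [← h2]
    refine intervalIntegral.integral_congr fun t _ => ?_
    simp [(him t).deriv]

variable {q : ℝ → ℝ}

/-- The solution of `-y'' + q y = -z² y` with `y(0) = 1`, `y'(0) = z`. -/
noncomputable def expSol (hq : Continuous q) (z : ℂ) (x : ℝ) : ℂ := ivpSol hq 1 z (-z ^ 2) x

/-- The derivative of `expSol`. -/
noncomputable def dexpSol (hq : Continuous q) (z : ℂ) (x : ℝ) : ℂ := divpSol hq 1 z (-z ^ 2) x

/-- The component of `expSol` that behaves like `exp (z x)`. -/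
noncomputable def ampPlus (hq : Continuous q) (z : ℂ) (x : ℝ) : ℂ :=
  (dexpSol hq z x + z * expSol hq z x) / (2 * z)

/-- The component of `expSol` that behaves like `exp (-z x)`, with the opposite sign. -/
noncomputable def ampMinus (hq : Continuous q) (z : ℂ) (x : ℝ) : ℂ :=
  (dexpSol hq z x - z * expSol hq z x) / (2 * z)

lemma expSol_eq (hq : Continuous q) {z : ℂ} (hz : z ≠ 0) (x : ℝ) :
    expSol hq z x = ampPlus hq z x - ampMinus hq z x := by
  simp only [ampPlus, ampMinus]; field_simp; ring

lemma ampPlus_zero (hq : Continuous q) {z : ℂ} (hz : z ≠ 0) : ampPlus hq z 0 = 1 := by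
  simp only [ampPlus, expSol, dexpSol, ivpSol_zero, divpSol_zero]; field_simp; ring

lemma ampMinus_zero (hq : Continuous q) (z : ℂ) : ampMinus hq z 0 = 0 := by
  simp [ampMinus, expSol, dexpSol, ivpSol_zero, divpSol_zero]

lemma hasDerivAt_ampPlus (hq : Continuous q) {z : ℂ} (hz : z ≠ 0) {x : ℝ}
    (hx : x ∈ Icc (0 : ℝ) Real.pi) :
    HasDerivAt (ampPlus hq z) (z * ampPlus hq z x + q x * expSol hq z x / (2 * z)) x := by
  refine (((hasDerivAt_divpSol hq 1 z (-z ^ 2) hx).add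
    ((hasDerivAt_ivpSol hq 1 z (-z ^ 2) hx).const_mul z)).div_const (2 * z)).congr_deriv ?_
  simp only [ampPlus, expSol, dexpSol]
  field_simp
  ring

lemma hasDerivAt_ampMinus (hq : Continuous q) {z : ℂ} (hz : z ≠ 0) {x : ℝ}
    (hx : x ∈ Icc (0 : ℝ) Real.pi) :
    HasDerivAt (ampMinus hq z) (-z * ampMinus hq z x + q x * expSol hq z x / (2 * z)) x := by
  refine (((hasDerivAt_divpSol hq 1 z (-z ^ 2) hx).sub
    ((hasDerivAt_ivpSol hq 1 z (-z ^ 2) hx).const_mul z)).div_const (2 * z)).congr_deriv ?_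
  simp only [ampMinus, expSol, dexpSol]
  field_simp
  ring

lemma continuous_expSol (hq : Continuous q) (z : ℂ) : Continuous (expSol hq z) :=
  continuous_ivpSol_apply hq _ _ _

lemma continuous_ampMinus (hq : Continuous q) (z : ℂ) : Continuous (ampMinus hq z) :=
  ((continuous_divpSol_apply hq _ _ _).sub
    (continuous_const.mul (continuous_ivpSol_apply hq _ _ _))).div_const _

lemma hasDerivAt_const_mul_ofReal (z : ℂ) (x : ℝ) : HasDerivAt (fun t : ℝ => z * t) z x := by
  simpa using (Complex.ofRealCLM.hasFDerivAt.comp_hasDerivAt x (hasDerivAt_id x)).const_mul z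

lemma norm_exp_mul_sub_mul_le (z : ℂ) {x t : ℝ} (ht : t ∈ Icc 0 x) :
    ‖Complex.exp (z * x - z * t)‖ ≤ 1 * Real.exp (|z.re| * (x - t)) := by
  have := norm_exp_mul_sub_le z (x := x - t) (t := x - t) (by rw [abs_of_nonneg]; linarith [ht.2])
  rw [one_mul]
  convert this using 3
  push_cast; ring

lemma exists_bound_on_Icc_pi (hq : Continuous q) :
    ∃ M, 0 ≤ M ∧ ∀ x ∈ Icc (0 : ℝ) Real.pi, ‖(q x : ℂ)‖ ≤ M := by
  obtain ⟨M, hM⟩ := isCompact_Icc.exists_bound_of_continuousOn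
    (s := Icc (0 : ℝ) Real.pi) (Complex.continuous_ofReal.comp hq).continuousOn
  exact ⟨M, (norm_nonneg _).trans (hM 0 zero_mem_Icc_pi), hM⟩

/-- A bootstrap: if N is the maximum of `‖expSol‖` divided by the weight, the integral equations
return N ≤ 1 + πMN/‖z‖. The threshold `2πM ≤ ‖z‖` makes the last term at most N/2, so N ≤ 2;
inserting this bound once more gives the other two estimates. -/
lemma norm_ampPlus_ampMinus_le (hq : Continuous q) {M : ℝ}
    (hM : ∀ x ∈ Icc (0 : ℝ) Real.pi, ‖(q x : ℂ)‖ ≤ M) {z : ℂ} (hz0 : z ≠ 0)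
    (hz : 2 * Real.pi * M ≤ ‖z‖) {x : ℝ} (hx : x ∈ Icc (0 : ℝ) Real.pi) :
    ‖expSol hq z x‖ ≤ 2 * Real.exp (|z.re| * x) ∧
    ‖ampPlus hq z x - Complex.exp (z * x)‖ ≤ Real.pi * M / ‖z‖ * Real.exp (|z.re| * x) ∧
    ‖ampMinus hq z x‖ ≤ Real.pi * M / ‖z‖ * Real.exp (|z.re| * x) := by
  have hM0 : 0 ≤ M := (norm_nonneg _).trans (hM 0 zero_mem_Icc_pi)
  have hzpos : 0 < ‖z‖ := norm_pos_iff.2 hz0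
  have hJc := continuous_expSol hq z
  set τ := |z.re| with hτ
  have key : ∀ N : ℝ, (∀ x ∈ Icc (0 : ℝ) Real.pi, ‖expSol hq z x‖ ≤ N * Real.exp (τ * x)) →
      ∀ x ∈ Icc (0 : ℝ) Real.pi,
      ‖ampPlus hq z x - Complex.exp (z * x)‖ ≤
        Real.pi * (M * N / (2 * ‖z‖)) * Real.exp (τ * x) ∧
      ‖ampMinus hq z x‖ ≤ Real.pi * (M * N / (2 * ‖z‖)) * Real.exp (τ * x) := by
    intro N hN x hx
    have hB : ∀ t ∈ Icc (0 : ℝ) Real.pi, ‖(q t : ℂ) * expSol hq z t / (2 * z)‖ ≤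
        M * N / (2 * ‖z‖) * Real.exp (τ * t) := by
      intro t ht
      rw [norm_div, norm_mul, norm_mul, Complex.norm_ofNat, div_mul_eq_mul_div, mul_assoc]
      have h1 := hM t ht
      have h2 := hN t ht
      gcongr
    have hr : ContinuousOn (fun t => (q t : ℂ) * expSol hq z t / (2 * z))
        (Icc (0 : ℝ) Real.pi) :=
      (((Complex.continuous_ofReal.comp hq).mul hJc).div_const _).continuousOn
    constructor
    · have := norm_sub_exp_mul_le (K := fun t : ℝ => z * t) (k := fun _ => z)
        (fun x _ => hasDerivAt_const_mul_ofReal z x)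
        (fun x hx => hasDerivAt_ampPlus hq hz0 hx) hr zero_le_one
        (fun x _ t ht => norm_exp_mul_sub_mul_le z ht) hB hx
      simpa [ampPlus_zero hq hz0] using this
    · have := norm_sub_exp_mul_le (K := fun t : ℝ => -z * t) (k := fun _ => -z) (τ := τ)
        (fun x _ => hasDerivAt_const_mul_ofReal (-z) x)
        (fun x hx => hasDerivAt_ampMinus hq hz0 hx) hr zero_le_one
        (fun x _ t ht => by simpa [hτ] using norm_exp_mul_sub_mul_le (-z) ht) hB hx
      simpa [ampMinus_zero hq] using this
  have hJ : ∀ x ∈ Icc (0 : ℝ) Real.pi, ‖expSol hq z x‖ ≤ 2 * Real.exp (τ * x) := by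
    obtain ⟨x₀, hx₀, hmax⟩ := isCompact_Icc.exists_isMaxOn
      (s := Icc (0 : ℝ) Real.pi) (f := fun x => ‖expSol hq z x‖ * Real.exp (-(τ * x)))
      ⟨0, zero_mem_Icc_pi⟩ (by fun_prop)
    set N := ‖expSol hq z x₀‖ * Real.exp (-(τ * x₀)) with hN
    have hNle : ∀ x ∈ Icc (0 : ℝ) Real.pi, ‖expSol hq z x‖ ≤ N * Real.exp (τ * x) := by
      intro x hx
      have h1 : ‖expSol hq z x‖ * Real.exp (-(τ * x)) ≤ N := hmax hx
      calc ‖expSol hq z x‖ = ‖expSol hq z x‖ * Real.exp (-(τ * x)) * Real.exp (τ * x) := by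
            rw [mul_assoc, ← Real.exp_add]; simp
        _ ≤ _ := by gcongr
    obtain ⟨h1, h2⟩ := key N hNle x₀ hx₀
    have h3 : ‖Complex.exp (z * x₀)‖ ≤ Real.exp (τ * x₀) :=
      norm_exp_mul_sub_le z (by rw [abs_of_nonneg hx₀.1])
    have h4 : ‖expSol hq z x₀‖ ≤
        (1 + Real.pi * (M * N / ‖z‖)) * Real.exp (τ * x₀) := by
      rw [expSol_eq hq hz0]
      calc ‖ampPlus hq z x₀ - ampMinus hq z x₀‖
          = ‖(ampPlus hq z x₀ - Complex.exp (z * x₀)) + Complex.exp (z * x₀) -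
              ampMinus hq z x₀‖ := by ring_nf
        _ ≤ ‖ampPlus hq z x₀ - Complex.exp (z * x₀)‖ + ‖Complex.exp (z * x₀)‖ +
              ‖ampMinus hq z x₀‖ := (norm_sub_le _ _).trans (by gcongr; exact norm_add_le _ _)
        _ ≤ Real.pi * (M * N / (2 * ‖z‖)) * Real.exp (τ * x₀) + Real.exp (τ * x₀) +
              Real.pi * (M * N / (2 * ‖z‖)) * Real.exp (τ * x₀) := by gcongr
        _ = _ := by field_simp; ring
    have h5 : N ≤ 1 + Real.pi * (M * N / ‖z‖) := by
      calc N ≤ (1 + Real.pi * (M * N / ‖z‖)) * Real.exp (τ * x₀) * Real.exp (-(τ * x₀)) := by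
            rw [hN]; gcongr
        _ = _ := by rw [mul_assoc, ← Real.exp_add]; simp
    have hN0 : 0 ≤ N := by positivity
    have h6 : Real.pi * (M * N / ‖z‖) ≤ N / 2 := by
      rw [← mul_div_assoc, div_le_iff₀ hzpos]
      nlinarith
    intro x hx
    refine (hNle x hx).trans ?_
    gcongr
    linarith
  obtain ⟨h1, h2⟩ := key 2 hJ x hx
  refine ⟨hJ x hx, h1.trans (le_of_eq ?_), h2.trans (le_of_eq ?_)⟩ <;> field_simp

end Asymptotics

/-! ### The two components up to third order in 1/z, by one integration by parts. -/

section AsymptoticsRefined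

variable {q : ℝ → ℝ}

/-- The two exponentials combine to exp(z(2t - x)), and `|2t - x| ≤ x` on the range of integration.
-/
lemma norm_exp_mul_integral_le {g : ℝ → ℂ} (hg : IntervalIntegrable g volume 0 Real.pi)
    {p : ℝ → ℂ} {D : ℝ} (z : ℂ) {x : ℝ} (hx : x ∈ Icc (0 : ℝ) Real.pi)
    (hp : ∀ t ∈ Icc 0 x, ‖p t‖ ≤ D) :
    ‖Complex.exp (-z * x) * ∫ t in (0 : ℝ)..x, g t * (Complex.exp (2 * z * t) * p t)‖ ≤
      D * Real.exp (|z.re| * x) * ∫ t in (0 : ℝ)..Real.pi, ‖g t‖ := by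
  have hD0 : 0 ≤ D := (norm_nonneg _).trans (hp 0 ⟨le_rfl, hx.1⟩)
  have hsub : uIcc 0 x ⊆ uIcc (0 : ℝ) Real.pi := by
    rw [uIcc_of_le hx.1, uIcc_of_le Real.pi_pos.le]; exact Icc_subset_Icc_right hx.2
  rw [← intervalIntegral.integral_const_mul]
  refine (intervalIntegral.norm_integral_le_of_norm_le
    (g := fun t => D * Real.exp (|z.re| * x) * ‖g t‖) hx.1
    (Filter.Eventually.of_forall fun t ht => ?_) ?_).trans ?_
  · have h1 : Complex.exp (-z * x) * (g t * (Complex.exp (2 * z * t) * p t)) =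
        Complex.exp (z * ((2 * t - x : ℝ) : ℂ)) * p t * g t := by
      have : z * ((2 * t - x : ℝ) : ℂ) = -z * x + 2 * z * t := by push_cast; ring
      rw [this, Complex.exp_add]
      ring
    rw [h1, norm_mul, norm_mul, mul_comm D]
    gcongr
    · exact norm_exp_mul_sub_le z (abs_le.2 ⟨by linarith [ht.1], by linarith [ht.2]⟩)
    · exact hp t ⟨ht.1.le, ht.2⟩
  · exact ((hg.mono_set hsub).norm.const_mul _)
  · rw [intervalIntegral.integral_const_mul]
    gcongr
    exact intervalIntegral.integral_mono_interval le_rfl hx.1 hx.2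
      (Filter.Eventually.of_forall fun t => norm_nonneg _) hg.norm

/-- The leading part of `ampMinus`, where `exp (z t + P t)` replaces `expSol`. -/
noncomputable def mainMinus (q : ℝ → ℝ) (P : ℝ → ℂ) (z : ℂ) (x : ℝ) : ℂ :=
  Complex.exp (-z * x) * (∫ t in (0 : ℝ)..x, (q t : ℂ) * Complex.exp (2 * z * t + P t)) / (2 * z)

lemma hasDerivAt_mainMinus (hq : Continuous q) {P : ℝ → ℂ} (hP : Continuous P) {z : ℂ}
    (hz : z ≠ 0) (x : ℝ) :
    HasDerivAt (mainMinus q P z)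
      (-z * mainMinus q P z x + q x * Complex.exp (z * x + P x) / (2 * z)) x := by
  have hc : Continuous fun t : ℝ => (q t : ℂ) * Complex.exp (2 * z * t + P t) := by fun_prop
  have h1 := intervalIntegral.integral_hasDerivAt_right (hc.intervalIntegrable 0 x)
    (hc.stronglyMeasurableAtFilter _ _) hc.continuousAt
  have h2 := (hasDerivAt_const_mul_ofReal (-z) x).cexp
  refine ((h2.mul h1).div_const (2 * z)).congr_deriv ?_
  have h3 : Complex.exp (z * x + P x) =
      Complex.exp (-z * x) * Complex.exp (2 * z * x + P x) := by
    rw [← Complex.exp_add]; ring_nf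
  rw [h3, mainMinus]
  field_simp

/-- Both functions vanish at `0` and satisfy the same equation up to the forcing term, so the error
in approximating `expSol` is improved by a factor of order `1/‖z‖`. -/
lemma norm_ampMinus_sub_mainMinus_le (hq : Continuous q) {P : ℝ → ℂ} (hP : Continuous P) {M : ℝ}
    (hM : ∀ x ∈ Icc (0 : ℝ) Real.pi, ‖(q x : ℂ)‖ ≤ M) {z : ℂ} (hz0 : z ≠ 0) {B : ℝ}
    (hB : ∀ t ∈ Icc (0 : ℝ) Real.pi,
      ‖expSol hq z t - Complex.exp (z * t + P t)‖ ≤ B * Real.exp (|z.re| * t))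
    {x : ℝ} (hx : x ∈ Icc (0 : ℝ) Real.pi) :
    ‖ampMinus hq z x - mainMinus q P z x‖ ≤
      Real.pi * (M * B / (2 * ‖z‖)) * Real.exp (|z.re| * x) := by
  have hJc := continuous_expSol hq z
  have h0 : ampMinus hq z 0 - mainMinus q P z 0 = 0 := by
    simp [ampMinus_zero, mainMinus]
  have := norm_sub_exp_mul_le (f := fun x => ampMinus hq z x - mainMinus q P z x)
    (K := fun t : ℝ => -z * t) (k := fun _ => -z) (τ := |z.re|)
    (r := fun t => (q t : ℂ) * (expSol hq z t - Complex.exp (z * t + P t)) / (2 * z))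
    (D := 1) (B := M * B / (2 * ‖z‖))
    (fun x _ => hasDerivAt_const_mul_ofReal (-z) x)
    (fun x hx => ((hasDerivAt_ampMinus hq hz0 hx).sub
      (hasDerivAt_mainMinus hq hP hz0 x)).congr_deriv (by ring))
    (by fun_prop) zero_le_one
    (fun x _ t ht => by simpa using norm_exp_mul_sub_mul_le (-z) ht)
    (fun t ht => by
      rw [norm_div, norm_mul, norm_mul, Complex.norm_ofNat, div_mul_eq_mul_div, mul_assoc]
      have h1 := hM t ht
      have h2 := hB t ht
      have h3 : 0 ≤ M := (norm_nonneg _).trans h1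
      gcongr) hx
  beta_reduce at this
  rw [h0] at this
  simpa using this

/-- Integration by parts in `mainMinus`. -/
lemma mainMinus_eq (hac : AbsolutelyContinuousOnInterval q 0 Real.pi) (hq : Continuous q)
    {P P' : ℝ → ℂ} (hP : ∀ t, HasDerivAt P (P' t) t) (hP' : Continuous P') {z : ℂ} (hz : z ≠ 0)
    {x : ℝ} (hx : x ∈ Icc (0 : ℝ) Real.pi) :
    4 * z ^ 2 * mainMinus q P z x =
      q x * Complex.exp (z * x + P x) - q 0 * Complex.exp (-z * x + P 0) -
      Complex.exp (-z * x) * (∫ t in (0 : ℝ)..x,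
        ((deriv q t : ℝ) : ℂ) * (Complex.exp (2 * z * t) * Complex.exp (P t))) -
      Complex.exp (-z * x) * ∫ t in (0 : ℝ)..x,
        (q t : ℂ) * (Complex.exp (2 * z * t) * (P' t * Complex.exp (P t))) := by
  have hPc : Continuous P := continuous_iff_continuousAt.2 fun t => (hP t).continuousAt
  have hE : ∀ t : ℝ, HasDerivAt (fun t : ℝ => Complex.exp (2 * z * t + P t))
      ((2 * z + P' t) * Complex.exp (2 * z * t + P t)) t := fun t => by
    refine (((hasDerivAt_const_mul_ofReal (2 * z) t).add (hP t)).cexp).congr_deriv ?_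
    rw [mul_comm]
    rfl
  have h1 := integral_deriv_mul_add hac hq hE (by fun_prop) hx
  have h2 : (∫ t in (0 : ℝ)..x, (q t : ℂ) * ((2 * z + P' t) * Complex.exp (2 * z * t + P t))) =
      2 * z * (∫ t in (0 : ℝ)..x, (q t : ℂ) * Complex.exp (2 * z * t + P t)) +
      ∫ t in (0 : ℝ)..x, (q t : ℂ) * (Complex.exp (2 * z * t) * (P' t * Complex.exp (P t))) := by
    rw [← intervalIntegral.integral_const_mul, ← intervalIntegral.integral_add]
    · refine intervalIntegral.integral_congr fun t _ => ?_
      simp only [Complex.exp_add]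
      ring
    · exact Continuous.intervalIntegrable (by fun_prop) _ _
    · exact Continuous.intervalIntegrable (by fun_prop) _ _
  rw [h2] at h1
  have h3 : Complex.exp (z * x + P x) =
      Complex.exp (-z * x) * Complex.exp (2 * z * x + P x) := by
    rw [← Complex.exp_add]; ring_nf
  have h4 : Complex.exp (-z * x + P 0) =
      Complex.exp (-z * x) * Complex.exp (2 * z * (0 : ℝ) + P 0) := by
    rw [← Complex.exp_add]; simp
  have h5 : (∫ t in (0 : ℝ)..x, ((deriv q t : ℝ) : ℂ) * Complex.exp (2 * z * t + P t)) =
      ∫ t in (0 : ℝ)..x,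
        ((deriv q t : ℝ) : ℂ) * (Complex.exp (2 * z * t) * Complex.exp (P t)) := by
    simp only [Complex.exp_add]
  have h6 : 4 * z ^ 2 * mainMinus q P z x = Complex.exp (-z * x) *
      (2 * z * ∫ t in (0 : ℝ)..x, (q t : ℂ) * Complex.exp (2 * z * t + P t)) := by
    rw [mainMinus]; field_simp; ring
  rw [h6, h3, h4, ← h5]
  linear_combination Complex.exp (-z * x) * h1

lemma intervalIntegrable_ofReal_deriv (hac : AbsolutelyContinuousOnInterval q 0 Real.pi) :
    IntervalIntegrable (fun t => ((deriv q t : ℝ) : ℂ)) volume 0 Real.pi :=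
  ⟨hac.intervalIntegrable_deriv.1.ofReal, hac.intervalIntegrable_deriv.2.ofReal⟩

/-- The second component of `expSol` is of second order. -/
lemma exists_norm_ampMinus_le (hac : AbsolutelyContinuousOnInterval q 0 Real.pi)
    (hq : Continuous q) {M : ℝ} (hM : ∀ x ∈ Icc (0 : ℝ) Real.pi, ‖(q x : ℂ)‖ ≤ M) :
    ∃ C, 0 ≤ C ∧ ∀ z : ℂ, z ≠ 0 → 2 * Real.pi * M ≤ ‖z‖ → ∀ x ∈ Icc (0 : ℝ) Real.pi,
      ‖ampMinus hq z x‖ ≤ C / ‖z‖ ^ 2 * Real.exp (|z.re| * x) := by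
  have hM0 : 0 ≤ M := (norm_nonneg _).trans (hM 0 zero_mem_Icc_pi)
  set K := ∫ t in (0 : ℝ)..Real.pi, ‖((deriv q t : ℝ) : ℂ)‖ with hK
  have hK0 : 0 ≤ K := intervalIntegral.integral_nonneg Real.pi_pos.le fun _ _ => norm_nonneg _
  refine ⟨Real.pi ^ 2 * M ^ 2 + (2 * M + K) / 4, by positivity, fun z hz0 hz x hx => ?_⟩
  have hzpos : 0 < ‖z‖ := norm_pos_iff.2 hz0
  have h1 : ∀ t ∈ Icc (0 : ℝ) Real.pi, ‖expSol hq z t - Complex.exp (z * t + 0)‖ ≤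
      2 * Real.pi * M / ‖z‖ * Real.exp (|z.re| * t) := by
    intro t ht
    obtain ⟨-, h1, h2⟩ := norm_ampPlus_ampMinus_le hq hM hz0 hz ht
    rw [expSol_eq hq hz0, add_zero]
    calc _ = ‖(ampPlus hq z t - Complex.exp (z * t)) - ampMinus hq z t‖ := by ring_nf
      _ ≤ _ := norm_sub_le _ _
      _ ≤ _ := add_le_add h1 h2
      _ = _ := by ring
  -- With `P = 0` the approximation of `expSol` has error O(1/z), hence this difference is O(1/z²);
  -- integration by parts bounds `mainMinus` itself by the same order.
  have h2 := norm_ampMinus_sub_mainMinus_le hq (P := fun _ => 0) continuous_const hM hz0 h1 hx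
  have h3 := mainMinus_eq hac hq (P := fun _ => 0) (P' := fun _ => 0)
    (fun t => hasDerivAt_const t 0) continuous_const hz0 hx
  have h4 := norm_exp_mul_integral_le (intervalIntegrable_ofReal_deriv hac) (p := fun _ => 1)
    (D := 1) z hx (fun t _ => by simp)
  rw [← hK] at h4
  simp only [Complex.exp_zero, add_zero, zero_mul, mul_zero,
    intervalIntegral.integral_zero, sub_zero] at h3
  have hx0 : |x| ≤ x := (abs_of_nonneg hx.1).le
  have hx1 : ‖Complex.exp (-z * x)‖ ≤ Real.exp (|z.re| * x) := by
    simpa using norm_exp_mul_sub_le (-z) hx0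
  have h5 : ‖4 * z ^ 2 * mainMinus q (fun _ => 0) z x‖ ≤
      (2 * M + K) * Real.exp (|z.re| * x) := by
    rw [h3]
    refine (norm_sub_le _ _).trans ((add_le_add (norm_sub_le _ _) h4).trans ?_)
    rw [norm_mul, norm_mul]
    calc _ ≤ M * Real.exp (|z.re| * x) + M * Real.exp (|z.re| * x) +
          1 * Real.exp (|z.re| * x) * K := by
          gcongr
          · exact hM x hx
          · exact norm_exp_mul_sub_le z hx0
          · exact hM 0 zero_mem_Icc_pi
      _ = _ := by ring
  rw [norm_mul, norm_mul, norm_pow, Complex.norm_ofNat] at h5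
  have h6 : ‖mainMinus q (fun _ => 0) z x‖ ≤
      (2 * M + K) / 4 / ‖z‖ ^ 2 * Real.exp (|z.re| * x) := by
    rw [div_mul_eq_mul_div, le_div_iff₀ (by positivity)]
    linarith
  calc ‖ampMinus hq z x‖ = ‖(ampMinus hq z x - mainMinus q (fun _ => 0) z x) +
        mainMinus q (fun _ => 0) z x‖ := by ring_nf
    _ ≤ _ := (norm_add_le _ _).trans (add_le_add h2 h6)
    _ = _ := by field_simp

lemma hasDerivAt_primitive_div (hq : Continuous q) (z : ℂ) (t : ℝ) :
    HasDerivAt (fun t : ℝ => ((∫ s in (0 : ℝ)..t, q s : ℝ) : ℂ) / (2 * z)) (q t / (2 * z)) t := by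
  have h1 : HasDerivAt (fun t => ∫ s in (0 : ℝ)..t, q s) (q t) t :=
    intervalIntegral.integral_hasDerivAt_right (hq.intervalIntegrable 0 t)
      (hq.stronglyMeasurableAtFilter _ _) hq.continuousAt
  exact h1.ofReal_comp.div_const _

lemma norm_primitive_sub_le (hq : Continuous q) {M : ℝ}
    (hM : ∀ x ∈ Icc (0 : ℝ) Real.pi, ‖(q x : ℂ)‖ ≤ M) {x t : ℝ}
    (hx : x ∈ Icc (0 : ℝ) Real.pi) (ht : t ∈ Icc 0 x) :
    |(∫ s in (0 : ℝ)..x, q s) - ∫ s in (0 : ℝ)..t, q s| ≤ Real.pi * M := by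
  have hM0 : 0 ≤ M := (norm_nonneg _).trans (hM 0 zero_mem_Icc_pi)
  rw [intervalIntegral.integral_interval_sub_left (hq.intervalIntegrable _ _)
    (hq.intervalIntegrable _ _), ← Real.norm_eq_abs]
  refine (intervalIntegral.norm_integral_le_of_norm_le_const (C := M) fun s hs => ?_).trans ?_
  · rw [uIoc_of_le ht.2] at hs
    simpa using hM s ⟨by linarith [ht.1, hs.1], hs.2.trans hx.2⟩
  · rw [abs_of_nonneg (by linarith [ht.2]), mul_comm]
    gcongr
    linarith [ht.1, hx.2]

/-- The main component of `expSol`, up to an error of third order. -/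
lemma exists_norm_ampPlus_sub_le (hac : AbsolutelyContinuousOnInterval q 0 Real.pi)
    (hq : Continuous q) {M : ℝ} (hM : ∀ x ∈ Icc (0 : ℝ) Real.pi, ‖(q x : ℂ)‖ ≤ M) :
    ∃ C, 0 ≤ C ∧ ∀ z : ℂ, z ≠ 0 → 2 * Real.pi * M ≤ ‖z‖ → ∀ x ∈ Icc (0 : ℝ) Real.pi,
      ‖ampPlus hq z x -
          Complex.exp (z * x + ((∫ s in (0 : ℝ)..x, q s : ℝ) : ℂ) / (2 * z))‖ ≤
        C / ‖z‖ ^ 3 * Real.exp (|z.re| * x) := by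
  have hM0 : 0 ≤ M := (norm_nonneg _).trans (hM 0 zero_mem_Icc_pi)
  obtain ⟨C, hC0, hC⟩ := exists_norm_ampMinus_le hac hq hM
  refine ⟨Real.pi * 3 * (M * C / 2), by positivity, fun z hz0 hz x hx => ?_⟩
  have hzpos : 0 < ‖z‖ := norm_pos_iff.2 hz0
  -- The term q·`ampPlus`/(2z) is absorbed into the exponent, leaving the forcing
  -- -q·`ampMinus`/(2z), which is of third order by the bound `hC`. The constant `D = 3` exceeds
  -- `e`, since the extra exponent has norm at most 1 when `2πM ≤ ‖z‖`.
  have h1 := norm_sub_exp_mul_le (f := ampPlus hq z)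
    (K := fun t : ℝ => z * t + ((∫ s in (0 : ℝ)..t, q s : ℝ) : ℂ) / (2 * z))
    (k := fun t => z + q t / (2 * z)) (τ := |z.re|)
    (r := fun t => -(q t / (2 * z) * ampMinus hq z t))
    (D := 3) (B := M * C / (2 * ‖z‖ ^ 3))
    (fun x _ => (hasDerivAt_const_mul_ofReal z x).add (hasDerivAt_primitive_div hq z x))
    (fun x hx => (hasDerivAt_ampPlus hq hz0 hx).congr_deriv
      (by rw [expSol_eq hq hz0]; ring))
    (by have := continuous_ampMinus hq z; fun_prop) (by norm_num)
    (fun x hx t ht => by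
      have e1 : z * (x : ℂ) + ((∫ s in (0 : ℝ)..x, q s : ℝ) : ℂ) / (2 * z) -
          (z * t + ((∫ s in (0 : ℝ)..t, q s : ℝ) : ℂ) / (2 * z)) =
          (((∫ s in (0 : ℝ)..x, q s) - ∫ s in (0 : ℝ)..t, q s : ℝ) : ℂ) / (2 * z) +
            (z * x - z * t) := by push_cast; ring
      rw [e1, Complex.exp_add, norm_mul]
      have e2 := norm_exp_mul_sub_mul_le z ht
      rw [one_mul] at e2
      refine mul_le_mul ?_ e2 (norm_nonneg _) (by norm_num)
      rw [Complex.norm_exp]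
      refine (Real.exp_le_exp.2 (Complex.re_le_norm _)).trans
        ((Real.exp_le_exp.2 ?_).trans Real.exp_one_lt_three.le)
      rw [norm_div, Complex.norm_real, norm_mul, Complex.norm_ofNat, div_le_one (by positivity)]
      have := norm_primitive_sub_le hq hM hx ht
      rw [Real.norm_eq_abs]
      nlinarith)
    (fun t ht => by
      rw [norm_neg, norm_mul, norm_div, norm_mul, Complex.norm_ofNat]
      calc _ ≤ M / (2 * ‖z‖) * (C / ‖z‖ ^ 2 * Real.exp (|z.re| * t)) := by
            gcongr
            · exact hM t ht
            · exact hC z hz0 hz t ht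
        _ = _ := by field_simp) hx
  beta_reduce at h1
  rw [ampPlus_zero hq hz0] at h1
  simp only [intervalIntegral.integral_same, Complex.ofReal_zero, mul_zero, zero_div, add_zero,
    sub_zero, mul_one] at h1
  refine h1.trans (le_of_eq ?_)
  field_simp

/-- The minor component of `expSol` at `π`, up to an error of third order. -/
lemma exists_norm_ampMinus_pi_sub_le (hac : AbsolutelyContinuousOnInterval q 0 Real.pi)
    (hq : Continuous q) {M : ℝ} (hM : ∀ x ∈ Icc (0 : ℝ) Real.pi, ‖(q x : ℂ)‖ ≤ M) :
    ∃ C, 0 ≤ C ∧ ∀ z : ℂ, 1 ≤ ‖z‖ → 2 * Real.pi * M ≤ ‖z‖ →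
      ‖ampMinus hq z Real.pi - (q Real.pi * Complex.exp (z * Real.pi) -
          q 0 * Complex.exp (-z * Real.pi) - Complex.exp (-z * Real.pi) *
          (∫ t in (0 : ℝ)..Real.pi, ((deriv q t : ℝ) : ℂ) * Complex.exp (2 * z * t))) /
          (4 * z ^ 2)‖ ≤
        C / ‖z‖ ^ 3 * Real.exp (|z.re| * Real.pi) := by
  have hM0 : 0 ≤ M := (norm_nonneg _).trans (hM 0 zero_mem_Icc_pi)
  obtain ⟨C₁, hC₁0, hC₁⟩ := exists_norm_ampMinus_le hac hq hM
  obtain ⟨C₂, hC₂0, hC₂⟩ := exists_norm_ampPlus_sub_le hac hq hM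
  set K := ∫ t in (0 : ℝ)..Real.pi, ‖((deriv q t : ℝ) : ℂ)‖ with hK
  have hK0 : 0 ≤ K := intervalIntegral.integral_nonneg Real.pi_pos.le fun _ _ => norm_nonneg _
  set L := ∫ t in (0 : ℝ)..Real.pi, ‖(q t : ℂ)‖ with hL
  have hL0 : 0 ≤ L := intervalIntegral.integral_nonneg Real.pi_pos.le fun _ _ => norm_nonneg _
  refine ⟨Real.pi * (M * (C₁ + C₂) / 2) +
    (M * (Real.pi * M) + Real.pi * M * K + 3 * M / 2 * L) / 4, by positivity,
    fun z hz1 hz => ?_⟩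
  have hzpos : 0 < ‖z‖ := by linarith
  have hz0 : z ≠ 0 := norm_pos_iff.1 hzpos
  have hx := pi_mem_Icc_pi
  -- With this phase the error in `expSol` is O(1/z²), so `mainMinus` approximates `ampMinus` to
  -- third order. After integration by parts there is already a factor 1/z², and exp(P) = 1 + O(1/z)
  -- may be replaced by 1.
  set P : ℝ → ℂ := fun t => ((∫ s in (0 : ℝ)..t, q s : ℝ) : ℂ) / (2 * z) with hP
  have hPd := hasDerivAt_primitive_div hq z
  have hPc : Continuous P := continuous_iff_continuousAt.2 fun t => (hPd t).continuousAt
  have hPn : ∀ t ∈ Icc (0 : ℝ) Real.pi, ‖P t‖ ≤ Real.pi * M / (2 * ‖z‖) := by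
    intro t ht
    rw [hP]
    simp only [norm_div, Complex.norm_real, norm_mul, Complex.norm_ofNat]
    gcongr
    simpa using norm_primitive_sub_le hq hM ht (t := 0) ⟨le_rfl, ht.1⟩
  have hPn1 : ∀ t ∈ Icc (0 : ℝ) Real.pi, ‖P t‖ ≤ 1 := fun t ht =>
    (hPn t ht).trans (by rw [div_le_one (by positivity)]; nlinarith)
  have hPe : ∀ t ∈ Icc (0 : ℝ) Real.pi, ‖Complex.exp (P t) - 1‖ ≤ Real.pi * M / ‖z‖ := by
    intro t ht
    refine (Complex.norm_exp_sub_one_le (hPn1 t ht)).trans ?_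
    calc 2 * ‖P t‖ ≤ 2 * (Real.pi * M / (2 * ‖z‖)) := by gcongr; exact hPn t ht
      _ = _ := by field_simp
  have h1 : ∀ t ∈ Icc (0 : ℝ) Real.pi, ‖expSol hq z t - Complex.exp (z * t + P t)‖ ≤
      (C₁ + C₂) / ‖z‖ ^ 2 * Real.exp (|z.re| * t) := by
    intro t ht
    rw [expSol_eq hq hz0]
    have e1 : C₂ / ‖z‖ ^ 3 ≤ C₂ / ‖z‖ ^ 2 := by
      gcongr
      norm_num
    calc _ = ‖(ampPlus hq z t - Complex.exp (z * t + P t)) - ampMinus hq z t‖ := by ring_nf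
      _ ≤ _ := norm_sub_le _ _
      _ ≤ C₂ / ‖z‖ ^ 3 * Real.exp (|z.re| * t) + C₁ / ‖z‖ ^ 2 * Real.exp (|z.re| * t) :=
        add_le_add (hC₂ z hz0 hz t ht) (hC₁ z hz0 hz t ht)
      _ ≤ C₂ / ‖z‖ ^ 2 * Real.exp (|z.re| * t) + C₁ / ‖z‖ ^ 2 * Real.exp (|z.re| * t) := by
        gcongr
      _ = _ := by ring
  have h2 := norm_ampMinus_sub_mainMinus_le hq hPc hM hz0 h1 hx
  have h3 := mainMinus_eq hac hq hPd (by fun_prop) hz0 hx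
  have hP0 : P 0 = 0 := by simp [hP]
  change 4 * z ^ 2 * mainMinus q P z Real.pi = _ * Complex.exp (_ + P Real.pi) -
    _ * Complex.exp (_ + P 0) - _ * (∫ t in (0 : ℝ)..Real.pi, _ * (_ * Complex.exp (P t))) -
    _ * (∫ t in (0 : ℝ)..Real.pi, _ * (_ * (_ * Complex.exp (P t)))) at h3
  rw [hP0, add_zero] at h3
  have hsplit : (∫ t in (0 : ℝ)..Real.pi, ((deriv q t : ℝ) : ℂ) * (Complex.exp (2 * z * t) *
      Complex.exp (P t))) = (∫ t in (0 : ℝ)..Real.pi, ((deriv q t : ℝ) : ℂ) *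
        Complex.exp (2 * z * t)) + ∫ t in (0 : ℝ)..Real.pi, ((deriv q t : ℝ) : ℂ) *
        (Complex.exp (2 * z * t) * (Complex.exp (P t) - 1)) := by
    rw [← intervalIntegral.integral_add]
    · refine intervalIntegral.integral_congr fun t _ => ?_
      ring
    · exact (intervalIntegrable_ofReal_deriv hac).mul_continuousOn (by fun_prop)
    · exact (intervalIntegrable_ofReal_deriv hac).mul_continuousOn (by fun_prop)
  have h4 := norm_exp_mul_integral_le (intervalIntegrable_ofReal_deriv hac)
    (p := fun t => Complex.exp (P t) - 1) (D := Real.pi * M / ‖z‖) z hx hPe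
  rw [← hK] at h4
  have h5 := norm_exp_mul_integral_le (g := fun t => (q t : ℂ))
    ((Complex.continuous_ofReal.comp hq).intervalIntegrable 0 Real.pi)
    (p := fun t => q t / (2 * z) * Complex.exp (P t)) (D := 3 * M / (2 * ‖z‖)) z hx
    (fun t ht => by
      rw [norm_mul, norm_div, norm_mul, Complex.norm_ofNat]
      have e1 : ‖Complex.exp (P t)‖ ≤ 3 := by
        rw [Complex.norm_exp]
        exact (Real.exp_le_exp.2 ((Complex.re_le_norm _).trans (hPn1 t ht))).trans
          Real.exp_one_lt_three.le
      calc _ ≤ M / (2 * ‖z‖) * 3 := by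
            gcongr
            exact hM t ht
        _ = _ := by ring)
  rw [← hL] at h5
  have h6 : 4 * z ^ 2 * (mainMinus q P z Real.pi - (q Real.pi * Complex.exp (z * Real.pi) -
          q 0 * Complex.exp (-z * Real.pi) - Complex.exp (-z * Real.pi) *
          (∫ t in (0 : ℝ)..Real.pi, ((deriv q t : ℝ) : ℂ) * Complex.exp (2 * z * t))) /
          (4 * z ^ 2)) =
      q Real.pi * (Complex.exp (z * Real.pi) * (Complex.exp (P Real.pi) - 1)) -
      Complex.exp (-z * Real.pi) * (∫ t in (0 : ℝ)..Real.pi, ((deriv q t : ℝ) : ℂ) *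
        (Complex.exp (2 * z * t) * (Complex.exp (P t) - 1))) -
      Complex.exp (-z * Real.pi) * ∫ t in (0 : ℝ)..Real.pi,
        (q t : ℂ) * (Complex.exp (2 * z * t) * (q t / (2 * z) * Complex.exp (P t))) := by
    rw [mul_sub, h3, hsplit, Complex.exp_add]
    field_simp
    ring
  have h7 : ‖4 * z ^ 2 * (mainMinus q P z Real.pi - (q Real.pi * Complex.exp (z * Real.pi) -
          q 0 * Complex.exp (-z * Real.pi) - Complex.exp (-z * Real.pi) *
          (∫ t in (0 : ℝ)..Real.pi, ((deriv q t : ℝ) : ℂ) * Complex.exp (2 * z * t))) /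
          (4 * z ^ 2))‖ ≤ (M * (Real.pi * M) + Real.pi * M * K + 3 * M / 2 * L) / ‖z‖ *
            Real.exp (|z.re| * Real.pi) := by
    rw [h6]
    refine (norm_sub_le _ _).trans (add_le_add (norm_sub_le _ _) h5 |>.trans ?_)
    rw [norm_mul, norm_mul]
    calc _ ≤ M * (Real.exp (|z.re| * Real.pi) * (Real.pi * M / ‖z‖)) +
          Real.pi * M / ‖z‖ * Real.exp (|z.re| * Real.pi) * K +
          3 * M / (2 * ‖z‖) * Real.exp (|z.re| * Real.pi) * L := by
          gcongr
          · exact hM _ hx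
          · exact norm_exp_mul_sub_le z (abs_of_nonneg Real.pi_pos.le).le
          · exact hPe _ hx
      _ = _ := by field_simp
  rw [norm_mul, norm_mul, norm_pow, Complex.norm_ofNat] at h7
  generalize (q Real.pi * Complex.exp (z * Real.pi) - q 0 * Complex.exp (-z * Real.pi) -
    Complex.exp (-z * Real.pi) * (∫ t in (0 : ℝ)..Real.pi,
      ((deriv q t : ℝ) : ℂ) * Complex.exp (2 * z * t))) / (4 * z ^ 2) = T at h7 ⊢
  have h8 : ‖mainMinus q P z Real.pi - T‖ ≤
      (M * (Real.pi * M) + Real.pi * M * K + 3 * M / 2 * L) / 4 / ‖z‖ ^ 3 *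
        Real.exp (|z.re| * Real.pi) := by
    have e : (M * (Real.pi * M) + Real.pi * M * K + 3 * M / 2 * L) / 4 / ‖z‖ ^ 3 *
        Real.exp (|z.re| * Real.pi) = ((M * (Real.pi * M) + Real.pi * M * K + 3 * M / 2 * L) /
          ‖z‖ * Real.exp (|z.re| * Real.pi)) / (4 * ‖z‖ ^ 2) := by field_simp
    rw [e, le_div_iff₀ (by positivity)]
    linarith
  calc _ = ‖(ampMinus hq z Real.pi - mainMinus q P z Real.pi) +
        (mainMinus q P z Real.pi - T)‖ := by ring_nf
    _ ≤ _ := (norm_add_le _ _).trans (add_le_add h2 h8)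
    _ = _ := by field_simp

end AsymptoticsRefined

/-! ### Expansion of the characteristic function at infinity. -/

section CharFnAsymptotics

open Filter Asymptotics

/-- The exponential weight `exp (π |Re z|)`. -/
noncomputable def expWeight (z : ℂ) : ℝ := Real.exp (|z.re| * Real.pi)

lemma expWeight_pos (z : ℂ) : 0 < expWeight z := Real.exp_pos _

lemma expWeight_neg (z : ℂ) : expWeight (-z) = expWeight z := by simp [expWeight]

lemma isBigO_exp_expWeight :
    (fun z : ℂ => Complex.exp (z * Real.pi)) =O[Bornology.cobounded ℂ] expWeight := by
  refine IsBigO.of_bound 1 (Eventually.of_forall fun z => ?_)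
  rw [one_mul, Real.norm_of_nonneg (expWeight_pos z).le]
  exact norm_exp_mul_sub_le z (abs_of_nonneg Real.pi_pos.le).le

lemma isBigO_exp_neg_expWeight :
    (fun z : ℂ => Complex.exp (-z * Real.pi)) =O[Bornology.cobounded ℂ] expWeight := by
  refine IsBigO.of_bound 1 (Eventually.of_forall fun z => ?_)
  rw [one_mul, Real.norm_of_nonneg (expWeight_pos z).le, ← expWeight_neg]
  exact norm_exp_mul_sub_le (-z) (abs_of_nonneg Real.pi_pos.le).le

/-- `f(z) = 1 + a z⁻¹ + b z⁻² + O(z⁻³)` at infinity. -/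
def HasExpansion (f : ℂ → ℂ) (a b : ℂ) : Prop :=
  (fun z => f z - (1 + a * z⁻¹ + b * z⁻¹ ^ 2)) =O[Bornology.cobounded ℂ] fun z => ‖z‖⁻¹ ^ 3

lemma isBigO_inv_norm_inv : (fun z : ℂ => z⁻¹) =O[Bornology.cobounded ℂ] fun z => ‖z‖⁻¹ :=
  IsBigO.of_bound 1 (Eventually.of_forall fun z => by simp)

lemma eventually_one_le_norm : ∀ᶠ z : ℂ in Bornology.cobounded ℂ, 1 ≤ ‖z‖ :=
  (hasBasis_cobounded_norm (E := ℂ)).mem_of_mem (i := 1) trivial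

lemma eventually_ne_zero_cobounded : ∀ᶠ z : ℂ in Bornology.cobounded ℂ, z ≠ 0 := by
  filter_upwards [eventually_one_le_norm] with z hz
  exact norm_pos_iff.1 (by linarith)

lemma isBigO_inv_pow_of_le {m n : ℕ} (h : m ≤ n) :
    (fun z : ℂ => ‖z‖⁻¹ ^ n) =O[Bornology.cobounded ℂ] fun z => ‖z‖⁻¹ ^ m := by
  refine IsBigO.of_bound 1 ?_
  filter_upwards [eventually_one_le_norm] with z hz
  rw [one_mul, Real.norm_of_nonneg (by positivity), Real.norm_of_nonneg (by positivity)]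
  exact pow_le_pow_of_le_one (by positivity) (inv_le_one_of_one_le₀ hz) h

lemma isBigO_const_mul_inv_pow (a : ℂ) (n : ℕ) :
    (fun z : ℂ => a * z⁻¹ ^ n) =O[Bornology.cobounded ℂ] fun z => ‖z‖⁻¹ ^ n :=
  (isBigO_inv_norm_inv.pow n).const_mul_left a

lemma isBigO_main_one (a b : ℂ) :
    (fun z : ℂ => 1 + a * z⁻¹ + b * z⁻¹ ^ 2) =O[Bornology.cobounded ℂ] fun z => ‖z‖⁻¹ ^ 0 := by
  have h0 := isBigO_const_mul_inv_pow 1 0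
  have h1 := (isBigO_const_mul_inv_pow a 1).trans (isBigO_inv_pow_of_le zero_le_one)
  have h2 := (isBigO_const_mul_inv_pow b 2).trans (isBigO_inv_pow_of_le zero_le_two)
  refine ((h0.add h1).add h2).congr_left fun z => ?_
  simp

lemma HasExpansion.isBigO_one {f : ℂ → ℂ} {a b : ℂ} (hf : HasExpansion f a b) :
    f =O[Bornology.cobounded ℂ] fun z => ‖z‖⁻¹ ^ 0 :=
  ((IsBigO.trans hf (isBigO_inv_pow_of_le (m := 0) (n := 3) (by norm_num))).add (isBigO_main_one a b)).congr_left
    fun z => by ring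

lemma HasExpansion.sub_one_isBigO {f : ℂ → ℂ} {a b : ℂ} (hf : HasExpansion f a b) :
    (fun z => f z - 1) =O[Bornology.cobounded ℂ] fun z => ‖z‖⁻¹ ^ 1 := by
  have h1 := isBigO_const_mul_inv_pow a 1
  have h2 := (isBigO_const_mul_inv_pow b 2).trans (isBigO_inv_pow_of_le one_le_two)
  have h3 := IsBigO.trans hf (isBigO_inv_pow_of_le (m := 1) (by norm_num))
  exact ((h3.add h1).add h2).congr_left fun z => by ring

lemma HasExpansion.mul {f g : ℂ → ℂ} {a b c d : ℂ} (hf : HasExpansion f a b)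
    (hg : HasExpansion g c d) :
    HasExpansion (fun z => f z * g z) (a + c) (b + d + a * c) := by
  have h1 := (IsBigO.mul hf hg.isBigO_one).congr_right (g₂ := fun z : ℂ => ‖z‖⁻¹ ^ 3)
    (fun z => by ring)
  have h2 := (IsBigO.mul (isBigO_main_one a b) hg).congr_right (g₂ := fun z : ℂ => ‖z‖⁻¹ ^ 3)
    (fun z => by ring)
  have h3 := isBigO_const_mul_inv_pow (a * d + b * c) 3
  have h4 := (isBigO_const_mul_inv_pow (b * d) 4).trans
    (isBigO_inv_pow_of_le (m := 3) (by norm_num))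
  exact (((h1.add h2).add h3).add h4).congr_left fun z => by ring

lemma HasExpansion.neg {f : ℂ → ℂ} {a b : ℂ} (hf : HasExpansion f a b) :
    HasExpansion (fun z => f (-z)) (-a) b := by
  refine (IsBigO.comp_tendsto hf tendsto_neg_cobounded).congr (fun z => ?_) (fun z => ?_)
  · simp only [Function.comp_apply, inv_neg]
    ring
  · simp

lemma hasExpansion_poly (a b c : ℂ) :
    HasExpansion (fun z => 1 + a * z⁻¹ + b * z⁻¹ ^ 2 + c * z⁻¹ ^ 3) a b :=
  (isBigO_const_mul_inv_pow c 3).congr_left fun z => by ring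

lemma hasExpansion_exp (a : ℂ) : HasExpansion (fun z => Complex.exp (a * z⁻¹)) a (a ^ 2 / 2) := by
  have ht : Tendsto (fun z : ℂ => a * z⁻¹) (Bornology.cobounded ℂ) (nhds 0) := by
    simpa using (tendsto_inv₀_cobounded (α := ℂ)).const_mul a
  have h1 : (fun z : ℂ => Complex.exp z - (1 + z + z ^ 2 / 2)) =O[nhds 0] fun z => z ^ 3 := by
    refine IsBigO.of_bound 1 ?_
    filter_upwards [Metric.ball_mem_nhds (0 : ℂ) one_pos] with z hz
    have hz' : ‖z‖ ≤ 1 := by simpa using (mem_ball_zero_iff.1 hz).le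
    have := Complex.exp_bound hz' (n := 3) (by norm_num)
    simp only [Finset.sum_range_succ, Finset.range_zero, Finset.sum_empty, pow_zero, pow_one,
      Nat.factorial] at this
    rw [one_mul, norm_pow]
    refine le_trans (le_of_eq ?_) (this.trans ?_)
    · congr 1; norm_num
    · have : 0 ≤ ‖z‖ ^ 3 := by positivity
      norm_num
      nlinarith
  have h3 : ((fun z : ℂ => z ^ 3) ∘ fun z : ℂ => a * z⁻¹) =O[Bornology.cobounded ℂ]
      fun z => ‖z‖⁻¹ ^ 3 :=
    (isBigO_const_mul_inv_pow (a ^ 3) 3).congr_left fun z => by simp [mul_pow]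
  have h2 := (h1.comp_tendsto ht).trans h3
  refine h2.congr_left fun z => ?_
  simp only [Function.comp_apply]
  ring

variable {q : ℝ → ℝ} {h h₁ h₂ H H₁ H₂ : ℝ}

/-- The normalised boundary factor `(λ - h₁ + (λ h - h₂)/z)/λ` with `λ = -z²`. -/
noncomputable def boundaryFactor (h h₁ h₂ : ℝ) (z : ℂ) : ℂ :=
  1 + h * z⁻¹ + h₁ * z⁻¹ ^ 2 + h₂ * z⁻¹ ^ 3

/-- The half of the characteristic function contributed by the exponential solution. -/
noncomputable def charHalf (hq : Continuous q) (h h₁ h₂ H H₁ H₂ : ℝ) (z : ℂ) : ℂ :=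
  boundaryFactor h h₁ h₂ z * (boundaryFactor H H₁ H₂ z * ampPlus hq z Real.pi +
    boundaryFactor H H₁ H₂ (-z) * ampMinus hq z Real.pi)

/-- `expSol` at `z` and at `-z` solve the same equation. Writing `leftSol` in this pair makes
`charFn` an odd part, so only one exponential solution has to be expanded. -/
lemma charFn_neg_sq (hq : Continuous q) {z : ℂ} (hz : z ≠ 0) :
    charFn hq h h₁ h₂ H H₁ H₂ (-z ^ 2) =
      z ^ 5 / 2 * (charHalf hq h h₁ h₂ H H₁ H₂ z - charHalf hq h h₁ h₂ H H₁ H₂ (-z)) := by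
  simp only [charFn, leftSol, dleftSol, charHalf, boundaryFactor, ampPlus, ampMinus, expSol,
    dexpSol, ivpSol, divpSol, neg_sq]
  field_simp
  ring

lemma isBigO_ampPlus_sub (hac : AbsolutelyContinuousOnInterval q 0 Real.pi) (hq : Continuous q) :
    (fun z => ampPlus hq z Real.pi - Complex.exp (z * Real.pi) *
      Complex.exp (((∫ s in (0 : ℝ)..Real.pi, q s : ℝ) : ℂ) / 2 * z⁻¹)) =O[Bornology.cobounded ℂ]
      fun z => ‖z‖⁻¹ ^ 3 * expWeight z := by
  obtain ⟨M, hM0, hM⟩ := exists_bound_on_Icc_pi hq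
  obtain ⟨C, hC0, hC⟩ := exists_norm_ampPlus_sub_le hac hq hM
  refine IsBigO.of_bound C ?_
  filter_upwards [eventually_ne_zero_cobounded,
    (hasBasis_cobounded_norm (E := ℂ)).mem_of_mem (i := 2 * Real.pi * M) trivial] with z hz0 hz
  have h1 := hC z hz0 hz Real.pi pi_mem_Icc_pi
  rw [Complex.exp_add] at h1
  have h2 := expWeight_pos z
  rw [Real.norm_of_nonneg (by positivity)]
  have e : ((∫ s in (0 : ℝ)..Real.pi, q s : ℝ) : ℂ) / 2 * z⁻¹ =
      ((∫ s in (0 : ℝ)..Real.pi, q s : ℝ) : ℂ) / (2 * z) := by field_simp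
  rw [e]
  refine h1.trans (le_of_eq ?_)
  rw [expWeight]
  field_simp

/-- The leading part of `ampMinus` at `π`. -/
noncomputable def minusMain (q : ℝ → ℝ) (z : ℂ) : ℂ :=
  (q Real.pi * Complex.exp (z * Real.pi) - q 0 * Complex.exp (-z * Real.pi) -
    Complex.exp (-z * Real.pi) *
      (∫ t in (0 : ℝ)..Real.pi, ((deriv q t : ℝ) : ℂ) * Complex.exp (2 * z * t))) / (4 * z ^ 2)

lemma isBigO_ampMinus_sub (hac : AbsolutelyContinuousOnInterval q 0 Real.pi)
    (hq : Continuous q) :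
    (fun z => ampMinus hq z Real.pi - minusMain q z) =O[Bornology.cobounded ℂ]
      fun z => ‖z‖⁻¹ ^ 3 * expWeight z := by
  obtain ⟨M, hM0, hM⟩ := exists_bound_on_Icc_pi hq
  obtain ⟨C, hC0, hC⟩ := exists_norm_ampMinus_pi_sub_le hac hq hM
  refine IsBigO.of_bound C ?_
  filter_upwards [eventually_one_le_norm,
    (hasBasis_cobounded_norm (E := ℂ)).mem_of_mem (i := 2 * Real.pi * M) trivial] with z hz1 hz
  have h1 := hC z hz1 hz
  have h2 := expWeight_pos z
  rw [Real.norm_of_nonneg (by positivity)]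
  refine h1.trans (le_of_eq ?_)
  rw [expWeight]
  field_simp

lemma isBigO_minusMain (hac : AbsolutelyContinuousOnInterval q 0 Real.pi) (hq : Continuous q) :
    minusMain q =O[Bornology.cobounded ℂ] fun z => ‖z‖⁻¹ ^ 2 * expWeight z := by
  obtain ⟨M, hM0, hM⟩ := exists_bound_on_Icc_pi hq
  obtain ⟨C, hC0, hC⟩ := exists_norm_ampMinus_le hac hq hM
  have h1 : (fun z => ampMinus hq z Real.pi) =O[Bornology.cobounded ℂ]
      fun z => ‖z‖⁻¹ ^ 2 * expWeight z := by
    refine IsBigO.of_bound C ?_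
    filter_upwards [eventually_ne_zero_cobounded,
      (hasBasis_cobounded_norm (E := ℂ)).mem_of_mem (i := 2 * Real.pi * M) trivial] with z hz0 hz
    have h1 := hC z hz0 hz Real.pi pi_mem_Icc_pi
    have h2 := expWeight_pos z
    rw [Real.norm_of_nonneg (by positivity)]
    refine h1.trans (le_of_eq ?_)
    rw [expWeight]
    field_simp
  have h2 : (fun z : ℂ => ‖z‖⁻¹ ^ 3 * expWeight z) =O[Bornology.cobounded ℂ]
      fun z => ‖z‖⁻¹ ^ 2 * expWeight z :=
    (isBigO_inv_pow_of_le (m := 2) (n := 3) (by norm_num)).mul (isBigO_refl _ _)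
  exact (h1.sub ((isBigO_ampMinus_sub hac hq).trans h2)).congr_left fun z => by ring

/-- The second order constant in the expansion of the characteristic function. -/
noncomputable def slKappa (q : ℝ → ℝ) (h h₁ H H₁ : ℝ) : ℝ :=
  h₁ + H₁ + h * H + (h + H) * (∫ s in (0 : ℝ)..Real.pi, q s) / 2 +
    (∫ s in (0 : ℝ)..Real.pi, q s) ^ 2 / 8

/-- The factor of `ampPlus` is a product of three expansions, whose coefficients give ω and
`slKappa`. As `minusMain` is already O(z⁻²), its boundary factors 1 + O(1/z) may be dropped. -/
lemma isBigO_charHalf_sub (hac : AbsolutelyContinuousOnInterval q 0 Real.pi)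
    (hq : Continuous q) :
    (fun z => charHalf hq h h₁ h₂ H H₁ H₂ z -
      (Complex.exp (z * Real.pi) *
        (1 + (slOmega q h H : ℂ) * z⁻¹ + (slKappa q h h₁ H H₁ : ℂ) * z⁻¹ ^ 2) + minusMain q z))
      =O[Bornology.cobounded ℂ] fun z => ‖z‖⁻¹ ^ 3 * expWeight z := by
  have hp : HasExpansion (boundaryFactor h h₁ h₂) h h₁ := hasExpansion_poly _ _ _
  have hr : HasExpansion (boundaryFactor H H₁ H₂) H H₁ := hasExpansion_poly _ _ _
  set Q := ((∫ s in (0 : ℝ)..Real.pi, q s : ℝ) : ℂ) with hQ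
  have h1 := (hp.mul hr).mul (hasExpansion_exp (Q / 2))
  have hpr := (hp.mul hr).isBigO_one
  have hpr' := hp.mul hr.neg
  have t1 := (hpr.mul (isBigO_ampPlus_sub hac hq)).congr_right
    (g₂ := fun z : ℂ => ‖z‖⁻¹ ^ 3 * expWeight z) (fun z => by ring)
  have t2 := IsBigO.mul h1 isBigO_exp_expWeight
  have t3 := (hpr'.sub_one_isBigO.mul (isBigO_minusMain hac hq)).congr_right
    (g₂ := fun z : ℂ => ‖z‖⁻¹ ^ 3 * expWeight z) (fun z => by ring)
  have t4 := (hpr'.isBigO_one.mul (isBigO_ampMinus_sub hac hq)).congr_right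
    (g₂ := fun z : ℂ => ‖z‖⁻¹ ^ 3 * expWeight z) (fun z => by ring)
  refine (((t1.add t2).add t3).add t4).congr_left fun z => ?_
  simp only [charHalf, slOmega, slKappa]
  push_cast
  rw [← hQ]
  ring

/-- The endpoint terms of the integration by parts combine under antisymmetrisation; this is the
origin of (q(0) + q(π))/4 in the trace formula. -/
lemma minusMain_sub_neg (hac : AbsolutelyContinuousOnInterval q 0 Real.pi) {z : ℂ} (hz : z ≠ 0) :
    minusMain q z - minusMain q (-z) =
      (((q 0 + q Real.pi) / 4 : ℝ) : ℂ) * z⁻¹ ^ 2 * (2 * Complex.sinh (z * Real.pi)) -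
      z⁻¹ ^ 2 / 2 * ∫ t in (0 : ℝ)..Real.pi,
        ((deriv q t : ℝ) : ℂ) * Complex.sinh (z * (2 * t - Real.pi)) := by
  have h1 : ∀ z : ℂ, Complex.exp (-z * Real.pi) * (∫ t in (0 : ℝ)..Real.pi,
      ((deriv q t : ℝ) : ℂ) * Complex.exp (2 * z * t)) =
      ∫ t in (0 : ℝ)..Real.pi, ((deriv q t : ℝ) : ℂ) * Complex.exp (z * (2 * t - Real.pi)) := by
    intro z
    rw [← intervalIntegral.integral_const_mul]
    refine intervalIntegral.integral_congr fun t _ => ?_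
    have : z * (2 * t - Real.pi) = -z * Real.pi + 2 * z * t := by ring
    rw [this, Complex.exp_add]
    ring
  have h2 : (∫ t in (0 : ℝ)..Real.pi,
        ((deriv q t : ℝ) : ℂ) * Complex.sinh (z * (2 * t - Real.pi))) =
      ((∫ t in (0 : ℝ)..Real.pi, ((deriv q t : ℝ) : ℂ) * Complex.exp (z * (2 * t - Real.pi))) -
      ∫ t in (0 : ℝ)..Real.pi,
        ((deriv q t : ℝ) : ℂ) * Complex.exp (-z * (2 * t - Real.pi))) / 2 := by
    rw [← intervalIntegral.integral_sub, ← intervalIntegral.integral_div]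
    · refine intervalIntegral.integral_congr fun t _ => ?_
      simp only [Complex.sinh, neg_mul]
      ring
    · exact (intervalIntegrable_ofReal_deriv hac).mul_continuousOn (by fun_prop)
    · exact (intervalIntegrable_ofReal_deriv hac).mul_continuousOn (by fun_prop)
  rw [minusMain, minusMain, h1, h1, h2, Complex.sinh]
  push_cast
  field_simp
  ring_nf

/-- Asymptotics of the characteristic function for large spectral parameter. -/
theorem isBigO_charFn_sub (hac : AbsolutelyContinuousOnInterval q 0 Real.pi)
    (hq : Continuous q) :
    (fun z : ℂ => charFn hq h h₁ h₂ H H₁ H₂ (-z ^ 2) / z ^ 5 -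
      (Complex.sinh (z * Real.pi) * (1 +
          ((slKappa q h h₁ H H₁ + (q 0 + q Real.pi) / 4 : ℝ) : ℂ) * z⁻¹ ^ 2) +
        Complex.cosh (z * Real.pi) * ((slOmega q h H : ℂ) * z⁻¹) -
        z⁻¹ ^ 2 / 4 * ∫ t in (0 : ℝ)..Real.pi,
          ((deriv q t : ℝ) : ℂ) * Complex.sinh (z * (2 * t - Real.pi))))
      =O[Bornology.cobounded ℂ] fun z => ‖z‖⁻¹ ^ 3 * expWeight z := by
  have h1 := isBigO_charHalf_sub (h := h) (h₁ := h₁) (h₂ := h₂) (H := H) (H₁ := H₁) (H₂ := H₂)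
    hac hq
  have h2 := (h1.comp_tendsto tendsto_neg_cobounded).congr_right
    (g₂ := fun z : ℂ => ‖z‖⁻¹ ^ 3 * expWeight z) (fun z => by simp [expWeight_neg])
  refine ((h1.sub h2).const_mul_left (1 / 2)).congr' ?_ EventuallyEq.rfl
  filter_upwards [eventually_ne_zero_cobounded] with z hz
  have h3 := minusMain_sub_neg hac hz
  rw [charFn_neg_sq hq hz]
  simp only [Function.comp_apply, inv_neg]
  have h4 : Complex.sinh (z * Real.pi) =
    (Complex.exp (z * Real.pi) - Complex.exp (-z * Real.pi)) / 2 := by rw [Complex.sinh, neg_mul]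
  have h5 : Complex.cosh (z * Real.pi) =
    (Complex.exp (z * Real.pi) + Complex.exp (-z * Real.pi)) / 2 := by rw [Complex.cosh, neg_mul]
  rw [h4] at h3 ⊢
  rw [h5]
  have h6 : z ^ 5 / 2 * (charHalf hq h h₁ h₂ H H₁ H₂ z - charHalf hq h h₁ h₂ H H₁ H₂ (-z)) /
      z ^ 5 = (charHalf hq h h₁ h₂ H H₁ H₂ z - charHalf hq h h₁ h₂ H H₁ H₂ (-z)) / 2 := by
    field_simp
  rw [h6]
  push_cast at h3 ⊢
  linear_combination (-1 / 2) * h3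

end CharFnAsymptotics

/-! ### Division of entire functions and Liouville's theorem on circles. -/

section EntireFunctions

open Filter Asymptotics Topology Polynomial

/-- An entire function vanishing at all zeros of an entire function with simple zeros is divisible
by it. -/
lemma exists_entire_mul_eq {f g : ℂ → ℂ} (hf : Differentiable ℂ f) (hg : Differentiable ℂ g)
    (h : ∀ w, g w = 0 → f w = 0 ∧ deriv g w ≠ 0) :
    ∃ F : ℂ → ℂ, Differentiable ℂ F ∧ ∀ w, f w = F w * g w := by
  classical
  refine ⟨fun w => if g w = 0 then deriv f w / deriv g w else f w / g w, fun w => ?_,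
    fun w => ?_⟩
  · by_cases hw : g w = 0
    · obtain ⟨hfw, hgw⟩ := h w hw
      have hds : ∀ {k : ℂ → ℂ}, Differentiable ℂ k → Differentiable ℂ (dslope k w) := by
        intro k hk
        exact differentiableOn_univ.1 ((Complex.differentiableOn_dslope univ_mem).2 hk.differentiableOn)
      have hne : ∀ᶠ v in 𝓝 w, dslope g w v ≠ 0 :=
        (hds hg).continuous.continuousAt.eventually_ne (by rwa [dslope_same])
      have heq : (fun w => if g w = 0 then deriv f w / deriv g w else f w / g w) =ᶠ[𝓝 w]
          fun v => dslope f w v / dslope g w v := by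
        filter_upwards [hne] with v hv
        by_cases hvw : v = w
        · subst hvw
          simp [hw]
        · rw [dslope_of_ne _ hvw, slope_def_field, hw, sub_zero] at hv
          have hgv : g v ≠ 0 := fun h0 => hv (by simp [h0])
          rw [if_neg hgv, dslope_of_ne _ hvw, dslope_of_ne _ hvw, slope_def_field,
            slope_def_field, hw, hfw, sub_zero, sub_zero,
            div_div_div_cancel_right₀ (sub_ne_zero.2 hvw)]
      exact (((hds hf) w).div ((hds hg) w) (by rwa [dslope_same])).congr_of_eventuallyEq heq
    · have heq : (fun w => if g w = 0 then deriv f w / deriv g w else f w / g w) =ᶠ[𝓝 w]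
          fun v => f v / g v := by
        filter_upwards [hg.continuous.continuousAt.eventually_ne hw] with v hv
        rw [if_neg hv]
      exact ((hf w).div (hg w) hw).congr_of_eventuallyEq heq
  · by_cases hw : g w = 0
    · simp [hw, (h w hw).1]
    · simp [hw]

/-- Large `z` on the circles of radius `N + 1/2`. -/
noncomputable def circleFilter : Filter ℂ := Bornology.cobounded ℂ ⊓ 𝓟 {z | ∃ N : ℕ, ‖z‖ = N + 1 / 2}

lemma eventually_circleFilter_iff {p : ℂ → Prop} : (∀ᶠ z in circleFilter, p z) ↔
    ∃ R : ℝ, ∀ z : ℂ, R ≤ ‖z‖ → (∃ N : ℕ, ‖z‖ = N + 1 / 2) → p z := by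
  rw [circleFilter, eventually_inf_principal, hasBasis_cobounded_norm.eventually_iff]
  simp

lemma circleFilter_le : circleFilter ≤ Bornology.cobounded ℂ := inf_le_left

instance circleFilter_neBot : circleFilter.NeBot := by
  refine ⟨fun h => ?_⟩
  have h1 : ∀ᶠ z in circleFilter, False := by rw [h]; exact trivial
  obtain ⟨R, hR⟩ := eventually_circleFilter_iff.1 h1
  obtain ⟨N, hN⟩ := exists_nat_gt R
  have h2 : ‖((N + 1 / 2 : ℝ) : ℂ)‖ = N + 1 / 2 := by
    rw [Complex.norm_real, Real.norm_of_nonneg (by positivity)]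
  exact hR _ (by rw [h2]; linarith) ⟨N, h2⟩

/-- An entire function of polynomial growth on circles is a polynomial. -/
lemma exists_polynomial_of_isBigO {F : ℂ → ℂ} (hF : Differentiable ℂ F) (k : ℕ)
    (hb : (fun z => F (-z ^ 2)) =O[circleFilter] fun z => ‖z‖ ^ (2 * k)) :
    ∃ p : ℂ[X], p.natDegree ≤ k ∧ ∀ w, F w = p.eval w := by
  induction k generalizing F with
  | zero =>
    obtain ⟨C, hC⟩ := hb.bound
    obtain ⟨R, hR⟩ := eventually_circleFilter_iff.1 hC
    have hbd : ∀ w, ‖F w‖ ≤ C := by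
      intro w
      obtain ⟨N, hN⟩ := exists_nat_gt (max R ‖w‖)
      have hN1 := (le_max_left _ _).trans_lt hN
      have hN2 := (le_max_right _ _).trans_lt hN
      have hw : w ∈ Metric.ball (0 : ℂ) ((N + 1 / 2) ^ 2) := by
        rw [mem_ball_zero_iff]
        nlinarith [sq_nonneg (N : ℝ)]
      -- Every point of the circle of radius `(N + 1/2)²` is `-z²` with `‖z‖ = N + 1/2`, so the
      -- maximum principle carries the bound from these circles to every disc; Liouville's theorem
      -- then applies.
      refine Complex.norm_le_of_forall_mem_frontier_norm_le Metric.isBounded_ball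
        hF.diffContOnCl (fun v hv => ?_) (subset_closure hw)
      rw [frontier_ball _ (by positivity), mem_sphere_zero_iff_norm] at hv
      obtain ⟨z, hz⟩ := IsAlgClosed.exists_pow_nat_eq (-v) two_pos
      have hz1 : ‖z‖ = N + 1 / 2 := by
        have : ‖z‖ ^ 2 = (N + 1 / 2 : ℝ) ^ 2 := by rw [← norm_pow, hz, norm_neg, hv]
        exact (pow_left_inj₀ (norm_nonneg _) (by positivity) two_ne_zero).1 this
      have := hR z (by rw [hz1]; linarith) ⟨N, hz1⟩
      simpa [hz] using this
    refine ⟨Polynomial.C (F 0), by simp, fun w => ?_⟩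
    rw [eval_C]
    refine hF.apply_eq_apply_of_bounded ?_ w 0
    rw [isBounded_iff_forall_norm_le]
    exact ⟨C, by rintro _ ⟨w, rfl⟩; exact hbd w⟩
  | succ k ih =>
    -- Passing to `(F(w) - F(0)) / w` lowers the growth by exactly one power of `z²`.
    have hG : Differentiable ℂ (dslope F 0) :=
      differentiableOn_univ.1 ((Complex.differentiableOn_dslope univ_mem).2 hF.differentiableOn)
    have hFG : ∀ w, F w = F 0 + w * dslope F 0 w := by
      intro w
      have := sub_smul_dslope F 0 w
      rw [sub_zero, smul_eq_mul] at this
      rw [this]; ring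
    have hne : ∀ᶠ z in circleFilter, 1 ≤ ‖z‖ := circleFilter_le eventually_one_le_norm
    have hGO : (fun z => dslope F 0 (-z ^ 2)) =O[circleFilter] fun z => ‖z‖ ^ (2 * k) := by
      obtain ⟨C, hC⟩ := hb.bound
      refine IsBigO.of_bound (C + ‖F 0‖) ?_
      filter_upwards [hC, hne] with z hz hz1
      rw [Real.norm_of_nonneg (by positivity)] at hz ⊢
      have e1 : z ^ 2 * dslope F 0 (-z ^ 2) = F 0 - F (-z ^ 2) := by
        rw [hFG (-z ^ 2)]; ring
      have e2 : ‖z‖ ^ 2 * ‖dslope F 0 (-z ^ 2)‖ ≤ ‖F 0‖ + C * ‖z‖ ^ (2 * (k + 1)) := by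
        rw [← norm_pow, ← norm_mul, e1]
        exact (norm_sub_le _ _).trans (by gcongr)
      have e3 : ‖F 0‖ ≤ ‖F 0‖ * ‖z‖ ^ (2 * (k + 1)) :=
        le_mul_of_one_le_right (norm_nonneg _) (one_le_pow₀ hz1)
      have e4 : ‖z‖ ^ 2 * ‖dslope F 0 (-z ^ 2)‖ ≤
          ‖z‖ ^ 2 * ((C + ‖F 0‖) * ‖z‖ ^ (2 * k)) := by
        refine e2.trans ((add_le_add e3 le_rfl).trans (le_of_eq ?_))
        ring
      exact le_of_mul_le_mul_left e4 (by positivity)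
    obtain ⟨p, hp, hpe⟩ := ih hG hGO
    refine ⟨Polynomial.C (F 0) + X * p, ?_, fun w => ?_⟩
    · refine (natDegree_add_le _ _).trans (max_le (by simp) ?_)
      exact natDegree_mul_le.trans (by rw [natDegree_X]; omega)
    · rw [hFG w, hpe w]; simp

end EntireFunctions

/-! ### Canonical products with prescribed zeros. -/

section Products

open Filter Asymptotics Topology

/-- The infinite product of the linear factors `1 + α n + β n w`. -/
noncomputable def linProd (α β : ℕ → ℂ) (w : ℂ) : ℂ := ∏' n, (1 + (α n + β n * w))

lemma summable_linProd {α β : ℕ → ℂ} (hα : Summable fun n => ‖α n‖)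
    (hβ : Summable fun n => ‖β n‖) (w : ℂ) : Summable fun n => ‖α n + β n * w‖ := by
  refine (hα.add (hβ.mul_right ‖w‖)).of_nonneg_of_le (fun n => norm_nonneg _) fun n => ?_
  exact (norm_add_le _ _).trans (by rw [norm_mul])

lemma differentiable_linProd {α β : ℕ → ℂ} (hα : Summable fun n => ‖α n‖)
    (hβ : Summable fun n => ‖β n‖) : Differentiable ℂ (linProd α β) := by
  intro w
  set R := ‖w‖ + 1
  have hw : w ∈ Metric.ball (0 : ℂ) R := by simp [R]
  have h1 : HasProdLocallyUniformlyOn (fun n w => 1 + (α n + β n * w)) (linProd α β)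
      (Metric.ball (0 : ℂ) R) := by
    refine Summable.hasProdLocallyUniformlyOn_nat_one_add Metric.isOpen_ball
      (hα.add (hβ.mul_right R)) (Eventually.of_forall fun n v hv => ?_) (fun n => by fun_prop)
    refine (norm_add_le _ _).trans ?_
    rw [norm_mul]
    have := (mem_ball_zero_iff.1 hv).le
    gcongr
  have h2 := h1.differentiableOn (.of_forall fun s => by
    simpa [Finset.prod_fn] using DifferentiableOn.finsetProd (fun _ _ => by fun_prop))
    Metric.isOpen_ball
  exact h2.differentiableAt (Metric.isOpen_ball.mem_nhds hw)

/-- Setting the `n`-th coefficients to zero turns that factor into 1, so the cofactor is again a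
`linProd` and inherits holomorphy and nonvanishing. -/
lemma linProd_eq_mul_update {α β : ℕ → ℂ} (hα : Summable fun n => ‖α n‖)
    (hβ : Summable fun n => ‖β n‖) (n : ℕ) (w : ℂ) :
    linProd α β w = (1 + (α n + β n * w)) *
      linProd (Function.update α n 0) (Function.update β n 0) w := by
  have h1 : Multipliable (Function.update (fun m => 1 + (α m + β m * w)) n 1) := by
    have := multipliable_one_add_of_summable (f := Function.update (fun m => α m + β m * w) n 0)
      (((summable_linProd hα hβ w).of_nonneg_of_le (fun _ => norm_nonneg _)) (fun m => by
        by_cases hm : m = n <;> simp [hm, Function.update]))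
    refine this.congr fun m => ?_
    by_cases hm : m = n <;> simp [hm, Function.update]
  rw [linProd, h1.tprod_eq_mul_tprod_ite' n, linProd]
  congr 1
  refine tprod_congr fun m => ?_
  by_cases hm : m = n <;> simp [hm, Function.update]

lemma summable_norm_update {α : ℕ → ℂ} (hα : Summable fun n => ‖α n‖) (n : ℕ) :
    Summable fun m => ‖Function.update α n 0 m‖ :=
  hα.of_nonneg_of_le (fun _ => norm_nonneg _) fun m => by
    by_cases hm : m = n <;> simp [hm, Function.update]

lemma norm_tprod_one_add_sub_one_le {f : ℕ → ℂ} (hf : Summable fun n => ‖f n‖) :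
    ‖∏' n, (1 + f n) - 1‖ ≤ Real.exp (∑' n, ‖f n‖) - 1 := by
  have h1 := (multipliable_one_add_of_summable hf).hasProd
  refine le_of_tendsto ((h1.sub_const 1).norm) (Eventually.of_forall fun s => ?_)
  refine (Finset.norm_prod_one_add_sub_one_le s f).trans ?_
  gcongr
  exact hf.sum_le_tsum s fun _ _ => norm_nonneg _

/-- The canonical product with zeros `a n`, normalised by the comparison sequence `b n`. -/
noncomputable def canProd (a b : ℕ → ℂ) : ℂ → ℂ :=
  linProd (fun n => (a n - b n - 1) / (b n + 1)) (fun n => -1 / (b n + 1))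

variable {a b : ℕ → ℂ}

/-- A sequence of comparison zeros. -/
structure IsBaseSeq (b : ℕ → ℂ) : Prop where
  ne : ∀ n, b n + 1 ≠ 0
  summable : Summable fun n => ‖(b n + 1)⁻¹‖

lemma IsBaseSeq.summable_beta (hb : IsBaseSeq b) : Summable fun n => ‖-1 / (b n + 1)‖ := by
  simpa [div_eq_mul_inv] using hb.summable

lemma IsBaseSeq.summable_alpha (hb : IsBaseSeq b) {C : ℝ} (ha : ∀ n, ‖a n - b n‖ ≤ C) :
    Summable fun n => ‖(a n - b n - 1) / (b n + 1)‖ := by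
  refine (hb.summable.mul_left (C + 1)).of_nonneg_of_le (fun _ => norm_nonneg _) fun n => ?_
  rw [div_eq_mul_inv, norm_mul]
  gcongr
  exact (norm_sub_le _ _).trans (by simpa using ha n)

lemma canProd_factor (hb : IsBaseSeq b) (n : ℕ) (w : ℂ) :
    1 + ((a n - b n - 1) / (b n + 1) + -1 / (b n + 1) * w) = (a n - w) / (b n + 1) := by
  have := hb.ne n
  field_simp
  ring

lemma canProd_eq (hb : IsBaseSeq b) (w : ℂ) : canProd a b w = ∏' n, (a n - w) / (b n + 1) :=
  tprod_congr fun n => canProd_factor hb n w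

lemma multipliable_canProd (hb : IsBaseSeq b) {C : ℝ} (ha : ∀ n, ‖a n - b n‖ ≤ C) (w : ℂ) :
    Multipliable fun n => (a n - w) / (b n + 1) :=
  (multipliable_one_add_of_summable
    (summable_linProd (hb.summable_alpha ha) hb.summable_beta w)).congr
    fun n => canProd_factor hb n w

lemma differentiable_canProd (hb : IsBaseSeq b) {C : ℝ} (ha : ∀ n, ‖a n - b n‖ ≤ C) :
    Differentiable ℂ (canProd a b) :=
  differentiable_linProd (hb.summable_alpha ha) hb.summable_beta

lemma canProd_ne_zero (hb : IsBaseSeq b) {C : ℝ} (ha : ∀ n, ‖a n - b n‖ ≤ C) {w : ℂ}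
    (hw : ∀ n, a n ≠ w) : canProd a b w ≠ 0 := by
  refine tprod_one_add_ne_zero_of_summable (fun n => ?_)
    (summable_linProd (hb.summable_alpha ha) hb.summable_beta w)
  rw [canProd_factor hb]
  exact div_ne_zero (sub_ne_zero.2 (hw n)) (hb.ne n)

lemma exists_canProd_eq (hb : IsBaseSeq b) {C : ℝ} (ha : ∀ n, ‖a n - b n‖ ≤ C) (n : ℕ) :
    ∃ G : ℂ → ℂ, Differentiable ℂ G ∧ (∀ w, canProd a b w = (a n - w) / (b n + 1) * G w) ∧
      ∀ w, (∀ m, m ≠ n → a m ≠ w) → G w ≠ 0 := by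
  have h1 := summable_norm_update (hb.summable_alpha ha) n
  have h2 := summable_norm_update hb.summable_beta n
  refine ⟨_, differentiable_linProd h1 h2, fun w => ?_, fun w hw => ?_⟩
  · rw [canProd, linProd_eq_mul_update (hb.summable_alpha ha) hb.summable_beta n,
      canProd_factor hb]
  · refine tprod_one_add_ne_zero_of_summable (fun m => ?_) (summable_linProd h1 h2 w)
    by_cases hm : m = n
    · simp [hm]
    · rw [Function.update_of_ne hm, Function.update_of_ne hm, canProd_factor hb]
      exact div_ne_zero (sub_ne_zero.2 (hw m hm)) (hb.ne m)

lemma canProd_eq_zero_iff (hb : IsBaseSeq b) {C : ℝ} (ha : ∀ n, ‖a n - b n‖ ≤ C) {w : ℂ} :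
    canProd a b w = 0 ↔ ∃ n, a n = w := by
  constructor
  · intro h
    by_contra! hcon
    exact canProd_ne_zero hb ha hcon h
  · rintro ⟨n, rfl⟩
    obtain ⟨G, -, hG, -⟩ := exists_canProd_eq hb ha n
    rw [hG]; simp

lemma deriv_canProd_ne_zero (hb : IsBaseSeq b) {C : ℝ} (ha : ∀ n, ‖a n - b n‖ ≤ C)
    (hinj : Function.Injective a) (n : ℕ) : deriv (canProd a b) (a n) ≠ 0 := by
  obtain ⟨G, hGd, hG, hG0⟩ := exists_canProd_eq hb ha n
  have h1 : HasDerivAt (fun w => (a n - w) / (b n + 1) * G w)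
      (-1 / (b n + 1) * G (a n) + (a n - a n) / (b n + 1) * deriv G (a n)) (a n) :=
    (((hasDerivAt_id (a n)).const_sub (a n)).div_const (b n + 1)).mul (hGd (a n)).hasDerivAt
  rw [funext hG, h1.deriv]
  simp only [sub_self, zero_div, zero_mul, add_zero]
  exact mul_ne_zero (div_ne_zero (by norm_num) (hb.ne n))
    (hG0 _ fun m hm h => hm (hinj h))

/-- Comparison of two canonical products. -/
lemma canProd_eq_mul (hb : IsBaseSeq b) {w : ℂ} (hw : ∀ n, b n ≠ w)
    (hs : Summable fun n => ‖(a n - b n) / (b n - w)‖) :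
    canProd a b w = canProd b b w * ∏' n, (1 + (a n - b n) / (b n - w)) := by
  rw [canProd_eq hb, canProd_eq hb, ← Multipliable.tprod_mul
    (multipliable_canProd (C := 0) hb (fun n => by simp) w) (multipliable_one_add_of_summable hs)]
  refine tprod_congr fun n => ?_
  have := hb.ne n
  have := sub_ne_zero.2 (hw n)
  field_simp
  ring

lemma canProd_eq_prod_mul (hb : IsBaseSeq b) {C : ℝ} (ha : ∀ n, ‖a n - b n‖ ≤ C) (k : ℕ) (w : ℂ) :
    canProd a b w = (∏ n ∈ Finset.range k, (a n - w) / (b n + 1)) *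
      canProd (fun n => a (n + k)) (fun n => b (n + k)) w := by
  have hb' : IsBaseSeq fun n => b (n + k) :=
    ⟨fun n => hb.ne _, (summable_nat_add_iff k).2 hb.summable⟩
  rw [canProd_eq hb, canProd_eq hb']
  exact (Multipliable.prod_mul_tprod_nat_mul' (f := fun n => (a n - w) / (b n + 1))
    (multipliable_canProd hb' (C := C) (fun n => ha _) w)).symm

end Products

/-! ### The unperturbed spectrum, and comparison of products on the circles |z| = N + 1/2. -/

section BaseSequence

open Filter Asymptotics Topology

/-- The unperturbed eigenvalues `0, 0, 0, 1, 4, 9, …`. -/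
noncomputable def slBase (n : ℕ) : ℝ := ((n - 2 : ℕ) : ℝ) ^ 2

lemma slBase_add_two (n : ℕ) : slBase (n + 2) = (n : ℝ) ^ 2 := by simp [slBase]

lemma slBase_nonneg (n : ℕ) : 0 ≤ slBase n := by rw [slBase]; positivity

lemma summable_slBase : Summable fun n => (slBase n + 1)⁻¹ := by
  refine (summable_nat_add_iff 3).1 ?_
  have h1 : Summable fun n : ℕ => 1 / ((n + 1 : ℕ) : ℝ) ^ 2 :=
    (summable_nat_add_iff 1).2 (Real.summable_one_div_nat_pow.2 one_lt_two)
  refine h1.of_nonneg_of_le (fun n => ?_) fun n => ?_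
  · have := slBase_nonneg (n + 3)
    positivity
  · rw [show n + 3 = n + 1 + 2 by ring, slBase_add_two, ← one_div]
    gcongr
    linarith

lemma isBaseSeq_slBase : IsBaseSeq fun n => (slBase n : ℂ) := by
  refine ⟨fun n => ?_, ?_⟩
  · have h1 := slBase_nonneg n
    have h2 : ((slBase n + 1 : ℝ) : ℂ) ≠ 0 := by
      rw [Complex.ofReal_ne_zero]; positivity
    exact_mod_cast h2
  · refine summable_slBase.congr fun n => ?_
    have h1 := slBase_nonneg n
    have h2 : ((slBase n : ℂ) + 1)⁻¹ = (((slBase n + 1)⁻¹ : ℝ) : ℂ) := by push_cast; rfl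
    rw [h2, Complex.norm_real, Real.norm_of_nonneg (by positivity)]

lemma tprod_one_add_sq_div {z : ℂ} (hz : z ≠ 0) :
    ∏' n : ℕ, (1 + z ^ 2 / ((n : ℂ) + 1) ^ 2) =
      Complex.sinh (z * Real.pi) / (z * Real.pi) := by
  have h1 := (multipliable_sineTerm (z * Complex.I)).hasProd.tendsto_prod_nat
  have h2 := tendsto_euler_sin_prod' (x := z * Complex.I) (mul_ne_zero hz Complex.I_ne_zero)
  have h3 := tendsto_nhds_unique h1 h2
  have h4 : ∀ n : ℕ, 1 + sineTerm (z * Complex.I) n = 1 + z ^ 2 / ((n : ℂ) + 1) ^ 2 := by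
    intro n
    rw [sineTerm, mul_pow, Complex.I_sq]
    ring
  rw [tprod_congr h4] at h3
  rw [h3, ← mul_assoc, Complex.sin_mul_I, mul_comm (Real.pi : ℂ) z]
  exact mul_div_mul_right _ _ Complex.I_ne_zero

lemma sinh_pi_ne_zero : Complex.sinh (Real.pi : ℂ) ≠ 0 := by
  rw [← Complex.ofReal_sinh, Complex.ofReal_ne_zero]
  exact (Real.sinh_pos_iff.2 Real.pi_pos).ne'

/-- The unperturbed canonical product. -/
lemma canProd_slBase {z : ℂ} (hz : z ≠ 0) :
    canProd (fun n => (slBase n : ℂ)) (fun n => (slBase n : ℂ)) (-z ^ 2) =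
      z ^ 5 * Complex.sinh (z * Real.pi) / Complex.sinh Real.pi := by
  have hpi : (Real.pi : ℂ) ≠ 0 := by exact_mod_cast Real.pi_ne_zero
  have hb' : IsBaseSeq fun n => (slBase (n + 3) : ℂ) :=
    ⟨fun n => isBaseSeq_slBase.ne _, (summable_nat_add_iff 3).2 isBaseSeq_slBase.summable⟩
  have hval : ∀ n, (slBase (n + 3) : ℂ) = ((n : ℂ) + 1) ^ 2 := fun n => by
    rw [show n + 3 = n + 1 + 2 by ring, slBase_add_two]; push_cast; rfl
  rw [canProd_eq_prod_mul (C := 0) isBaseSeq_slBase (fun n => by simp) 3 (-z ^ 2)]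
  -- The three zero entries contribute `z⁶`. The remaining factors form Euler's product divided by
  -- its value at `z = 1`, that is sinh(πz)/(z sinh π), leaving `z⁵ sinh(πz)` in total.
  have h1 : (∏ n ∈ Finset.range 3, ((slBase n : ℂ) - -z ^ 2) / (slBase n + 1)) = z ^ 6 := by
    simp [Finset.prod_range_succ, slBase]
    ring
  rw [h1, canProd_eq hb']
  have h2 : (∏' n : ℕ, (1 + z ^ 2 / ((n : ℂ) + 1) ^ 2)) =
      (∏' n : ℕ, ((slBase (n + 3) : ℂ) - -z ^ 2) / (slBase (n + 3) + 1)) *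
        ∏' n : ℕ, (1 + 1 ^ 2 / ((n : ℂ) + 1) ^ 2) := by
    rw [← Multipliable.tprod_mul]
    · refine tprod_congr fun n => ?_
      have h3 := hb'.ne n
      have h4 : (n : ℂ) + 1 ≠ 0 := Nat.cast_add_one_ne_zero n
      beta_reduce at h3
      rw [hval] at h3 ⊢
      field_simp
      ring
    · exact multipliable_canProd (C := 0) hb' (fun n => by simp) (-z ^ 2)
    · have := multipliable_sineTerm Complex.I
      refine this.congr fun n => ?_
      simp [sineTerm]
  rw [tprod_one_add_sq_div hz, tprod_one_add_sq_div one_ne_zero, one_mul] at h2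
  have h5 := sinh_pi_ne_zero
  rw [div_eq_iff (by positivity)] at h2
  rw [h2]
  field_simp

lemma norm_sinh_sq (z : ℂ) : ‖Complex.sinh z‖ ^ 2 = Real.sinh z.re ^ 2 + Real.sin z.im ^ 2 := by
  have h1 : Complex.sinh z = ((Real.sinh z.re * Real.cos z.im : ℝ) : ℂ) +
      ((Real.cosh z.re * Real.sin z.im : ℝ) : ℂ) * Complex.I := by
    conv_lhs => rw [← Complex.re_add_im z]
    rw [Complex.sinh_add, Complex.sinh_mul_I, Complex.cosh_mul_I]
    push_cast
    ring
  rw [← Complex.normSq_eq_norm_sq, h1, Complex.normSq_add_mul_I]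
  have h2 := Real.cosh_sq z.re
  have h3 := Real.sin_sq_add_cos_sq z.im
  nlinarith

/-- A lower bound for `sinh (π z)` on the circles of radius `N + 1/2`. -/
lemma expWeight_le_norm_sinh {z : ℂ} {N : ℕ} (hz : ‖z‖ = N + 1 / 2) :
    expWeight z ≤ 6 * ‖Complex.sinh (z * Real.pi)‖ := by
  have h1 := norm_sinh_sq (z * Real.pi)
  have hre : (z * Real.pi).re = z.re * Real.pi := by simp
  have him : (z * Real.pi).im = z.im * Real.pi := by simp
  rw [hre, him] at h1
  have hpi := Real.pi_gt_three
  have hpi4 := Real.pi_lt_four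
  -- Away from the imaginary axis sinh of the real part suffices. Near it, `‖z‖ = N + 1/2` forces
  -- `|Im z|` into `[N + 3/8, N + 1/2]`, so `|sin(π Im z)| ≥ 1/2` while the weight is at most 3;
  -- hence the constant 6.
  by_cases hx : 1 / 4 ≤ |z.re|
  · have h2 : Real.sinh (|z.re| * Real.pi) ≤ ‖Complex.sinh (z * Real.pi)‖ := by
      refine le_of_sq_le_sq ?_ (norm_nonneg _)
      have h3 : Real.sinh (|z.re| * Real.pi) ^ 2 = Real.sinh (z.re * Real.pi) ^ 2 := by
        rcases abs_cases z.re with h | h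
        · rw [h.1]
        · rw [h.1, neg_mul, Real.sinh_neg, neg_sq]
      rw [h1, h3]
      have := sq_nonneg (Real.sin (z.im * Real.pi))
      linarith
    have h4 : Real.exp (-(|z.re| * Real.pi)) ≤ 1 / 2 * Real.exp (|z.re| * Real.pi) := by
      have h5 : Real.exp (|z.re| * Real.pi) =
          Real.exp (2 * (|z.re| * Real.pi)) * Real.exp (-(|z.re| * Real.pi)) := by
        rw [← Real.exp_add]; ring_nf
      have h6 : 2 ≤ Real.exp (2 * (|z.re| * Real.pi)) := by
        have := Real.add_one_le_exp (2 * (|z.re| * Real.pi))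
        nlinarith
      have h7 := Real.exp_pos (-(|z.re| * Real.pi))
      nlinarith
    rw [Real.sinh_eq] at h2
    rw [expWeight]
    have := Real.exp_pos (|z.re| * Real.pi)
    linarith
  · push Not at hx
    have h2 : expWeight z ≤ 3 := by
      rw [expWeight]
      refine (Real.exp_le_exp.2 ?_).trans Real.exp_one_lt_three.le
      nlinarith [abs_nonneg z.re]
    have hnorm : z.re ^ 2 + z.im ^ 2 = (N + 1 / 2 : ℝ) ^ 2 := by
      rw [← hz, ← Complex.normSq_eq_norm_sq, Complex.normSq_apply]; ring
    have hN : (0 : ℝ) ≤ N := Nat.cast_nonneg N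
    have hre2 : z.re ^ 2 ≤ 1 / 16 := by
      rw [← sq_abs]; nlinarith [abs_nonneg z.re]
    have hlow : N + 3 / 8 ≤ |z.im| := by
      refine le_of_sq_le_sq ?_ (abs_nonneg _)
      rw [sq_abs]; nlinarith
    have hup : |z.im| ≤ N + 1 / 2 := by
      refine le_of_sq_le_sq ?_ (by positivity)
      rw [sq_abs]; nlinarith [sq_nonneg z.re]
    have h3 : 1 / 2 ≤ Real.sin (|z.im| * Real.pi - N * Real.pi) := by
      rw [← Real.sin_pi_div_six]
      refine Real.sin_le_sin_of_le_of_le_pi_div_two ?_ ?_ ?_ <;> nlinarith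
    rw [Real.sin_sub_nat_mul_pi] at h3
    have h4 : 1 / 4 ≤ Real.sin (z.im * Real.pi) ^ 2 := by
      have h5 : Real.sin (|z.im| * Real.pi) ^ 2 = Real.sin (z.im * Real.pi) ^ 2 := by
        rcases abs_cases z.im with h | h
        · rw [h.1]
        · rw [h.1, neg_mul, Real.sin_neg, neg_sq]
      rw [← h5]
      have h6 : ((-1 : ℝ) ^ N * Real.sin (|z.im| * Real.pi)) ^ 2 =
          Real.sin (|z.im| * Real.pi) ^ 2 := by
        rw [mul_pow, ← pow_mul, mul_comm N 2, pow_mul]; norm_num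
      rw [← h6]
      nlinarith
    have h7 : 1 / 2 ≤ ‖Complex.sinh (z * Real.pi)‖ := by
      refine le_of_sq_le_sq ?_ (norm_nonneg _)
      rw [h1]
      nlinarith [sq_nonneg (Real.sinh (z.re * Real.pi))]
    linarith

/-- With R = N + 1/2, the norm is at least |m - R|(m + R), and m + R dominates both R and |m - R|.
Giving half a power to each leaves a summable exponent 3/2 in `m` together with decay in R. -/
lemma norm_nat_sq_add_ge {z : ℂ} {N : ℕ} (hz : ‖z‖ = N + 1 / 2) (m : ℕ) :
    (N + 1 / 2 : ℝ) ^ (1 / 2 : ℝ) * |((m - N : ℤ) : ℝ) + (-1 / 2)| ^ (3 / 2 : ℝ) ≤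
      ‖((m : ℝ) ^ 2 : ℂ) + z ^ 2‖ := by
  set R : ℝ := N + 1 / 2 with hR
  have hR0 : 0 < R := by positivity
  set A : ℝ := |(m : ℝ) - R| with hA
  have hA' : |((m - N : ℤ) : ℝ) + (-1 / 2)| = A := by
    rw [hA, hR]; push_cast; congr 1; ring
  have hm : (0 : ℝ) ≤ m := Nat.cast_nonneg m
  have hAB : A ≤ m + R := abs_le.2 ⟨by linarith, by linarith⟩
  have hA0 : 0 ≤ A := abs_nonneg _
  have h1 : A * (m + R) ≤ ‖((m : ℝ) ^ 2 : ℂ) + z ^ 2‖ := by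
    have h2 : ‖((m : ℝ) ^ 2 : ℂ)‖ = (m : ℝ) ^ 2 := by simp
    have h3 : ‖-z ^ 2‖ = R ^ 2 := by rw [norm_neg, norm_pow, hz]
    have h4 := abs_norm_sub_norm_le ((m : ℝ) ^ 2 : ℂ) (-z ^ 2)
    rw [h2, h3, sub_neg_eq_add] at h4
    refine le_trans (le_of_eq ?_) h4
    rw [show (m : ℝ) ^ 2 - R ^ 2 = (m - R) * (m + R) by ring, abs_mul,
      abs_of_pos (show (0 : ℝ) < m + R by positivity)]
  rw [hA']
  refine le_trans ?_ h1
  have h5 : A ^ (3 / 2 : ℝ) = A * A ^ (1 / 2 : ℝ) := by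
    rw [show (3 / 2 : ℝ) = 1 + 1 / 2 by norm_num, Real.rpow_add_of_nonneg hA0 (by norm_num)
      (by norm_num), Real.rpow_one]
  have h6 : (m + R : ℝ) = (m + R) ^ (1 / 2 : ℝ) * (m + R) ^ (1 / 2 : ℝ) := by
    rw [← Real.rpow_add (by positivity)]; norm_num
  rw [h5]
  calc R ^ (1 / 2 : ℝ) * (A * A ^ (1 / 2 : ℝ))
      ≤ (m + R) ^ (1 / 2 : ℝ) * (A * (m + R) ^ (1 / 2 : ℝ)) := by
        gcongr
        linarith
    _ = A * (m + R) := by conv_rhs => rw [h6]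
                          ring

/-- The sums `∑ 1/|b n + z²|` over the unperturbed spectrum are small on large circles. -/
lemma exists_tsum_circle_le : ∃ A : ℝ, ∀ (N : ℕ) (z : ℂ), ‖z‖ = N + 1 / 2 →
    (∀ n, (slBase n : ℂ) + z ^ 2 ≠ 0) ∧ (Summable fun n => ‖((slBase n : ℂ) + z ^ 2)⁻¹‖) ∧
      ∑' n, ‖((slBase n : ℂ) + z ^ 2)⁻¹‖ ≤ A * (N + 1 / 2 : ℝ) ^ (-(1 / 2) : ℝ) := by
  set f : ℤ → ℝ := fun k => 1 / |(k : ℝ) + (-1 / 2)| ^ (3 / 2 : ℝ) with hf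
  have hfs : Summable f := (Real.summable_one_div_int_add_rpow (-1 / 2) (3 / 2)).2 (by norm_num)
  have hf0 : ∀ k, 0 ≤ f k := fun k => by rw [hf]; positivity
  refine ⟨3 * ∑' k, f k, fun N z hz => ?_⟩
  set R : ℝ := N + 1 / 2 with hR
  have hR0 : 0 < R := by positivity
  have hb : ∀ m : ℕ, (m - N : ℝ) + (-1 / 2) ≠ 0 := by
    intro m h
    have h1 : (2 * (m - N : ℤ) - 1 : ℤ) = 0 := by
      have : ((2 * (m - N : ℤ) - 1 : ℤ) : ℝ) = 0 := by push_cast; linarith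
      exact_mod_cast this
    omega
  have hterm : ∀ n, (slBase n : ℂ) + z ^ 2 ≠ 0 ∧
      ‖((slBase n : ℂ) + z ^ 2)⁻¹‖ ≤ R ^ (-(1 / 2) : ℝ) * f (((n - 2 : ℕ) : ℤ) - N) := by
    intro n
    have h1 := norm_nat_sq_add_ge hz (n - 2)
    have h2 : (0 : ℝ) < |((((n - 2 : ℕ) : ℤ) - N : ℤ) : ℝ) + (-1 / 2)| := by
      rw [abs_pos]; push_cast; exact hb (n - 2)
    have h3 : 0 < R ^ (1 / 2 : ℝ) * |((((n - 2 : ℕ) : ℤ) - N : ℤ) : ℝ) + (-1 / 2)| ^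
        (3 / 2 : ℝ) := by positivity
    have h4 : (slBase n : ℂ) = (((n - 2 : ℕ) : ℝ) ^ 2 : ℂ) := by rw [slBase]; push_cast; rfl
    rw [h4]
    refine ⟨norm_pos_iff.1 (h3.trans_le h1), ?_⟩
    rw [norm_inv, Real.rpow_neg hR0.le]
    refine (inv_anti₀ h3 h1).trans (le_of_eq ?_)
    rw [mul_inv]
    congr 1
    exact (one_div _).symm
  have hinj : Function.Injective fun m : ℕ => (m : ℤ) - N := fun a b h => by
    simpa using h
  have hs1 : Summable fun m : ℕ => f ((m : ℤ) - N) := hfs.comp_injective hinj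
  have hs2 : Summable fun n : ℕ => f (((n - 2 : ℕ) : ℤ) - N) :=
    (summable_nat_add_iff 2).1 (by simpa using hs1)
  have hs3 := hs2.mul_left (R ^ (-(1 / 2) : ℝ))
  have hs : Summable fun n => ‖((slBase n : ℂ) + z ^ 2)⁻¹‖ :=
    hs3.of_nonneg_of_le (fun _ => norm_nonneg _) fun n => (hterm n).2
  refine ⟨fun n => (hterm n).1, hs, (hs.tsum_le_tsum (fun n => (hterm n).2) hs3).trans ?_⟩
  rw [tsum_mul_left, mul_comm]
  gcongr
  rw [← hs2.sum_add_tsum_nat_add 2]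
  have h5 : ∑' m : ℕ, f (((m + 2 - 2 : ℕ) : ℤ) - N) ≤ ∑' k, f k := by
    simpa [Function.comp_def] using tsum_comp_le_tsum_of_inj hfs hf0 hinj
  have h6 : f (-N) ≤ ∑' k, f k := hfs.le_tsum _ fun k _ => hf0 k
  simp only [Finset.sum_range_succ, Finset.range_zero, Finset.sum_empty]
  simp only [Nat.zero_sub, Nat.reduceSub, Nat.cast_zero, zero_sub]
  linarith

/-- The quotient by the unperturbed product is ∏(1 + (a n - b n)/(b n + z²)), and the sum of its
perturbations is at most C ∑ 1/|b n + z²|, which tends to 0 along the circles. A bounded shift of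
the zeros does not change the leading growth. -/
lemma tendsto_ratio_circleFilter {a : ℕ → ℂ} {C : ℝ} (ha : ∀ n, ‖a n - slBase n‖ ≤ C) :
    Tendsto (fun z => canProd a (fun n => (slBase n : ℂ)) (-z ^ 2) /
      (z ^ 5 * Complex.sinh (z * Real.pi))) circleFilter (𝓝 (Complex.sinh Real.pi)⁻¹) := by
  obtain ⟨A, hA⟩ := exists_tsum_circle_le
  have hC0 : 0 ≤ C := (norm_nonneg _).trans (ha 0)
  have hcirc : ∀ᶠ z in circleFilter, ∃ N : ℕ, ‖z‖ = N + 1 / 2 :=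
    eventually_circleFilter_iff.2 ⟨0, fun z _ h => h⟩
  have hprod : Tendsto (fun z : ℂ => ∏' n, (1 + (a n - slBase n) / (slBase n - -z ^ 2)))
      circleFilter (𝓝 1) := by
    rw [tendsto_iff_norm_sub_tendsto_zero]
    have hnorm : Tendsto (fun z : ℂ => ‖z‖) circleFilter atTop :=
      tendsto_norm_cobounded_atTop.mono_left circleFilter_le
    have h1 : Tendsto (fun z : ℂ => Real.exp (C * (A * ‖z‖ ^ (-(1 / 2) : ℝ))) - 1)
        circleFilter (𝓝 0) := by
      have h2 := (tendsto_rpow_neg_atTop (y := 1 / 2) (by norm_num)).comp hnorm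
      have h3 := ((Real.continuous_exp.tendsto _).comp ((h2.const_mul A).const_mul C)).sub_const 1
      simpa using h3
    refine squeeze_zero' (Eventually.of_forall fun _ => norm_nonneg _) ?_ h1
    filter_upwards [hcirc] with z ⟨N, hN⟩
    obtain ⟨h2, h3, h4⟩ := hA N z hN
    have h5 : ∀ n, ‖(a n - slBase n) / (slBase n - -z ^ 2)‖ ≤
        C * ‖((slBase n : ℂ) + z ^ 2)⁻¹‖ := by
      intro n
      rw [sub_neg_eq_add, div_eq_mul_inv, norm_mul]
      gcongr
      exact ha n
    have h6 : Summable fun n => ‖(a n - slBase n) / (slBase n - -z ^ 2)‖ :=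
      (h3.mul_left C).of_nonneg_of_le (fun _ => norm_nonneg _) h5
    refine (norm_tprod_one_add_sub_one_le h6).trans ?_
    rw [hN]
    gcongr
    refine (h6.tsum_le_tsum h5 (h3.mul_left C)).trans ?_
    rw [tsum_mul_left]
    gcongr
  have hfin := hprod.mul_const (Complex.sinh Real.pi)⁻¹
  rw [one_mul] at hfin
  refine hfin.congr' ?_
  filter_upwards [hcirc, circleFilter_le eventually_ne_zero_cobounded] with z ⟨N, hN⟩ hz0
  obtain ⟨h2, h3, h4⟩ := hA N z hN
  have h5 : Complex.sinh (z * Real.pi) ≠ 0 := by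
    have h6 := expWeight_le_norm_sinh hN
    have h7 := expWeight_pos z
    exact norm_pos_iff.1 (by linarith)
  rw [canProd_eq_mul isBaseSeq_slBase (fun n h => h2 n (by rw [h]; ring)), canProd_slBase hz0]
  · field_simp
  · refine (h3.mul_left C).of_nonneg_of_le (fun _ => norm_nonneg _) fun n => ?_
    rw [sub_neg_eq_add, div_eq_mul_inv, norm_mul]
    gcongr
    exact ha n

end BaseSequence

/-! ### Zeros near the squares of large integers, and their asymptotics. -/

section RealAxis

open Filter Asymptotics Topology

variable {q : ℝ → ℝ} {h h₁ h₂ H H₁ H₂ : ℝ}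

lemma abs_sin_sub_self_le (x : ℝ) : |Real.sin x - x| ≤ 2 * |x| ^ 3 := by
  have h0 := abs_nonneg x
  rcases le_total |x| 1 with hx | hx
  · have h1 := Real.sin_bound hx
    have h2 : |Real.sin x - x| ≤ |Real.sin x - (x - x ^ 3 / 6)| + |x ^ 3 / 6| := by
      rw [show Real.sin x - x = (Real.sin x - (x - x ^ 3 / 6)) + -(x ^ 3 / 6) by ring]
      refine (abs_add_le _ _).trans ?_
      rw [abs_neg]
    have h3 : |x ^ 3 / 6| = |x| ^ 3 / 6 := by rw [abs_div, abs_pow]; norm_num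
    have h4 : |x| ^ 5 ≤ |x| ^ 3 := pow_le_pow_of_le_one h0 hx (by norm_num)
    have h5 : 0 ≤ |x| ^ 3 := by positivity
    rw [h3] at h2
    linarith
  · have h1 : |Real.sin x - x| ≤ |Real.sin x| + |x| := abs_sub _ _
    have h2 := Real.abs_sin_le_one x
    have h3 : |x| ≤ |x| ^ 3 := le_self_pow₀ hx (by norm_num)
    linarith

set_option maxHeartbeats 1000000 in
/-- Perturbation of a zero of `sin (π s)` near an integer `m`. -/
lemma exists_root_asymptotics (κ ω C K L : ℝ) (hK : 0 ≤ K) (hL : 0 ≤ L) (hC : 0 ≤ C) :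
    ∃ B, 0 ≤ B ∧ ∀ m σ Y j : ℝ, 1 ≤ m → |σ - m| ≤ 1 / 2 → |Y| ≤ K → |Y| ≤ |j| + L * |σ - m| →
      |Real.sin (Real.pi * (σ - m)) * (1 - κ / σ ^ 2) - ω * Real.cos (Real.pi * (σ - m)) / σ +
        Y / (4 * σ ^ 2)| ≤ C / σ ^ 3 →
      |σ - m| ≤ B / m ∧ |σ ^ 2 - m ^ 2 - 2 * ω / Real.pi| ≤ B * (|j| / m + 1 / m ^ 2) := by
  -- The equation is used twice. `A` bounds `m * |sin(πε)|`, hence `m * |ε|`, when every term but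
  -- the sine is estimated crudely; `B₁` collects the cubic errors once `|ε| ≤ A / m` is fed back
  -- in.
  set A : ℝ := 4 * |κ| + 2 * |ω| + K + 8 * C with hA
  have hA0 : 0 ≤ A := by positivity
  set B₁ : ℝ := 2 * Real.pi ^ 3 * A ^ 3 + 8 * C + 4 * A * |κ| + |ω| * Real.pi ^ 2 * A ^ 2 +
    2 * |ω| * A + L * A with hB₁
  have hB₁0 : 0 ≤ B₁ := by positivity
  have hpi := Real.pi_gt_three
  refine ⟨A + B₁ + A ^ 2 + 1, by positivity, fun m σ Y j hm hε hYK hYj hroot => ?_⟩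
  set ε := σ - m with hεdef
  set S := Real.sin (Real.pi * ε) with hS
  set Co := Real.cos (Real.pi * ε) with hCo
  set T := S * (1 - κ / σ ^ 2) - ω * Co / σ + Y / (4 * σ ^ 2) with hT
  have hm0 : 0 < m := by linarith
  have hσm : m / 2 ≤ σ := by linarith [(abs_le.1 hε).1]
  have hσ0 : 0 < σ := by linarith
  set u := 1 / m with hu
  set v := 1 / σ with hv
  have hu0 : 0 < u := by positivity
  have hv0 : 0 < v := by positivity
  have hu1 : u ≤ 1 := by rw [hu, div_le_one hm0]; exact hm
  have hvu : v ≤ 2 * u := by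
    rw [hv, hu, div_le_iff₀ hσ0, mul_one_div, div_mul_eq_mul_div, le_div_iff₀ hm0]; linarith
  have eT : T = S * (1 - κ * v ^ 2) - ω * Co * v + Y * v ^ 2 / 4 := by
    rw [hT, hv]; field_simp
  have hTC : |T| ≤ C * v ^ 3 := hroot.trans (le_of_eq (by rw [hv]; field_simp))
  have hv2 : v ^ 2 ≤ 4 * u ^ 2 := by
    calc v ^ 2 ≤ (2 * u) ^ 2 := by gcongr
      _ = _ := by ring
  have hv3 : v ^ 3 ≤ 8 * u ^ 3 := by
    calc v ^ 3 ≤ (2 * u) ^ 3 := by gcongr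
      _ = _ := by ring
  have hu2 : u ^ 2 ≤ u := pow_le_of_le_one hu0.le hu1 (by norm_num)
  have hu3 : u ^ 3 ≤ u := pow_le_of_le_one hu0.le hu1 (by norm_num)
  have hS1 : |S| ≤ 1 := Real.abs_sin_le_one _
  have hCo1 : |Co| ≤ 1 := Real.abs_cos_le_one _
  have hSA : |S| ≤ A * u := by
    have e : S = T + S * κ * v ^ 2 + ω * Co * v - Y * v ^ 2 / 4 := by rw [eT]; ring
    have b1 : |S * κ * v ^ 2| ≤ 4 * |κ| * u := by
      rw [abs_mul, abs_mul, abs_of_nonneg (by positivity : 0 ≤ v ^ 2)]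
      calc |S| * |κ| * v ^ 2 ≤ 1 * |κ| * (4 * u ^ 2) := by gcongr
        _ ≤ 1 * |κ| * (4 * u) := by gcongr
        _ = _ := by ring
    have b2 : |ω * Co * v| ≤ 2 * |ω| * u := by
      rw [abs_mul, abs_mul, abs_of_pos hv0]
      calc |ω| * |Co| * v ≤ |ω| * 1 * (2 * u) := by gcongr
        _ = _ := by ring
    have b3 : |Y * v ^ 2 / 4| ≤ K * u := by
      rw [abs_div, abs_mul, abs_of_nonneg (by positivity : 0 ≤ v ^ 2)]
      calc |Y| * v ^ 2 / |4| ≤ K * (4 * u ^ 2) / |4| := by gcongr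
        _ ≤ K * (4 * u) / |4| := by gcongr
        _ = _ := by norm_num; ring
    have b4 : |T| ≤ 8 * C * u := by
      refine hTC.trans ?_
      calc C * v ^ 3 ≤ C * (8 * u) := mul_le_mul_of_nonneg_left (by linarith) hC
        _ = _ := by ring
    rw [e]
    refine (abs_sub _ _).trans ((add_le_add (abs_add_three _ _ _) le_rfl).trans ?_)
    rw [hA]
    linarith
  have hεS : 2 * |ε| ≤ |S| := by
    have h1 : |Real.pi * ε| ≤ Real.pi / 2 := by
      rw [abs_mul, abs_of_pos Real.pi_pos]
      linarith [mul_le_mul_of_nonneg_left hε Real.pi_pos.le]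
    have h2 := Real.mul_abs_le_abs_sin h1
    rw [abs_mul, abs_of_pos Real.pi_pos] at h2
    calc 2 * |ε| = 2 / Real.pi * (Real.pi * |ε|) := by field_simp
      _ ≤ _ := h2
  have hεA : |ε| ≤ A * u := by linarith [abs_nonneg ε]
  -- Now every correction to πε = ω/m is of order `m⁻³`, except the term in `j`, which enters with
  -- `m⁻²`. Multiplication by 2m/π gives the assertion on σ² - m² = 2mε + ε².
  have hmain : |Real.pi * ε - ω * u| ≤ B₁ * u ^ 3 + |j| * u ^ 2 := by
    have e : Real.pi * ε - ω * u = -(S - Real.pi * ε) + T + S * κ * v ^ 2 + ω * (Co - 1) * v +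
        ω * (v - u) - Y * v ^ 2 / 4 := by rw [eT]; ring
    have b1 : |-(S - Real.pi * ε)| ≤ 2 * Real.pi ^ 3 * A ^ 3 * u ^ 3 := by
      rw [abs_neg]
      refine (abs_sin_sub_self_le _).trans ?_
      rw [abs_mul, abs_of_pos Real.pi_pos]
      calc 2 * (Real.pi * |ε|) ^ 3 ≤ 2 * (Real.pi * (A * u)) ^ 3 := by gcongr
        _ = _ := by ring
    have b2 : |T| ≤ 8 * C * u ^ 3 := hTC.trans (by linarith [mul_le_mul_of_nonneg_left hv3 hC])
    have b3 : |S * κ * v ^ 2| ≤ 4 * A * |κ| * u ^ 3 := by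
      rw [abs_mul, abs_mul, abs_of_nonneg (by positivity : 0 ≤ v ^ 2)]
      calc |S| * |κ| * v ^ 2 ≤ (A * u) * |κ| * (4 * u ^ 2) := by gcongr
        _ = _ := by ring
    have b4 : |ω * (Co - 1) * v| ≤ |ω| * Real.pi ^ 2 * A ^ 2 * u ^ 3 := by
      have c1 : |Co - 1| ≤ (Real.pi * (A * u)) ^ 2 / 2 := by
        have c2 := Real.one_sub_sq_div_two_le_cos (x := Real.pi * ε)
        have c3 := Real.cos_le_one (Real.pi * ε)
        rw [abs_sub_comm, abs_of_nonneg (by linarith)]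
        have c4 : (Real.pi * ε) ^ 2 ≤ (Real.pi * (A * u)) ^ 2 := by
          rw [← sq_abs (Real.pi * ε), abs_mul, abs_of_pos Real.pi_pos]
          gcongr
        linarith
      rw [abs_mul, abs_mul, abs_of_pos hv0]
      calc |ω| * |Co - 1| * v ≤ |ω| * ((Real.pi * (A * u)) ^ 2 / 2) * (2 * u) := by gcongr
        _ = _ := by ring
    have b5 : |ω * (v - u)| ≤ 2 * |ω| * A * u ^ 3 := by
      have c1 : v - u = -ε * v * u := by
        rw [hv, hu, hεdef]; field_simp; ring
      rw [c1, abs_mul, abs_mul, abs_mul, abs_neg, abs_of_pos hv0, abs_of_pos hu0]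
      calc |ω| * (|ε| * v * u) ≤ |ω| * ((A * u) * (2 * u) * u) := by gcongr
        _ = _ := by ring
    have b6 : |Y * v ^ 2 / 4| ≤ |j| * u ^ 2 + L * A * u ^ 3 := by
      rw [abs_div, abs_mul, abs_of_nonneg (by positivity : 0 ≤ v ^ 2)]
      calc |Y| * v ^ 2 / |4| ≤ (|j| + L * (A * u)) * (4 * u ^ 2) / |4| := by
            gcongr
            exact hYj.trans (by gcongr)
        _ = _ := by norm_num; ring
    rw [e]
    refine (abs_sub _ _).trans ?_
    have c1 := abs_add_three (-(S - Real.pi * ε) + T + S * κ * v ^ 2) (ω * (Co - 1) * v)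
      (ω * (v - u))
    have c2 := abs_add_three (-(S - Real.pi * ε)) T (S * κ * v ^ 2)
    rw [hB₁]
    linarith
  have hj0 := abs_nonneg j
  constructor
  · rw [show (A + B₁ + A ^ 2 + 1) / m = (A + B₁ + A ^ 2 + 1) * u by rw [hu]; ring]
    refine hεA.trans ?_
    gcongr
    linarith [sq_nonneg A]
  · have hmu : m * u = 1 := by rw [hu]; field_simp
    have e : σ ^ 2 - m ^ 2 - 2 * ω / Real.pi =
        2 / Real.pi * (m * (Real.pi * ε - ω * u)) + ε ^ 2 := by
      have : σ = m + ε := by rw [hεdef]; ring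
      rw [mul_sub, show m * (ω * u) = ω by rw [mul_left_comm, hmu, mul_one], this]
      field_simp
      ring
    have b1 : |2 / Real.pi * (m * (Real.pi * ε - ω * u))| ≤ B₁ * u ^ 2 + |j| * u := by
      rw [abs_mul, abs_mul, abs_of_pos hm0, abs_of_pos (by positivity : 0 < 2 / Real.pi)]
      have c1 : 2 / Real.pi ≤ 1 := by rw [div_le_one Real.pi_pos]; linarith
      calc _ ≤ 1 * (m * (B₁ * u ^ 3 + |j| * u ^ 2)) := by gcongr
        _ = (m * u) * (B₁ * u ^ 2 + |j| * u) := by ring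
        _ = _ := by rw [hmu, one_mul]
    have b2 : |ε ^ 2| ≤ A ^ 2 * u ^ 2 := by
      rw [abs_pow, ← mul_pow]; gcongr
    rw [e, show |j| / m + 1 / m ^ 2 = |j| * u + u ^ 2 by rw [hu]; field_simp]
    refine (abs_add_le _ _).trans ((add_le_add b1 b2).trans ?_)
    have c1 : 0 ≤ |j| * u := by positivity
    have c2 : 0 ≤ u ^ 2 := by positivity
    linarith [mul_nonneg hA0 c1, mul_nonneg hB₁0 c1, mul_nonneg (sq_nonneg A) c1,
      mul_nonneg hA0 c2]

/-- The characteristic function on the positive half line, normalised to look like `sin (π s)`. -/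
noncomputable def charReal (hq : Continuous q) (h h₁ h₂ H H₁ H₂ : ℝ) (s : ℝ) : ℝ :=
  -(charFn hq h h₁ h₂ H H₁ H₂ ((s : ℂ) ^ 2)).re / s ^ 5

/-- The integral `∫_0^π q'(t) sin (s (2 t - π)) dt`. -/
noncomputable def derivSine (q : ℝ → ℝ) (s : ℝ) : ℝ :=
  ∫ t in (0 : ℝ)..Real.pi, deriv q t * Real.sin (s * (2 * t - Real.pi))

lemma charFn_ofReal_sq (hq : Continuous q) (s : ℝ) :
    charFn hq h h₁ h₂ H H₁ H₂ ((s : ℂ) ^ 2) =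
      ((charFn hq h h₁ h₂ H H₁ H₂ ((s : ℂ) ^ 2)).re : ℂ) := by
  have h1 := charFn_conj (h := h) (h₁ := h₁) (h₂ := h₂) (H := H) (H₁ := H₁) (H₂ := H₂) hq
    ((s : ℂ) ^ 2)
  rw [map_pow, Complex.conj_ofReal] at h1
  exact (Complex.conj_eq_iff_re.1 h1.symm).symm

/-- The expansion at `z = is`: the exponential weight is 1, sinh and cosh become i sin and cos, and
a common factor i is removed. -/
lemma exists_abs_charReal_sub_le (hac : AbsolutelyContinuousOnInterval q 0 Real.pi)
    (hq : Continuous q) : ∃ κ C R : ℝ, 0 ≤ C ∧ 1 ≤ R ∧ ∀ s, R ≤ s →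
      |charReal hq h h₁ h₂ H H₁ H₂ s - (Real.sin (s * Real.pi) * (1 - κ / s ^ 2) -
        slOmega q h H * Real.cos (s * Real.pi) / s + derivSine q s / (4 * s ^ 2))| ≤
      C / s ^ 3 := by
  set κ := slKappa q h h₁ H H₁ + (q 0 + q Real.pi) / 4 with hκ
  obtain ⟨C, hC0, hC⟩ := (isBigO_charFn_sub (h := h) (h₁ := h₁) (h₂ := h₂) (H := H)
    (H₁ := H₁) (H₂ := H₂) hac hq).exists_pos
  obtain ⟨R, -, hR⟩ := hasBasis_cobounded_norm.eventually_iff.1 hC.bound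
  refine ⟨κ, C, max R 1, hC0.le, le_max_right _ _, fun s hs => ?_⟩
  have hs1 : 1 ≤ s := (le_max_right _ _).trans hs
  have hs0 : 0 < s := by linarith
  have hnorm : ‖(s : ℂ) * Complex.I‖ = s := by
    rw [norm_mul, Complex.norm_I, mul_one, Complex.norm_real, Real.norm_of_nonneg hs0.le]
  have h1 := @hR (s * Complex.I) (by
    change R ≤ ‖(s : ℂ) * Complex.I‖
    rw [hnorm]; exact (le_max_left _ _).trans hs)
  have hw : expWeight (s * Complex.I) = 1 := by simp [expWeight]
  rw [hw, hnorm, mul_one, Real.norm_of_nonneg (by positivity)] at h1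
  have hsq : -((s : ℂ) * Complex.I) ^ 2 = (s : ℂ) ^ 2 := by rw [mul_pow, Complex.I_sq]; ring
  rw [hsq, charFn_ofReal_sq] at h1
  have hsinh : Complex.sinh (s * Complex.I * Real.pi) =
      (Real.sin (s * Real.pi) : ℂ) * Complex.I := by
    rw [show (s : ℂ) * Complex.I * Real.pi = ((s * Real.pi : ℝ) : ℂ) * Complex.I by
      push_cast; ring, Complex.sinh_mul_I, Complex.ofReal_sin]
  have hcosh : Complex.cosh (s * Complex.I * Real.pi) = (Real.cos (s * Real.pi) : ℂ) := by
    rw [show (s : ℂ) * Complex.I * Real.pi = ((s * Real.pi : ℝ) : ℂ) * Complex.I by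
      push_cast; ring, Complex.cosh_mul_I, Complex.ofReal_cos]
  have hint : (∫ t in (0 : ℝ)..Real.pi,
      ((deriv q t : ℝ) : ℂ) * Complex.sinh (s * Complex.I * (2 * t - Real.pi))) =
      (derivSine q s : ℂ) * Complex.I := by
    rw [derivSine, ← intervalIntegral.integral_ofReal, ← intervalIntegral.integral_mul_const]
    refine intervalIntegral.integral_congr fun t _ => ?_
    rw [show (s : ℂ) * Complex.I * (2 * t - Real.pi) =
      ((s * (2 * t - Real.pi) : ℝ) : ℂ) * Complex.I by push_cast; ring, Complex.sinh_mul_I]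
    push_cast
    ring
  rw [hsinh, hcosh, hint] at h1
  have hsC : (s : ℂ) ≠ 0 := by exact_mod_cast hs0.ne'
  have hinv : ((s : ℂ) * Complex.I)⁻¹ = -(s : ℂ)⁻¹ * Complex.I := by
    rw [mul_inv, Complex.inv_I]; ring
  have hI5 : ((s : ℂ) * Complex.I) ^ 5 = (s : ℂ) ^ 5 * Complex.I := by
    rw [mul_pow, show Complex.I ^ 5 = Complex.I by
      rw [show Complex.I ^ 5 = (Complex.I ^ 2) ^ 2 * Complex.I by ring, Complex.I_sq]; ring]
  have hfin : ∀ r : ℝ, (r : ℂ) / (s * Complex.I) ^ 5 -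
      ((Real.sin (s * Real.pi) : ℂ) * Complex.I * (1 + (κ : ℂ) * (s * Complex.I)⁻¹ ^ 2) +
        (Real.cos (s * Real.pi) : ℂ) * ((slOmega q h H : ℂ) * (s * Complex.I)⁻¹) -
        (s * Complex.I)⁻¹ ^ 2 / 4 * ((derivSine q s : ℂ) * Complex.I)) =
      ((-r / s ^ 5 - (Real.sin (s * Real.pi) * (1 - κ / s ^ 2) -
        slOmega q h H * Real.cos (s * Real.pi) / s + derivSine q s / (4 * s ^ 2)) : ℝ) : ℂ) *
        Complex.I := by
    intro r
    rw [hI5, hinv, mul_pow, Complex.I_sq, div_mul_eq_div_div, Complex.div_I]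
    push_cast
    field_simp
    ring
  rw [hfin, norm_mul, Complex.norm_I, mul_one, Complex.norm_real, Real.norm_eq_abs] at h1
  rw [charReal]
  refine h1.trans (le_of_eq ?_)
  field_simp

lemma continuousOn_charReal (hq : Continuous q) :
    ContinuousOn (charReal hq h h₁ h₂ H H₁ H₂) (Ioi 0) := by
  have h1 := (differentiable_charFn (h := h) (h₁ := h₁) (h₂ := h₂) (H := H) (H₁ := H₁)
    (H₂ := H₂) hq).continuous
  have h2 : Continuous fun s : ℝ => -(charFn hq h h₁ h₂ H H₁ H₂ ((s : ℂ) ^ 2)).re :=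
    (Complex.continuous_re.comp (h1.comp (by fun_prop))).neg
  exact h2.continuousOn.div (by fun_prop) fun s hs => pow_ne_zero _ (ne_of_gt hs)

lemma intervalIntegrable_deriv_mul_sin (hac : AbsolutelyContinuousOnInterval q 0 Real.pi)
    (s : ℝ) : IntervalIntegrable (fun t => deriv q t * Real.sin (s * (2 * t - Real.pi))) volume 0
      Real.pi :=
  hac.intervalIntegrable_deriv.mul_continuousOn (by fun_prop)

lemma abs_derivSine_le (hac : AbsolutelyContinuousOnInterval q 0 Real.pi) (s : ℝ) :
    |derivSine q s| ≤ ∫ t in (0 : ℝ)..Real.pi, |deriv q t| := by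
  rw [derivSine, ← Real.norm_eq_abs]
  refine intervalIntegral.norm_integral_le_of_norm_le Real.pi_pos.le
    (Eventually.of_forall fun t _ => ?_) hac.intervalIntegrable_deriv.abs
  rw [norm_mul, Real.norm_eq_abs, Real.norm_eq_abs]
  exact mul_le_of_le_one_right (abs_nonneg _) (Real.abs_sin_le_one _)

/-- The frequency `2t - π` is bounded by `π`. This Lipschitz bound lets the value of `derivSine` at
the unknown zero be replaced by its value at the integer. -/
lemma abs_derivSine_sub_le (hac : AbsolutelyContinuousOnInterval q 0 Real.pi) (s s' : ℝ) :
    |derivSine q s - derivSine q s'| ≤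
      (Real.pi * ∫ t in (0 : ℝ)..Real.pi, |deriv q t|) * |s - s'| := by
  rw [derivSine, derivSine, ← intervalIntegral.integral_sub
    (intervalIntegrable_deriv_mul_sin hac s) (intervalIntegrable_deriv_mul_sin hac s'),
    ← Real.norm_eq_abs]
  refine (intervalIntegral.norm_integral_le_of_norm_le (g := fun t => Real.pi * |s - s'| *
    |deriv q t|) Real.pi_pos.le
    (Eventually.of_forall fun t ht => ?_) (hac.intervalIntegrable_deriv.abs.const_mul _)).trans ?_
  · rw [← mul_sub, norm_mul, Real.norm_eq_abs, Real.norm_eq_abs, mul_comm]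
    gcongr
    refine (Real.abs_sin_sub_sin_le _ _).trans ?_
    rw [← sub_mul, abs_mul, mul_comm]
    gcongr
    exact abs_le.2 ⟨by linarith [ht.1], by linarith [ht.2]⟩
  · rw [intervalIntegral.integral_const_mul]
    exact le_of_eq (by ring)

/-- Bessel's inequality for the sine coefficients of `q'`. -/
lemma summable_derivSine_sq (hq : MemW21 q) : Summable fun m : ℕ => derivSine q m ^ 2 := by
  have hmem : MemLp (fun t => ((deriv q t : ℝ) : ℂ)) 2 (volume.restrict (Ioc 0 Real.pi)) :=
    (hq.2.mono_measure (Measure.restrict_mono Ioc_subset_Icc_self le_rfl)).ofReal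
  have h1 := (hasSum_sq_fourierCoeffOn Real.pi_pos hmem).summable
  have h2 : Summable fun m : ℕ => Real.pi ^ 2 *
      ‖fourierCoeffOn Real.pi_pos (fun t => ((deriv q t : ℝ) : ℂ)) (m : ℤ)‖ ^ 2 :=
    (h1.comp_injective Nat.cast_injective).mul_left _
  refine h2.of_nonneg_of_le (fun _ => sq_nonneg _) fun m => ?_
  rw [← mul_pow, ← sq_abs (derivSine q m)]
  gcongr
  have h3 : (derivSine q m : ℂ) =
      (∫ t in (0 : ℝ)..Real.pi, ((deriv q t : ℝ) : ℂ) * (Real.sin (m * (2 * t - Real.pi)) : ℂ)) := by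
    rw [derivSine, ← intervalIntegral.integral_ofReal]
    push_cast
    rfl
  have hI : IntervalIntegrable (fun t : ℝ => (fourier (-(m : ℤ)) : AddCircle (Real.pi - 0) → ℂ) t •
      ((deriv q t : ℝ) : ℂ)) volume 0 Real.pi := by
    simp only [smul_eq_mul]
    refine (intervalIntegrable_ofReal_deriv hq.1).continuousOn_mul ?_
    exact ((map_continuous (fourier (-(m : ℤ)))).comp
      (AddCircle.continuous_mk' (Real.pi - 0))).continuousOn
  -- sin(m(2t - π)) = (-1)^m sin(2mt), and `sin(2mt)` is, up to sign, the imaginary part of a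
  -- character of the circle of length `π`.
  have h4 : derivSine q m = (-1) ^ m * -(∫ t in (0 : ℝ)..Real.pi,
      (fourier (-(m : ℤ)) : AddCircle (Real.pi - 0) → ℂ) t • ((deriv q t : ℝ) : ℂ)).im := by
    have e1 := Complex.imCLM.intervalIntegral_comp_comm hI
    simp only [Complex.imCLM_apply] at e1
    rw [← e1, derivSine, ← intervalIntegral.integral_neg, ← intervalIntegral.integral_const_mul]
    refine intervalIntegral.integral_congr fun t _ => ?_
    rw [fourier_coe_apply, smul_eq_mul, Complex.im_mul_ofReal]
    have e2 : 2 * (Real.pi : ℂ) * Complex.I * ((-(m : ℤ) : ℤ) : ℂ) * t / ((Real.pi - 0 : ℝ) : ℂ) =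
        ((-(2 * m * t) : ℝ) : ℂ) * Complex.I := by
      have : (Real.pi : ℂ) ≠ 0 := by exact_mod_cast Real.pi_ne_zero
      push_cast
      rw [sub_zero]
      field_simp
    rw [e2, Complex.exp_ofReal_mul_I_im, Real.sin_neg,
      show (m : ℝ) * (2 * t - Real.pi) = 2 * m * t - m * Real.pi by ring,
      Real.sin_sub_nat_mul_pi]
    ring
  rw [h4, abs_mul, abs_pow, abs_neg, abs_neg, abs_one, one_pow, one_mul]
  refine (Complex.abs_im_le_norm _).trans (le_of_eq ?_)
  rw [fourierCoeffOn_eq_integral, norm_smul, Real.norm_of_nonneg (by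
    rw [sub_zero]; exact (one_div_pos.2 Real.pi_pos).le), sub_zero]
  field_simp

/-- Existence and asymptotics of a zero of the characteristic function near each large `m²`. -/
theorem exists_zeros_near_integers (hq2 : MemW21 q) (hq : Continuous q) :
    ∃ (m₀ : ℕ) (σ : ℕ → ℝ) (B : ℝ), 1 ≤ m₀ ∧ 0 ≤ B ∧ ∀ m : ℕ, m₀ ≤ m →
      |σ m - m| < 1 / 2 ∧ charFn hq h h₁ h₂ H H₁ H₂ (((σ m) ^ 2 : ℝ) : ℂ) = 0 ∧
      |σ m ^ 2 - (m : ℝ) ^ 2 - 2 * slOmega q h H / Real.pi| ≤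
        B * (|derivSine q m| / m + 1 / (m : ℝ) ^ 2) := by
  have hac := hq2.1
  obtain ⟨κ, C, R, hC0, hR1, hR⟩ := exists_abs_charReal_sub_le (h := h) (h₁ := h₁) (h₂ := h₂)
    (H := H) (H₁ := H₁) (H₂ := H₂) hac hq
  set ω := slOmega q h H with hω
  set K := ∫ t in (0 : ℝ)..Real.pi, |deriv q t| with hK
  have hK0 : 0 ≤ K := intervalIntegral.integral_nonneg Real.pi_pos.le fun _ _ => abs_nonneg _
  obtain ⟨B, hB0, hB⟩ := exists_root_asymptotics κ ω C K (Real.pi * K) hK0 (by positivity) hC0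
  set D := charReal hq h h₁ h₂ H H₁ H₂ with hD
  set C' := |κ| + |ω| + K + C with hC'
  have hfirst : ∀ s, R ≤ s → |D s - Real.sin (s * Real.pi)| ≤ C' / s := by
    intro s hs
    have hs1 : 1 ≤ s := hR1.trans hs
    have hs0 : 0 < s := by linarith
    have h1 := hR s hs
    have e : D s - Real.sin (s * Real.pi) =
        (D s - (Real.sin (s * Real.pi) * (1 - κ / s ^ 2) - ω * Real.cos (s * Real.pi) / s +
          derivSine q s / (4 * s ^ 2))) + -(Real.sin (s * Real.pi) * (κ / s ^ 2)) +
        -(ω * Real.cos (s * Real.pi) / s) + derivSine q s / (4 * s ^ 2) := by ring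
    have hss : 1 / s ^ 2 ≤ 1 / s := one_div_le_one_div_of_le hs0 (by nlinarith)
    have hsss : 1 / s ^ 3 ≤ 1 / s :=
      one_div_le_one_div_of_le hs0 (le_self_pow₀ hs1 (by norm_num))
    have b1 : C / s ^ 3 ≤ C * (1 / s) := by rw [div_eq_mul_one_div]; gcongr
    have b2 : |-(Real.sin (s * Real.pi) * (κ / s ^ 2))| ≤ |κ| * (1 / s) := by
      rw [abs_neg, abs_mul, abs_div, abs_of_pos (by positivity : 0 < s ^ 2)]
      calc _ ≤ 1 * (|κ| / s ^ 2) := by gcongr; exact Real.abs_sin_le_one _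
        _ = |κ| * (1 / s ^ 2) := by ring
        _ ≤ _ := by gcongr
    have b3 : |-(ω * Real.cos (s * Real.pi) / s)| ≤ |ω| * (1 / s) := by
      rw [abs_neg, abs_div, abs_mul, abs_of_pos hs0]
      calc _ ≤ |ω| * 1 / s := by gcongr; exact Real.abs_cos_le_one _
        _ = _ := by ring
    have b4 : |derivSine q s / (4 * s ^ 2)| ≤ K * (1 / s) := by
      rw [abs_div, abs_of_pos (by positivity : 0 < 4 * s ^ 2)]
      calc _ ≤ K / (4 * s ^ 2) := by gcongr; exact abs_derivSine_le hac s
        _ = K * (1 / s ^ 2) / 4 := by field_simp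
        _ ≤ K * (1 / s) / 4 := by gcongr
        _ ≤ K * (1 / s) := by
          have : 0 ≤ K * (1 / s) := by positivity
          linarith
    rw [e]
    refine (abs_add_le _ _).trans ((add_le_add (abs_add_three _ _ _) b4).trans ?_)
    have hC's : C' / s = (|κ| + |ω| + K + C) * (1 / s) := by rw [hC']; ring
    rw [hC's]
    linarith
  obtain ⟨m₀, hm₀⟩ := exists_nat_gt (R + C' + 2)
  have hC'0 : 0 ≤ C' := by positivity
  -- By the choice of `m₀`, all `s ≥ m - 1/2` exceed both `R` and `C'`, so `D` differs from sin(πs)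
  -- by less than 1. At m ± 1/2 the sine is ±1, so `D` changes sign in between.
  have hex : ∀ m : ℕ, m₀ ≤ m → ∃ s : ℝ, |s - m| < 1 / 2 ∧ D s = 0 := by
    intro m hm
    have hmm : (m₀ : ℝ) ≤ m := by exact_mod_cast hm
    have hclose : ∀ s : ℝ, (m : ℝ) - 1 / 2 ≤ s → |D s - Real.sin (s * Real.pi)| < 1 := by
      intro s hs
      refine (hfirst s (by linarith)).trans_lt ?_
      rw [div_lt_one (by linarith)]
      linarith
    set G : ℝ → ℝ := fun s => (-1) ^ m * D s with hG
    have hsign : ∀ x : ℝ, (-1) ^ m * Real.sin (x * Real.pi) = Real.sin ((x - m) * Real.pi) := by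
      intro x
      rw [sub_mul, Real.sin_sub_nat_mul_pi]
    have hGclose : ∀ s : ℝ, (m : ℝ) - 1 / 2 ≤ s →
        |G s - Real.sin ((s - m) * Real.pi)| < 1 := by
      intro s hs
      rw [← hsign, hG]
      beta_reduce
      rw [← mul_sub, abs_mul, abs_pow, abs_neg, abs_one, one_pow, one_mul]
      exact hclose s hs
    have hlo : G (m - 1 / 2) < 0 := by
      have h1 := hGclose (m - 1 / 2) le_rfl
      rw [show ((m : ℝ) - 1 / 2 - m) * Real.pi = -(Real.pi / 2) by ring, Real.sin_neg,
        Real.sin_pi_div_two] at h1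
      linarith [(abs_lt.1 h1).2]
    have hhi : 0 < G (m + 1 / 2) := by
      have h1 := hGclose (m + 1 / 2) (by linarith)
      rw [show ((m : ℝ) + 1 / 2 - m) * Real.pi = Real.pi / 2 by ring,
        Real.sin_pi_div_two] at h1
      linarith [(abs_lt.1 h1).1]
    have hGc : ContinuousOn G (Icc ((m : ℝ) - 1 / 2) (m + 1 / 2)) :=
      (continuousOn_const.mul (continuousOn_charReal hq)).mono fun s hs => by
        have := hs.1
        change 0 < s
        linarith
    obtain ⟨s, hs, hs0⟩ := intermediate_value_Icc (by linarith) hGc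
      (show (0 : ℝ) ∈ Icc _ _ from ⟨hlo.le, hhi.le⟩)
    refine ⟨s, ?_, ?_⟩
    · have h1 : (m : ℝ) - 1 / 2 ≠ s := fun h => hlo.ne (by rw [h]; exact hs0)
      have h2 : s ≠ m + 1 / 2 := fun h => hhi.ne' (by rw [← h]; exact hs0)
      rw [abs_lt]
      exact ⟨by linarith [lt_of_le_of_ne hs.1 h1], by linarith [lt_of_le_of_ne hs.2 h2]⟩
    · exact (mul_eq_zero.1 hs0).resolve_left (pow_ne_zero _ (by norm_num))
  choose! σ hσ1 hσ2 using hex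
  have hm₀1 : 1 ≤ m₀ := by
    have : (0 : ℝ) < m₀ := by linarith
    exact_mod_cast this
  refine ⟨m₀, σ, B, hm₀1, hB0, fun m hm => ?_⟩
  have hmm : (m₀ : ℝ) ≤ m := by exact_mod_cast hm
  have h1 := hσ1 m hm
  have h2 := hσ2 m hm
  have hσR : R ≤ σ m := by linarith [(abs_lt.1 h1).1]
  have hσ0 : 0 < σ m := by linarith
  refine ⟨h1, ?_, ?_⟩
  · rw [hD, charReal, div_eq_zero_iff, neg_eq_zero] at h2
    push_cast
    rw [charFn_ofReal_sq, h2.resolve_right (by positivity), Complex.ofReal_zero]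
  · have h3 := hR (σ m) hσR
    change |D (σ m) - _| ≤ _ at h3
    rw [h2, zero_sub, abs_neg] at h3
    -- The factor `(-1)^m` moves the phase from `πσ` to `π(σ - m)`, as `hB` requires.
    refine (hB m (σ m) ((-1) ^ m * derivSine q (σ m)) (derivSine q m) (by linarith) h1.le
      ?_ ?_ ?_).2
    · rw [abs_mul, abs_pow, abs_neg, abs_one, one_pow, one_mul]
      exact abs_derivSine_le hac _
    · rw [abs_mul, abs_pow, abs_neg, abs_one, one_pow, one_mul]
      have h4 := abs_derivSine_sub_le hac (σ m) m
      have h5 := abs_sub_abs_le_abs_sub (derivSine q (σ m)) (derivSine q m)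
      linarith
    · have e1 : Real.sin (Real.pi * (σ m - m)) = (-1) ^ m * Real.sin (σ m * Real.pi) := by
        rw [← Real.sin_sub_nat_mul_pi]; ring_nf
      have e2 : Real.cos (Real.pi * (σ m - m)) = (-1) ^ m * Real.cos (σ m * Real.pi) := by
        rw [← Real.cos_sub_nat_mul_pi]; ring_nf
      rw [e1, e2]
      refine le_trans (le_of_eq ?_) h3
      have e3 : (-1) ^ m * Real.sin (σ m * Real.pi) * (1 - κ / σ m ^ 2) -
          ω * ((-1) ^ m * Real.cos (σ m * Real.pi)) / σ m +
          (-1) ^ m * derivSine q (σ m) / (4 * σ m ^ 2) =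
          (-1) ^ m * (Real.sin (σ m * Real.pi) * (1 - κ / σ m ^ 2) -
            ω * Real.cos (σ m * Real.pi) / σ m + derivSine q (σ m) / (4 * σ m ^ 2)) := by ring
      rw [e3, abs_mul, abs_pow, abs_neg, abs_one, one_pow, one_mul]

end RealAxis

/-! ### Counting the eigenvalues and the product formula for the characteristic function. -/

section Spectrum

open Filter Asymptotics Topology Polynomial

/-- Adjoining finitely many points to an increasing sequence. -/
lemma exists_strictMono_union (S : Finset ℝ) {τ : ℕ → ℝ} (hτ : StrictMono τ)
    (hlim : Tendsto τ atTop atTop) (hdisj : ∀ k, τ k ∉ S) :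
    ∃ lam : ℕ → ℝ, StrictMono lam ∧ range lam = ↑S ∪ range τ ∧
      ∃ N, ∀ n, N ≤ n → lam (n + S.card) = τ n := by
  classical
  obtain ⟨b, hb⟩ := S.exists_le
  obtain ⟨N, hN⟩ := (hlim.eventually_gt_atTop b).exists
  -- Beyond index `N` the sequence `τ` lies above all of `S`, so only this finite set has to be
  -- sorted; afterwards `τ` continues with its index shifted by `S.card`.
  set E : Finset ℝ := S ∪ (Finset.range N).image τ with hE
  have hcard : E.card = S.card + N := by
    rw [hE, Finset.card_union_of_disjoint, Finset.card_image_of_injective _ hτ.injective,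
      Finset.card_range]
    rw [Finset.disjoint_left]
    intro x hx hx'
    obtain ⟨k, -, rfl⟩ := Finset.mem_image.1 hx'
    exact hdisj k hx
  have hlt : ∀ x ∈ E, x < τ N := by
    intro x hx
    rcases Finset.mem_union.1 hx with hx | hx
    · exact (hb x hx).trans_lt hN
    · obtain ⟨k, hk, rfl⟩ := Finset.mem_image.1 hx
      exact hτ (Finset.mem_range.1 hk)
  set e := E.orderEmbOfFin hcard with he
  set lam : ℕ → ℝ := fun n => if hn : n < S.card + N then e ⟨n, hn⟩ else τ (n - S.card) with hlam
  have hlo : ∀ n (hn : n < S.card + N), lam n = e ⟨n, hn⟩ := fun n hn => dif_pos hn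
  have hhi : ∀ n, S.card + N ≤ n → lam n = τ (n - S.card) := fun n hn => dif_neg (by omega)
  refine ⟨lam, strictMono_nat_of_lt_succ fun n => ?_, ?_, N, fun n hn => ?_⟩
  · rcases lt_trichotomy (n + 1) (S.card + N) with h | h | h
    · rw [hlo n (by omega), hlo (n + 1) h]
      exact e.strictMono (Fin.mk_lt_mk.2 (Nat.lt_succ_self n))
    · rw [hlo n (by omega), hhi (n + 1) h.ge, h, Nat.add_sub_cancel_left]
      exact hlt _ (Finset.orderEmbOfFin_mem E hcard _)
    · rw [hhi n (by omega), hhi (n + 1) (by omega)]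
      exact hτ (by omega)
  · ext x
    constructor
    · rintro ⟨n, rfl⟩
      rcases lt_or_ge n (S.card + N) with h | h
      · rw [hlo n h]
        rcases Finset.mem_union.1 (Finset.orderEmbOfFin_mem E hcard ⟨n, h⟩) with hx | hx
        · exact Or.inl hx
        · obtain ⟨k, -, hk⟩ := Finset.mem_image.1 hx
          exact Or.inr ⟨k, hk⟩
      · exact Or.inr ⟨_, (hhi n h).symm⟩
    · intro hx
      have hxE : x ∈ E → x ∈ range lam := by
        intro hx
        have h1 : x ∈ range e := by rw [he, Finset.range_orderEmbOfFin]; exact hx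
        obtain ⟨i, rfl⟩ := h1
        exact ⟨i, hlo i i.2⟩
      rcases hx with hx | ⟨k, rfl⟩
      · exact hxE (Finset.mem_union_left _ hx)
      · rcases lt_or_ge k N with hk | hk
        · exact hxE (Finset.mem_union_right _
            (Finset.mem_image_of_mem _ (Finset.mem_range.2 hk)))
        · exact ⟨k + S.card, by rw [hhi _ (by omega), Nat.add_sub_cancel]⟩
  · rw [hhi _ (by omega), Nat.add_sub_cancel]

lemma tendsto_eval_div_pow (p : ℂ[X]) {n : ℕ} (hp : p.natDegree ≤ n) :
    Tendsto (fun w => p.eval w / w ^ n) (Bornology.cobounded ℂ) (𝓝 (p.coeff n)) := by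
  have h1 : ∀ i ∈ Finset.range (n + 1), Tendsto (fun w : ℂ => p.coeff i * w⁻¹ ^ (n - i))
      (Bornology.cobounded ℂ) (𝓝 (p.coeff i * 0 ^ (n - i))) := fun i _ =>
    (tendsto_inv₀_cobounded.pow _).const_mul _
  have h2 := tendsto_finsetSum _ h1
  have h3 : ∑ i ∈ Finset.range (n + 1), p.coeff i * 0 ^ (n - i) = p.coeff n := by
    rw [Finset.sum_eq_single n]
    · simp
    · intro i hi hin
      have := Finset.mem_range.1 hi
      rw [zero_pow (by omega), mul_zero]
    · simp
  rw [h3] at h2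
  refine h2.congr' ?_
  filter_upwards [eventually_ne_zero_cobounded] with w hw
  rw [eval_eq_sum_range' (Nat.lt_succ_of_le hp), Finset.sum_div]
  refine Finset.sum_congr rfl fun i hi => ?_
  have hi' := Finset.mem_range.1 hi
  rw [inv_pow, mul_div_assoc, pow_sub₀ _ hw (by omega), mul_inv, inv_inv, div_eq_inv_mul]

lemma tendsto_neg_sq_cobounded :
    Tendsto (fun z : ℂ => -z ^ 2) (Bornology.cobounded ℂ) (Bornology.cobounded ℂ) := by
  rw [← tendsto_norm_atTop_iff_cobounded]
  simp only [norm_neg, norm_pow]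
  exact (tendsto_pow_atTop two_ne_zero).comp tendsto_norm_cobounded_atTop

lemma sinh_ne_zero_of_circle {z : ℂ} {N : ℕ} (hz : ‖z‖ = N + 1 / 2) :
    Complex.sinh (z * Real.pi) ≠ 0 := by
  have h6 := expWeight_le_norm_sinh hz
  have h7 := expWeight_pos z
  exact norm_pos_iff.1 (by linarith)

lemma eventually_circle : ∀ᶠ z in circleFilter, ∃ N : ℕ, ‖z‖ = N + 1 / 2 :=
  eventually_circleFilter_iff.2 ⟨0, fun _ _ h => h⟩

/-- Quotient of two entire functions with the same growth on circles. -/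
lemma tendsto_quotient {f F T : ℂ → ℂ} {Q : ℂ → ℂ} {c : ℂ} (hc : c ≠ 0)
    (hfF : ∀ w, f w = F w * T w)
    (hlim : Tendsto (fun z => f (-z ^ 2) / (z ^ 5 * Complex.sinh (z * Real.pi)))
      circleFilter (𝓝 1))
    (hT : Tendsto (fun z => Q (-z ^ 2) * T (-z ^ 2) / (z ^ 5 * Complex.sinh (z * Real.pi)))
      circleFilter (𝓝 c)) :
    Tendsto (fun z => F (-z ^ 2) / Q (-z ^ 2)) circleFilter (𝓝 c⁻¹) := by
  have h1 := hlim.div hT hc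
  rw [one_div] at h1
  refine h1.congr' ?_
  filter_upwards [hT.eventually_ne hc, eventually_circle,
    circleFilter_le eventually_ne_zero_cobounded] with z hz1 ⟨N, hN⟩ hz0
  have h5 := sinh_ne_zero_of_circle hN
  have h2 : Q (-z ^ 2) * T (-z ^ 2) ≠ 0 := fun h => hz1 (by rw [h, zero_div])
  have h3 := left_ne_zero_of_mul h2
  have h4 := right_ne_zero_of_mul h2
  rw [Pi.div_apply, hfF]
  field_simp

lemma tendsto_prod_slBase (k : ℕ) : Tendsto
    (fun z : ℂ => (∏ n ∈ Finset.range k, ((slBase n : ℂ) - -z ^ 2) / (slBase n + 1)) / (-z ^ 2) ^ k)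
    (Bornology.cobounded ℂ) (𝓝 (∏ n ∈ Finset.range k, -1 / ((slBase n : ℂ) + 1))) := by
  have h1 : ∀ n ∈ Finset.range k, Tendsto
      (fun z : ℂ => ((slBase n : ℂ) * (-z ^ 2)⁻¹ - 1) / (slBase n + 1)) (Bornology.cobounded ℂ)
      (𝓝 (((slBase n : ℂ) * 0 - 1) / ((slBase n : ℂ) + 1))) := fun n _ =>
    (((tendsto_inv₀_cobounded.comp tendsto_neg_sq_cobounded).const_mul _).sub_const _).div_const _
  have h2 := tendsto_finsetProd _ h1
  simp only [mul_zero, zero_sub] at h2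
  refine h2.congr' ?_
  filter_upwards [eventually_ne_zero_cobounded] with z hz
  have hz2 : -z ^ 2 ≠ 0 := neg_ne_zero.2 (pow_ne_zero _ hz)
  rw [← Finset.card_range k, ← Finset.prod_const, Finset.card_range, ← Finset.prod_div_distrib]
  refine Finset.prod_congr rfl fun n _ => ?_
  have := isBaseSeq_slBase.ne n
  field_simp
  ring

/-- A polynomial with simple real roots only. -/
lemma exists_finset_roots {p : ℂ[X]} {k : ℕ} (hk : p.natDegree = k) (hp : p ≠ 0)
    (hreal : ∀ w, p.eval w = 0 → starRingEnd ℂ w = w)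
    (hsimple : ∀ w, p.eval w = 0 → p.derivative.eval w ≠ 0) :
    ∃ S : Finset ℝ, S.card = k ∧ ∀ w : ℂ, p.eval w = 0 ↔ ∃ s ∈ S, (s : ℂ) = w := by
  classical
  have hmem : ∀ w, w ∈ p.roots ↔ p.eval w = 0 := fun w => by
    rw [mem_roots hp, IsRoot.def]
  have hnd : p.roots.Nodup := by
    rw [Multiset.nodup_iff_count_le_one]
    intro w
    rw [count_roots]
    by_contra! hcon
    have h1 := (one_lt_rootMultiplicity_iff_isRoot hp).1 hcon
    exact hsimple w h1.1 h1.2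
  have hre : ∀ w, p.eval w = 0 → ((w.re : ℝ) : ℂ) = w := fun w hw =>
    Complex.conj_eq_iff_re.1 (hreal w hw)
  refine ⟨p.roots.toFinset.image Complex.re, ?_, fun w => ⟨fun hw => ?_, ?_⟩⟩
  · rw [Finset.card_image_of_injOn, Multiset.toFinset_card_of_nodup hnd, ← hk]
    · exact (IsAlgClosed.splits p).natDegree_eq_card_roots.symm
    · intro w hw v hv hwv
      have h1 := hre w ((hmem w).1 (by simpa using hw))
      have h2 := hre v ((hmem v).1 (by simpa using hv))
      rw [← h1, ← h2]
      exact congrArg _ hwv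
  · exact ⟨w.re, Finset.mem_image_of_mem _ (by rw [Multiset.mem_toFinset]; exact (hmem w).2 hw),
      hre w hw⟩
  · rintro ⟨s, hs, rfl⟩
    obtain ⟨v, hv, rfl⟩ := Finset.mem_image.1 hs
    have hv' := (hmem v).1 (by simpa using hv)
    rw [hre v hv']
    exact hv'

/-- An entire function comparable with the unperturbed product on circles, all of whose zeros are
real and simple: enumeration of the zeros and canonical product. -/
theorem exists_enumeration {f : ℂ → ℂ} (hf : Differentiable ℂ f)
    (hreal : ∀ w, f w = 0 → starRingEnd ℂ w = w) (hsimple : ∀ w, f w = 0 → deriv f w ≠ 0)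
    (hlim : Tendsto (fun z => f (-z ^ 2) / (z ^ 5 * Complex.sinh (z * Real.pi)))
      circleFilter (𝓝 1))
    {m₀ : ℕ} {σ : ℕ → ℝ} {C : ℝ} (hm₀ : 1 ≤ m₀) (hσ : ∀ m, m₀ ≤ m → |σ m - m| < 1 / 2)
    (hσf : ∀ m, m₀ ≤ m → f (((σ m) ^ 2 : ℝ) : ℂ) = 0)
    (hσC : ∀ m : ℕ, m₀ ≤ m → |σ m ^ 2 - (m : ℝ) ^ 2| ≤ C) :
    ∃ lam : ℕ → ℝ, StrictMono lam ∧ (∀ w, f w = 0 ↔ ∃ n, (lam n : ℂ) = w) ∧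
      (∃ N, ∀ n, N ≤ n → lam (n + 2) = σ n ^ 2) ∧ (∃ C', ∀ n, |lam n - slBase n| ≤ C') ∧
      ∀ w, f w = Complex.sinh Real.pi * canProd (fun n => (lam n : ℂ)) (fun n => (slBase n : ℂ)) w := by
  have hC0 : 0 ≤ C := (abs_nonneg _).trans (hσC m₀ le_rfl)
  set k := m₀ + 2 with hk
  -- Index `n` corresponds to `m = n - 2`, so located zeros start at `k = m₀ + 2`. The unperturbed
  -- values below `k` are placeholders: they make the full product comparable with `z⁵ sinh(πz)`,
  -- while `T` contains the located zeros only.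
  set a : ℕ → ℝ := fun n => if n < k then slBase n else σ (n - 2) ^ 2 with ha
  have hatail : ∀ n, a (n + k) = σ (n + m₀) ^ 2 := fun n => by
    rw [ha]
    simp only [if_neg (show ¬ (n + k < k) by omega)]
    congr 2
  have haC : ∀ n, ‖(a n : ℂ) - slBase n‖ ≤ C := by
    intro n
    rw [← Complex.ofReal_sub, Complex.norm_real, Real.norm_eq_abs]
    rcases lt_or_ge n k with h | h
    · simp only [ha, if_pos h, sub_self, abs_zero]; exact hC0
    · obtain ⟨j, rfl⟩ := Nat.exists_eq_add_of_le' h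
      rw [hatail, hk, show j + (m₀ + 2) = j + m₀ + 2 by ring, slBase_add_two]
      exact hσC _ (by omega)
  set T := canProd (fun n => (a (n + k) : ℂ)) (fun n => (slBase (n + k) : ℂ)) with hT
  have hbk : IsBaseSeq fun n => (slBase (n + k) : ℂ) :=
    ⟨fun n => isBaseSeq_slBase.ne _, (summable_nat_add_iff k).2 isBaseSeq_slBase.summable⟩
  have hτ : StrictMono fun n => a (n + k) := by
    refine strictMono_nat_of_lt_succ fun n => ?_
    rw [hatail, hatail]
    have h1 := abs_lt.1 (hσ (n + m₀) (by omega))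
    have h2 := abs_lt.1 (hσ (n + 1 + m₀) (by omega))
    have h3 : (1 : ℝ) ≤ (n + m₀ : ℕ) := by exact_mod_cast (by omega : 1 ≤ n + m₀)
    push_cast at h1 h2 h3
    exact pow_lt_pow_left₀ (by linarith) (by linarith) two_ne_zero
  have hτlim : Tendsto (fun n => a (n + k)) atTop atTop := by
    refine tendsto_atTop_mono (f := fun n : ℕ => (n : ℝ)) (fun n => ?_) tendsto_natCast_atTop_atTop
    rw [hatail]
    have h1 := abs_lt.1 (hσ (n + m₀) (by omega))
    have h3 : (1 : ℝ) ≤ m₀ := by exact_mod_cast hm₀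
    push_cast at h1
    nlinarith
  have hTzero : ∀ w, T w = 0 ↔ ∃ n, (a (n + k) : ℂ) = w := fun w =>
    canProd_eq_zero_iff hbk (C := C) fun n => haC _
  have hTd : Differentiable ℂ T := differentiable_canProd hbk (C := C) fun n => haC _
  obtain ⟨F, hFd, hF⟩ := exists_entire_mul_eq hf hTd (fun w hw => by
    obtain ⟨n, rfl⟩ := (hTzero w).1 hw
    refine ⟨?_, deriv_canProd_ne_zero hbk (C := C) (fun n => haC _)
      (fun x y hxy => hτ.injective (Complex.ofReal_injective hxy)) n⟩
    rw [hatail]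
    exact hσf _ (by omega))
  have hratio := tendsto_ratio_circleFilter haC
  have hFQ := tendsto_quotient (Q := fun w => ∏ n ∈ Finset.range k,
    ((slBase n : ℂ) - w) / (slBase n + 1)) (inv_ne_zero sinh_pi_ne_zero) hF hlim (by
      refine hratio.congr fun z => ?_
      rw [canProd_eq_prod_mul isBaseSeq_slBase haC k]
      congr 2
      refine Finset.prod_congr rfl fun n hn => ?_
      simp only [ha, if_pos (Finset.mem_range.1 hn)])
  rw [inv_inv] at hFQ
  have hQlim := (tendsto_prod_slBase k).mono_left circleFilter_le
  have hQ0 : ∏ n ∈ Finset.range k, -1 / ((slBase n : ℂ) + 1) ≠ 0 :=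
    Finset.prod_ne_zero_iff.2 fun n _ => div_ne_zero (by norm_num) (isBaseSeq_slBase.ne n)
  have hFlim : Tendsto (fun z => F (-z ^ 2) / (-z ^ 2) ^ k) circleFilter
      (𝓝 (Complex.sinh Real.pi * ∏ n ∈ Finset.range k, -1 / ((slBase n : ℂ) + 1))) := by
    refine (hFQ.mul hQlim).congr' ?_
    filter_upwards [hQlim.eventually_ne hQ0] with z hz
    refine div_mul_div_cancel₀ fun h => hz ?_
    beta_reduce at h
    rw [h, zero_div]
  have hFO : (fun z => F (-z ^ 2)) =O[circleFilter] fun z => ‖z‖ ^ (2 * k) := by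
    have h1 : (fun z : ℂ => (-z ^ 2) ^ k) =O[circleFilter] fun z => ‖z‖ ^ (2 * k) :=
      IsBigO.of_bound 1 (Eventually.of_forall fun z => by
        rw [norm_pow, norm_neg, norm_pow, ← pow_mul, one_mul, norm_pow, norm_norm])
    refine IsBigO.trans (isBigO_of_div_tendsto_nhds ?_ _ hFlim) h1
    filter_upwards [circleFilter_le eventually_ne_zero_cobounded] with z hz h
    exact absurd h (pow_ne_zero _ (neg_ne_zero.2 (pow_ne_zero _ hz)))
  obtain ⟨p, hpdeg, hpF⟩ := exists_polynomial_of_isBigO hFd k hFO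
  have hpk : p.coeff k ≠ 0 := by
    have h1 : Tendsto (fun z : ℂ => F (-z ^ 2) / (-z ^ 2) ^ k) circleFilter (𝓝 (p.coeff k)) := by
      simp only [hpF]
      exact ((tendsto_eval_div_pow p hpdeg).comp tendsto_neg_sq_cobounded).mono_left
        circleFilter_le
    rw [tendsto_nhds_unique h1 hFlim]
    exact mul_ne_zero sinh_pi_ne_zero hQ0
  have hp0 : p ≠ 0 := fun h => hpk (by rw [h, coeff_zero])
  have hpd : p.natDegree = k := le_antisymm hpdeg (le_natDegree_of_ne_zero hpk)
  have hfp : ∀ w, f w = p.eval w * T w := fun w => by rw [hF, hpF]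
  have hderiv : ∀ w, deriv f w = p.derivative.eval w * T w + p.eval w * deriv T w := fun w => by
    rw [funext hfp]
    exact ((p.hasDerivAt w).mul (hTd w).hasDerivAt).deriv
  have hzero : ∀ w, p.eval w = 0 → f w = 0 := fun w hw => by rw [hfp, hw, zero_mul]
  -- Simplicity of the zeros of `f = p T` makes the roots of `p` simple here, and below it excludes
  -- common zeros of `p` and `T`.
  obtain ⟨S, hScard, hS⟩ := exists_finset_roots hpd hp0 (fun w hw => hreal w (hzero w hw))
    (fun w hw h0 => hsimple w (hzero w hw) (by rw [hderiv, hw, h0]; ring))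
  obtain ⟨lam, hlam, hrange, N, hN⟩ := exists_strictMono_union S hτ hτlim (fun n hn => by
    have h1 : p.eval (a (n + k) : ℂ) = 0 := (hS _).2 ⟨_, hn, rfl⟩
    exact hsimple _ (hzero _ h1) (by rw [hderiv, h1, (hTzero _).2 ⟨n, rfl⟩]; ring))
  have hlamzero : ∀ w, f w = 0 ↔ ∃ n, (lam n : ℂ) = w := by
    intro w
    rw [hfp, mul_eq_zero, hS, hTzero]
    constructor
    · rintro (⟨s, hs, rfl⟩ | ⟨n, rfl⟩)
      · obtain ⟨n, hn⟩ : s ∈ range lam := by rw [hrange]; exact Or.inl hs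
        exact ⟨n, by rw [hn]⟩
      · obtain ⟨m, hm⟩ : a (n + k) ∈ range lam := by rw [hrange]; exact Or.inr ⟨n, rfl⟩
        exact ⟨m, by rw [hm]⟩
    · rintro ⟨n, rfl⟩
      have h1 : lam n ∈ ↑S ∪ range fun n => a (n + k) := by rw [← hrange]; exact ⟨n, rfl⟩
      rcases h1 with h1 | ⟨m, hm⟩
      · exact Or.inl ⟨_, h1, rfl⟩
      · exact Or.inr ⟨m, by rw [← hm]⟩
  have hlamtail : ∀ n, N + m₀ ≤ n → lam (n + 2) = σ n ^ 2 := by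
    intro n hn
    obtain ⟨j, rfl⟩ := Nat.exists_eq_add_of_le' (show m₀ ≤ n by omega)
    rw [← hatail, ← hN j (by omega), hScard]
    congr 1
  obtain ⟨C', hC'⟩ : ∃ C', ∀ n, ‖(lam n : ℂ) - slBase n‖ ≤ C' := by
    obtain ⟨D, hD⟩ := ((Finset.range (N + m₀ + 2)).image
      fun n => ‖(lam n : ℂ) - slBase n‖).exists_le
    refine ⟨max D C, fun n => ?_⟩
    rcases lt_or_ge n (N + m₀ + 2) with h | h
    · exact (hD _ (Finset.mem_image_of_mem _ (Finset.mem_range.2 h))).trans (le_max_left _ _)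
    · obtain ⟨j, rfl⟩ := Nat.exists_eq_add_of_le' (show 2 ≤ n by omega)
      refine le_trans ?_ (le_max_right _ _)
      rw [hlamtail j (by omega), slBase_add_two, ← Complex.ofReal_sub, Complex.norm_real,
        Real.norm_eq_abs]
      exact hσC _ (by omega)
  refine ⟨lam, hlam, hlamzero, ⟨N + m₀, hlamtail⟩, ⟨C', fun n => ?_⟩, ?_⟩
  · simpa only [← Complex.ofReal_sub, Complex.norm_real, Real.norm_eq_abs] using hC' n
  have hPd := differentiable_canProd isBaseSeq_slBase hC'
  -- A second division, now by the product over all the zeros: the quotient has a limit on circles,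
  -- hence is constant, and that limit is `sinh π`.
  obtain ⟨G, hGd, hG⟩ := exists_entire_mul_eq hf hPd (fun w hw => by
    obtain ⟨n, rfl⟩ := (canProd_eq_zero_iff isBaseSeq_slBase hC').1 hw
    exact ⟨(hlamzero _).2 ⟨n, rfl⟩, deriv_canProd_ne_zero isBaseSeq_slBase hC'
      (fun x y hxy => hlam.injective (Complex.ofReal_injective hxy)) n⟩)
  have hGQ := tendsto_quotient (Q := fun _ => 1) (inv_ne_zero sinh_pi_ne_zero) hG hlim (by
    simpa only [one_mul] using tendsto_ratio_circleFilter hC')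
  simp only [inv_inv, div_one] at hGQ
  obtain ⟨r, hr, hrG⟩ := exists_polynomial_of_isBigO hGd 0 (by
    simpa using hGQ.isBigO_one ℝ)
  have hrC := eq_C_of_natDegree_le_zero hr
  have hGc : ∀ w, G w = r.coeff 0 := fun w => by rw [hrG, hrC, eval_C, coeff_C_zero]
  simp only [hGc] at hGQ
  intro w
  rw [hG, hGc, tendsto_nhds_unique tendsto_const_nhds hGQ]

variable {q : ℝ → ℝ} {h h₁ h₂ H H₁ H₂ : ℝ}

lemma norm_integral_deriv_mul_sinh_le (hac : AbsolutelyContinuousOnInterval q 0 Real.pi) (z : ℂ) :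
    ‖∫ t in (0 : ℝ)..Real.pi, ((deriv q t : ℝ) : ℂ) * Complex.sinh (z * (2 * t - Real.pi))‖ ≤
      (∫ t in (0 : ℝ)..Real.pi, |deriv q t|) * expWeight z := by
  rw [← intervalIntegral.integral_mul_const]
  refine intervalIntegral.norm_integral_le_of_norm_le Real.pi_pos.le
    (Eventually.of_forall fun t ht => ?_) (hac.intervalIntegrable_deriv.abs.mul_const _)
  rw [norm_mul, Complex.norm_real, Real.norm_eq_abs]
  gcongr
  have h1 : |2 * t - Real.pi| ≤ Real.pi := abs_le.2 ⟨by linarith [ht.1], by linarith [ht.2]⟩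
  have h2 := norm_exp_mul_sub_le z h1
  have h3 := norm_exp_mul_sub_le (-z) h1
  rw [Complex.neg_re, abs_neg] at h3
  push_cast at h2 h3
  rw [Complex.sinh, norm_div, Complex.norm_ofNat, expWeight, div_le_iff₀ two_pos, ← neg_mul]
  exact (norm_sub_le _ _).trans (by linarith)

/-- Every term of the expansion except sinh(πz) is O(exp(π|Re z|)/|z|), and on the circles the
exponential weight is at most 6|sinh(πz)|. -/
lemma tendsto_charFn_circleFilter (hac : AbsolutelyContinuousOnInterval q 0 Real.pi)
    (hq : Continuous q) :
    Tendsto (fun z => charFn hq h h₁ h₂ H H₁ H₂ (-z ^ 2) /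
      (z ^ 5 * Complex.sinh (z * Real.pi))) circleFilter (𝓝 1) := by
  set κ : ℂ := ((slKappa q h h₁ H H₁ + (q 0 + q Real.pi) / 4 : ℝ) : ℂ) with hκ
  have h1 := isBigO_charFn_sub (h := h) (h₁ := h₁) (h₂ := h₂) (H := H) (H₁ := H₁) (H₂ := H₂) hac hq
  have hsinh : (fun z : ℂ => Complex.sinh (z * Real.pi)) =O[Bornology.cobounded ℂ] expWeight := by
    refine ((isBigO_exp_expWeight.sub isBigO_exp_neg_expWeight).const_mul_left (1 / 2)).congr_left
      fun z => ?_
    rw [Complex.sinh, neg_mul]; ring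
  have hcosh : (fun z : ℂ => Complex.cosh (z * Real.pi)) =O[Bornology.cobounded ℂ] expWeight := by
    refine ((isBigO_exp_expWeight.add isBigO_exp_neg_expWeight).const_mul_left (1 / 2)).congr_left
      fun z => ?_
    rw [Complex.cosh, neg_mul]; ring
  have hint : (fun z : ℂ => ∫ t in (0 : ℝ)..Real.pi,
      ((deriv q t : ℝ) : ℂ) * Complex.sinh (z * (2 * t - Real.pi))) =O[Bornology.cobounded ℂ]
      expWeight := by
    refine IsBigO.of_bound (∫ t in (0 : ℝ)..Real.pi, |deriv q t|)
      (Eventually.of_forall fun z => ?_)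
    rw [Real.norm_of_nonneg (expWeight_pos z).le]
    exact norm_integral_deriv_mul_sinh_le hac z
  have hW := isBigO_refl expWeight (Bornology.cobounded ℂ)
  have t1 := (isBigO_inv_pow_of_le (m := 1) (n := 3) (by norm_num)).mul hW
  have t2 := ((isBigO_const_mul_inv_pow κ 2).trans (isBigO_inv_pow_of_le (m := 1)
    (by norm_num))).mul hsinh
  have t3 := (isBigO_const_mul_inv_pow (slOmega q h H : ℂ) 1).mul hcosh
  have t4 := ((isBigO_const_mul_inv_pow (1 / 4) 2).trans (isBigO_inv_pow_of_le (m := 1)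
    (by norm_num))).mul hint
  have h2 : (fun z => charFn hq h h₁ h₂ H H₁ H₂ (-z ^ 2) / z ^ 5 - Complex.sinh (z * Real.pi))
      =O[Bornology.cobounded ℂ] fun z => ‖z‖⁻¹ ^ 1 * expWeight z := by
    refine ((((IsBigO.trans h1 t1).add t2).add t3).sub t4).congr_left fun z => ?_
    ring
  obtain ⟨C, hC0, hC⟩ := h2.exists_pos
  rw [tendsto_iff_norm_sub_tendsto_zero]
  have hlim : Tendsto (fun z : ℂ => C * 6 * ‖z‖⁻¹) circleFilter (𝓝 0) := by
    have := (tendsto_inv_atTop_zero.comp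
      (tendsto_norm_cobounded_atTop.mono_left circleFilter_le)).const_mul (C * 6)
    simpa using this
  refine squeeze_zero' (Eventually.of_forall fun _ => norm_nonneg _) ?_ hlim
  filter_upwards [circleFilter_le hC.bound, eventually_circle,
    circleFilter_le eventually_ne_zero_cobounded] with z hz ⟨N, hN⟩ hz0
  have h3 := expWeight_le_norm_sinh hN
  have h5 := sinh_ne_zero_of_circle hN
  have h6 := expWeight_pos z
  have e : charFn hq h h₁ h₂ H H₁ H₂ (-z ^ 2) / (z ^ 5 * Complex.sinh (z * Real.pi)) - 1 =
      (charFn hq h h₁ h₂ H H₁ H₂ (-z ^ 2) / z ^ 5 - Complex.sinh (z * Real.pi)) /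
        Complex.sinh (z * Real.pi) := by field_simp
  rw [e, norm_div, div_le_iff₀ (norm_pos_iff.2 h5)]
  refine hz.trans ?_
  rw [Real.norm_of_nonneg (by positivity), pow_one]
  calc C * (‖z‖⁻¹ * expWeight z) ≤ C * (‖z‖⁻¹ * (6 * ‖Complex.sinh (z * Real.pi)‖)) := by gcongr
    _ = _ := by ring

end Spectrum

/-! ### The trace identity, from the behaviour along the negative spectral axis. -/

section Trace

open Filter Asymptotics Topology

/-- log(1 + x) = x - x²/2 + O(x³) with x = ω/t + κ/t² + o(t⁻²): the square contributes ω²/2 and the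
cubic term disappears after multiplication by t². -/
lemma tendsto_log_expansion {R : ℝ → ℝ} {ω κ : ℝ}
    (h : Tendsto (fun t => t ^ 2 * (R t - 1 - ω / t)) atTop (𝓝 κ)) :
    Tendsto (fun t => t ^ 2 * Real.log (R t) - ω * t) atTop (𝓝 (κ - ω ^ 2 / 2)) := by
  set x : ℝ → ℝ := fun t => R t - 1 with hx
  have hinv : Tendsto (fun t : ℝ => t⁻¹) atTop (𝓝 0) := tendsto_inv_atTop_zero
  have htx : Tendsto (fun t => t * x t) atTop (𝓝 ω) := by
    have h1 : Tendsto (fun t => ω + t⁻¹ * (t ^ 2 * (R t - 1 - ω / t))) atTop (𝓝 (ω + 0 * κ)) :=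
      (hinv.mul h).const_add ω
    rw [zero_mul, add_zero] at h1
    refine h1.congr' ?_
    filter_upwards [eventually_gt_atTop 0] with t ht
    rw [hx]
    field_simp
    ring
  have hx0 : Tendsto x atTop (𝓝 0) := by
    have h1 := hinv.mul htx
    rw [zero_mul] at h1
    refine h1.congr' ?_
    filter_upwards [eventually_gt_atTop 0] with t ht
    field_simp
  have hrem : Tendsto (fun t => t ^ 2 * (Real.log (R t) - (x t - x t ^ 2 / 2))) atTop (𝓝 0) := by
    have h1 : Tendsto (fun t => 2 * (t * x t) ^ 2 * |x t|) atTop (𝓝 0) := by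
      have := ((htx.pow 2).const_mul 2).mul hx0.abs
      simpa using this
    refine squeeze_zero_norm' ?_ h1
    filter_upwards [hx0.eventually (Metric.ball_mem_nhds 0 (by norm_num : (0 : ℝ) < 1 / 2))] with t ht
    rw [dist_zero_right, Real.norm_eq_abs] at ht
    have h2 := Real.abs_log_sub_add_sum_range_le (x := -x t) (by rw [abs_neg]; linarith) 2
    simp only [Finset.sum_range_succ, Finset.range_zero, Finset.sum_empty, abs_neg] at h2
    have h3 : |x t| ^ 3 / (1 - |x t|) ≤ 2 * |x t| ^ 3 := by
      rw [div_le_iff₀ (by linarith)]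
      have : 0 ≤ |x t| ^ 3 := by positivity
      nlinarith
    have h4 : Real.log (R t) - (x t - x t ^ 2 / 2) = 0 + (-x t) ^ (0 + 1) / ((0 : ℕ) + 1) +
        (-x t) ^ (1 + 1) / ((1 : ℕ) + 1) + Real.log (1 - -x t) := by
      rw [show 1 - -x t = R t by rw [hx]; ring]
      push_cast
      ring
    rw [norm_mul, Real.norm_of_nonneg (sq_nonneg t), Real.norm_eq_abs, h4]
    calc _ ≤ t ^ 2 * (2 * |x t| ^ 3) := by gcongr; exact h2.trans h3
      _ = 2 * (t ^ 2 * |x t| ^ 2) * |x t| := by ring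
      _ = _ := by rw [sq_abs]; ring
  have h5 : Tendsto (fun t => t ^ 2 * (R t - 1 - ω / t) - (t * x t) ^ 2 / 2 +
      t ^ 2 * (Real.log (R t) - (x t - x t ^ 2 / 2))) atTop (𝓝 (κ - ω ^ 2 / 2 + 0)) :=
    (h.sub ((htx.pow 2).div_const 2)).add hrem
  rw [add_zero] at h5
  refine h5.congr' ?_
  filter_upwards [eventually_gt_atTop 0] with t ht
  rw [hx]
  field_simp
  ring

lemma abs_log_one_add_sub_le {u : ℝ} (hu : |u| ≤ 1 / 2) : |Real.log (1 + u) - u| ≤ 2 * u ^ 2 := by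
  have h2 := Real.abs_log_sub_add_sum_range_le (x := -u) (by rw [abs_neg]; linarith) 1
  simp only [Finset.sum_range_succ, Finset.range_zero, Finset.sum_empty, abs_neg] at h2
  have h3 : |u| ^ 2 / (1 - |u|) ≤ 2 * u ^ 2 := by
    rw [sq_abs, div_le_iff₀ (by linarith)]
    nlinarith [sq_nonneg u]
  refine le_trans (le_of_eq ?_) (h2.trans h3)
  congr 1
  push_cast
  rw [sub_neg_eq_add]
  ring

lemma abs_log_tprod_sub_tsum_le {u : ℕ → ℝ} (hs : Summable u) (hu : ∀ n, |u n| ≤ 1 / 2)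
    (hs2 : Summable fun n => u n ^ 2) :
    |Real.log (∏' n, (1 + u n)) - ∑' n, u n| ≤ 2 * ∑' n, u n ^ 2 := by
  have hlog := Real.summable_log_one_add_of_summable hs
  rw [← Real.rexp_tsum_eq_tprod (fun n => by linarith [(abs_le.1 (hu n)).1]) hlog, Real.log_exp,
    ← hlog.tsum_sub hs, ← Real.norm_eq_abs, ← tsum_mul_left]
  exact tsum_of_norm_bounded (hs2.mul_left 2).hasSum fun n => abs_log_one_add_sub_le (hu n)

/-- Partial fractions of the hyperbolic cotangent. -/
lemma hasSum_one_div_sq_add_sq {t : ℝ} (ht : 0 < t) :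
    HasSum (fun m : ℕ => 1 / ((m : ℝ) ^ 2 + t ^ 2))
      (Real.pi * (Real.cosh (Real.pi * t) / Real.sinh (Real.pi * t)) / (2 * t) +
        1 / (2 * t ^ 2)) := by
  set x : ℂ := t * Complex.I with hx
  have htC : (t : ℂ) ≠ 0 := by exact_mod_cast ht.ne'
  have hxm : x ∈ Complex.integerComplement := by
    rw [Complex.mem_integerComplement_iff]
    rintro ⟨n, hn⟩
    have := congrArg Complex.im hn
    simp [hx] at this
    exact ht.ne' this.symm
  have hI : Complex.I ^ 2 = -1 := Complex.I_sq
  have hterm : ∀ n : ℕ, 1 / (x - (n + 1)) + 1 / (x + (n + 1)) =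
      (-2 * x) * ((1 / (((n + 1 : ℕ) : ℝ) ^ 2 + t ^ 2) : ℝ) : ℂ) := by
    intro n
    have h1 : x - (n + 1) ≠ 0 := by
      intro h0
      exact hxm ⟨n + 1, by push_cast; exact (sub_eq_zero.1 h0).symm⟩
    have h2 : x + (n + 1) ≠ 0 := by
      intro h0
      exact hxm ⟨-(n + 1), by push_cast; exact (eq_neg_of_add_eq_zero_left h0).symm⟩
    have h3 : ((((n + 1 : ℕ) : ℝ) ^ 2 + t ^ 2 : ℝ) : ℂ) = -((x - (n + 1)) * (x + (n + 1))) := by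
      rw [hx]
      push_cast
      linear_combination (t : ℂ) ^ 2 * hI
    rw [Complex.ofReal_div, h3, Complex.ofReal_one]
    field_simp
    ring
  have hsum : Summable fun m : ℕ => 1 / ((m : ℝ) ^ 2 + t ^ 2) := by
    refine (summable_nat_add_iff 1).1 ?_
    have h1 : Summable fun n : ℕ => 1 / ((n + 1 : ℕ) : ℝ) ^ 2 :=
      (summable_nat_add_iff 1).2 (Real.summable_one_div_nat_pow.2 one_lt_two)
    refine h1.of_nonneg_of_le (fun n => by positivity) fun n => ?_
    gcongr
    exact le_add_of_nonneg_right (sq_nonneg t)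
  refine (hsum.hasSum_iff).2 ?_
  rw [hsum.tsum_eq_zero_add]
  have hser := cot_series_rep' hxm
  simp only [hterm] at hser
  rw [tsum_mul_left, ← Complex.ofReal_tsum, Complex.cot_eq_cos_div_sin, hx,
    ← mul_assoc, ← Complex.ofReal_mul, Complex.cos_mul_I, Complex.sin_mul_I,
    ← Complex.ofReal_cosh, ← Complex.ofReal_sinh] at hser
  set S := ∑' n : ℕ, 1 / (((n + 1 : ℕ) : ℝ) ^ 2 + t ^ 2) with hS
  have hs0 : Real.sinh (Real.pi * t) ≠ 0 := (Real.sinh_pos_iff.2 (by positivity)).ne'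
  have hs0C : (Real.sinh (Real.pi * t) : ℂ) ≠ 0 := by exact_mod_cast hs0
  have hkey : ((Real.pi * Real.cosh (Real.pi * t) / Real.sinh (Real.pi * t) - 1 / t : ℝ) : ℂ) =
      ((2 * t * S : ℝ) : ℂ) := by
    have h1 : (Real.pi : ℂ) * (Real.cosh (Real.pi * t) / (Real.sinh (Real.pi * t) * Complex.I)) -
        1 / (t * Complex.I) = (Real.pi * Real.cosh (Real.pi * t) / Real.sinh (Real.pi * t) - 1 / t) *
          (-Complex.I) := by
      field_simp
      linear_combination ((Real.pi * Real.cosh (Real.pi * t) * t : ℂ) -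
        Real.sinh (Real.pi * t)) * hI
    rw [h1] at hser
    simp only [Complex.ofReal_sub, Complex.ofReal_mul, Complex.ofReal_div, Complex.ofReal_one,
      Complex.ofReal_ofNat]
    refine mul_right_cancel₀ (neg_ne_zero.2 Complex.I_ne_zero) (hser.trans ?_)
    ring
  have hkey' := Complex.ofReal_injective hkey
  have hSe : S = (Real.pi * Real.cosh (Real.pi * t) / Real.sinh (Real.pi * t) - 1 / t) /
      (2 * t) := by
    rw [hkey']; field_simp
  rw [hSe]
  push_cast
  field_simp
  ring

/-- coth x - 1 = exp(-x)/sinh x, and sinh x ≥ x absorbs the factor `t`. -/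
lemma tendsto_mul_coth_sub_one :
    Tendsto (fun t : ℝ => t * (Real.cosh (Real.pi * t) / Real.sinh (Real.pi * t) - 1)) atTop
      (𝓝 0) := by
  have h1 : Tendsto (fun t : ℝ => Real.exp (-(Real.pi * t)) / Real.pi) atTop (𝓝 0) := by
    have := (Real.tendsto_exp_neg_atTop_nhds_zero.comp
      (tendsto_id.const_mul_atTop Real.pi_pos)).div_const Real.pi
    simpa using this
  refine squeeze_zero' ?_ ?_ h1
  all_goals
    filter_upwards [eventually_gt_atTop 0] with t ht
    have hx : 0 < Real.pi * t := by positivity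
    have hs := Real.sinh_pos_iff.2 hx
    have hsl : Real.pi * t ≤ Real.sinh (Real.pi * t) := Real.self_le_sinh_iff.2 hx.le
    have e : t * (Real.cosh (Real.pi * t) / Real.sinh (Real.pi * t) - 1) =
        t * (Real.exp (-(Real.pi * t)) / Real.sinh (Real.pi * t)) := by
      rw [← Real.cosh_sub_sinh]; field_simp
    rw [e]
  · positivity
  · calc _ ≤ t * (Real.exp (-(Real.pi * t)) / (Real.pi * t)) := by gcongr
      _ = _ := by field_simp

/-- Trace identity from the asymptotics of a quotient of canonical products. -/
lemma trace_of_tendsto {d : ℕ → ℝ} {C ω κ : ℝ} (hd : ∀ n, |d n| ≤ C)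
    (hs : Summable fun n => d (n + 2) - 2 * ω / Real.pi)
    (hR : Tendsto (fun t : ℝ => t ^ 2 * ((∏' n, (1 + d n / (slBase n + t ^ 2))) - 1 - ω / t))
      atTop (𝓝 κ)) :
    d 0 + d 1 + ∑' n, (d (n + 2) - 2 * ω / Real.pi) = κ - ω ^ 2 / 2 - ω / Real.pi := by
  have hC0 : 0 ≤ C := (abs_nonneg _).trans (hd 0)
  have hinv : ∀ t : ℝ, 1 ≤ t → ∀ n, 0 ≤ 1 / (slBase n + t ^ 2) ∧
      1 / (slBase n + t ^ 2) ≤ (slBase n + 1)⁻¹ ∧ 0 < slBase n + t ^ 2 := by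
    intro t ht n
    have h1 := slBase_nonneg n
    have h2 : 1 ≤ t ^ 2 := one_le_pow₀ ht
    refine ⟨by positivity, ?_, by positivity⟩
    rw [← one_div]
    gcongr
  have hGs : ∀ t : ℝ, 1 ≤ t → Summable fun n => 1 / (slBase n + t ^ 2) := fun t ht =>
    summable_slBase.of_nonneg_of_le (fun n => (hinv t ht n).1) fun n => (hinv t ht n).2.1
  have hG : Tendsto (fun t : ℝ => ∑' n, 1 / (slBase n + t ^ 2)) atTop (𝓝 0) := by
    have h1 : Tendsto (fun t : ℝ => ∑' n, 1 / (slBase n + t ^ 2)) atTop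
        (𝓝 (∑' _ : ℕ, (0 : ℝ))) := by
      refine tendsto_tsum_of_dominated_convergence summable_slBase (fun n => ?_) ?_
      · have h2 : Tendsto (fun t : ℝ => slBase n + t ^ 2) atTop atTop :=
          tendsto_atTop_add_const_left _ _ (tendsto_pow_atTop two_ne_zero)
        simpa only [one_div, Function.comp_def] using tendsto_inv_atTop_zero.comp h2
      · filter_upwards [eventually_ge_atTop 1] with t ht n
        rw [Real.norm_of_nonneg (hinv t ht n).1]
        exact (hinv t ht n).2.1
    simpa using h1
  have hus : ∀ t : ℝ, 1 ≤ t → Summable fun n => d n / (slBase n + t ^ 2) := fun t ht => by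
    refine ((hGs t ht).mul_left C).of_norm_bounded fun n => ?_
    rw [Real.norm_eq_abs, abs_div, abs_of_pos (hinv t ht n).2.2, div_eq_mul_one_div]
    have := (hinv t ht n).1
    gcongr
    exact hd n
  -- Linearising the logarithm costs at most 2t² ∑ (d n/(b n + t²))² ≤ 2C² ∑ 1/(b n + t²), which
  -- tends to 0.
  have hlog : Tendsto (fun t : ℝ => t ^ 2 * (Real.log (∏' n, (1 + d n / (slBase n + t ^ 2))) -
      ∑' n, d n / (slBase n + t ^ 2))) atTop (𝓝 0) := by
    have h0 := hG.const_mul (2 * C ^ 2)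
    rw [mul_zero] at h0
    refine squeeze_zero_norm' ?_ h0
    filter_upwards [eventually_ge_atTop 1, (tendsto_pow_atTop (α := ℝ) two_ne_zero).eventually_ge_atTop
      (2 * C)] with t ht htC
    have ht2 : 0 < t ^ 2 := by positivity
    have hu : ∀ n, |d n / (slBase n + t ^ 2)| ≤ 1 / 2 := fun n => by
      rw [abs_div, abs_of_pos (hinv t ht n).2.2, div_le_iff₀ (hinv t ht n).2.2]
      linarith [hd n, slBase_nonneg n]
    have hsq : ∀ n, (d n / (slBase n + t ^ 2)) ^ 2 ≤
        C ^ 2 * (1 / t ^ 2 * (1 / (slBase n + t ^ 2))) := fun n => by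
      rw [div_pow, ← sq_abs (d n), div_eq_mul_one_div, sq (slBase n + t ^ 2), one_div_mul_one_div]
      have h1 := (hinv t ht n).2.2
      have h2 : t ^ 2 ≤ slBase n + t ^ 2 := by linarith [slBase_nonneg n]
      gcongr
      exact hd n
    have hs1 := ((hGs t ht).mul_left (1 / t ^ 2)).mul_left (C ^ 2)
    have hs2 := hs1.of_nonneg_of_le (fun n => sq_nonneg _) hsq
    have h1 := abs_log_tprod_sub_tsum_le (hus t ht) hu hs2
    have h2 := hs2.tsum_le_tsum hsq hs1
    rw [tsum_mul_left, tsum_mul_left] at h2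
    rw [norm_mul, Real.norm_of_nonneg ht2.le, Real.norm_eq_abs]
    calc _ ≤ t ^ 2 * (2 * (C ^ 2 * (1 / t ^ 2 * ∑' n, 1 / (slBase n + t ^ 2)))) := by
          gcongr
          exact h1.trans (by gcongr)
      _ = _ := by field_simp
  have h1 := (tendsto_log_expansion hR).sub hlog
  rw [sub_zero] at h1
  -- The divergent constant 2ω/π is split off from `d`. The summable rest passes to the limit by
  -- dominated convergence, while the constant part is summed exactly to ωt coth(πt) + ω/π.
  have hε : Tendsto (fun t : ℝ => ∑' m : ℕ, (d (m + 2) - 2 * ω / Real.pi) *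
      (t ^ 2 / ((m : ℝ) ^ 2 + t ^ 2))) atTop (𝓝 (∑' m, (d (m + 2) - 2 * ω / Real.pi))) := by
    refine tendsto_tsum_of_dominated_convergence hs.norm (fun m => ?_) ?_
    · have h2 : Tendsto (fun t : ℝ => 1 - (m : ℝ) ^ 2 * ((m : ℝ) ^ 2 + t ^ 2)⁻¹) atTop
          (𝓝 (1 - (m : ℝ) ^ 2 * 0)) := by
        refine ((tendsto_inv_atTop_zero.comp ?_).const_mul _).const_sub 1
        exact tendsto_atTop_add_const_left _ _ (tendsto_pow_atTop two_ne_zero)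
      have h3 := h2.const_mul (d (m + 2) - 2 * ω / Real.pi)
      rw [mul_zero, sub_zero, mul_one] at h3
      refine h3.congr' ?_
      filter_upwards [eventually_gt_atTop 0] with t ht
      have : (m : ℝ) ^ 2 + t ^ 2 ≠ 0 := by positivity
      congr 1
      field_simp
      ring
    · filter_upwards [eventually_gt_atTop 0] with t ht m
      rw [norm_mul]
      refine mul_le_of_le_one_right (norm_nonneg _) ?_
      rw [Real.norm_of_nonneg (by positivity), div_le_one (by positivity)]
      linarith [sq_nonneg (m : ℝ)]
  have h2 : Tendsto (fun t : ℝ => d 0 + d 1 + (∑' m : ℕ, (d (m + 2) - 2 * ω / Real.pi) *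
      (t ^ 2 / ((m : ℝ) ^ 2 + t ^ 2))) + (ω / Real.pi +
        ω * (t * (Real.cosh (Real.pi * t) / Real.sinh (Real.pi * t) - 1)))) atTop
      (𝓝 (d 0 + d 1 + (∑' m, (d (m + 2) - 2 * ω / Real.pi)) + (ω / Real.pi + ω * 0))) :=
    (hε.const_add _).add ((tendsto_mul_coth_sub_one.const_mul ω).const_add _)
  have h3 : d 0 + d 1 + (∑' m, (d (m + 2) - 2 * ω / Real.pi)) + (ω / Real.pi + ω * 0) =
      κ - ω ^ 2 / 2 := by
    refine tendsto_nhds_unique h2 (h1.congr' ?_)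
    filter_upwards [eventually_ge_atTop 1] with t ht
    have ht0 : 0 < t := by linarith
    have hc := hasSum_one_div_sq_add_sq ht0
    have hεs : Summable fun m : ℕ => (d (m + 2) - 2 * ω / Real.pi) *
        (t ^ 2 / ((m : ℝ) ^ 2 + t ^ 2)) := by
      refine hs.norm.of_norm_bounded fun m => ?_
      rw [norm_mul]
      refine mul_le_of_le_one_right (norm_nonneg _) ?_
      rw [Real.norm_of_nonneg (by positivity), div_le_one (by positivity)]
      linarith [sq_nonneg (m : ℝ)]
    have e1 : t ^ 2 * ∑' n, d n / (slBase n + t ^ 2) = d 0 + d 1 +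
        (∑' m : ℕ, (d (m + 2) - 2 * ω / Real.pi) * (t ^ 2 / ((m : ℝ) ^ 2 + t ^ 2))) +
        2 * ω / Real.pi * t ^ 2 * ∑' m : ℕ, 1 / ((m : ℝ) ^ 2 + t ^ 2) := by
      rw [← (hus t ht).sum_add_tsum_nat_add 2, ← tsum_mul_left, add_assoc,
        ← hεs.tsum_add (hc.summable.mul_left _), mul_add, ← tsum_mul_left]
      congr 1
      · simp [Finset.sum_range_succ, slBase]
        field_simp
      · refine tsum_congr fun m => ?_
        rw [slBase_add_two]
        ring
    rw [mul_sub, e1, hc.tsum_eq]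
    have hs0 : Real.sinh (Real.pi * t) ≠ 0 := (Real.sinh_pos_iff.2 (by positivity)).ne'
    field_simp
    ring_nf
  linarith

variable {q : ℝ → ℝ} {h h₁ h₂ H H₁ H₂ : ℝ}

/-- The integrand is at most |q'(s)| exp(-t(π - |2s - π|)), which tends to 0 for s strictly inside
the interval; dominated convergence applies. Hence this integral leaves no trace in the limit below.
-/
lemma tendsto_integral_deriv_mul_sinh (hac : AbsolutelyContinuousOnInterval q 0 Real.pi) :
    Tendsto (fun t : ℝ => (∫ s in (0 : ℝ)..Real.pi, ((deriv q s : ℝ) : ℂ) *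
      Complex.sinh (t * (2 * s - Real.pi))) * Real.exp (-(Real.pi * t))) atTop (𝓝 0) := by
  have hlim : Tendsto (fun t : ℝ => ∫ s in (0 : ℝ)..Real.pi, ((deriv q s : ℝ) : ℂ) *
      Complex.sinh (t * (2 * s - Real.pi)) * Real.exp (-(Real.pi * t))) atTop
      (𝓝 (∫ _ in (0 : ℝ)..Real.pi, (0 : ℂ))) := by
    have hbd : ∀ t s : ℝ, 0 < t → s ∈ Ioc 0 Real.pi → ‖((deriv q s : ℝ) : ℂ) *
        Complex.sinh (t * (2 * s - Real.pi)) * Real.exp (-(Real.pi * t))‖ ≤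
        |deriv q s| * Real.exp (-(t * (Real.pi - |2 * s - Real.pi|))) := by
      intro t s ht hs
      have h2 := norm_exp_mul_sub_le (t : ℂ) (le_refl |2 * s - Real.pi|)
      have h3 := norm_exp_mul_sub_le (-(t : ℂ)) (le_refl |2 * s - Real.pi|)
      rw [Complex.neg_re, abs_neg] at h3
      rw [Complex.ofReal_re, abs_of_pos ht] at h2 h3
      push_cast at h2 h3
      have h4 : ‖Complex.sinh (t * (2 * s - Real.pi))‖ ≤ Real.exp (t * |2 * s - Real.pi|) := by
        rw [Complex.sinh, norm_div, Complex.norm_ofNat, div_le_iff₀ two_pos, ← neg_mul]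
        exact (norm_sub_le _ _).trans (by linarith)
      rw [norm_mul, norm_mul, Complex.norm_real, Complex.norm_real, Real.norm_eq_abs,
        Real.norm_of_nonneg (Real.exp_pos _).le, mul_assoc]
      gcongr
      calc _ ≤ Real.exp (t * |2 * s - Real.pi|) * Real.exp (-(Real.pi * t)) := by gcongr
        _ = _ := by rw [← Real.exp_add]; congr 1; ring
    refine intervalIntegral.tendsto_integral_filter_of_dominated_convergence
      (fun s => |deriv q s|) ?_ ?_ hac.intervalIntegrable_deriv.abs ?_
    · filter_upwards with t
      exact (((intervalIntegrable_ofReal_deriv hac).mul_continuousOn (by fun_prop)).mul_const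
        _).def'.aestronglyMeasurable
    · filter_upwards [eventually_gt_atTop 0] with t ht
      filter_upwards with s hs
      rw [uIoc_of_le Real.pi_pos.le] at hs
      refine (hbd t s ht hs).trans (mul_le_of_le_one_right (abs_nonneg _) ?_)
      rw [Real.exp_le_one_iff, neg_nonpos]
      have : |2 * s - Real.pi| ≤ Real.pi := abs_le.2 ⟨by linarith [hs.1], by linarith [hs.2]⟩
      exact mul_nonneg ht.le (by linarith)
    · have hne : ∀ᵐ s : ℝ, s ≠ Real.pi := by simp [ae_iff, measure_singleton]
      filter_upwards [hne] with s hsne hs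
      rw [uIoc_of_le Real.pi_pos.le] at hs
      have hlt : |2 * s - Real.pi| < Real.pi :=
        abs_lt.2 ⟨by linarith [hs.1], by linarith [lt_of_le_of_ne hs.2 hsne]⟩
      have h5 : Tendsto (fun t : ℝ => |deriv q s| *
          Real.exp (-(t * (Real.pi - |2 * s - Real.pi|)))) atTop (𝓝 (|deriv q s| * 0)) :=
        (Real.tendsto_exp_neg_atTop_nhds_zero.comp
          (tendsto_id.atTop_mul_const (sub_pos.2 hlt))).const_mul _
      rw [mul_zero] at h5
      refine squeeze_zero_norm' ?_ h5
      filter_upwards [eventually_gt_atTop 0] with t ht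
      exact hbd t s ht hs
  rw [intervalIntegral.integral_zero] at hlim
  refine hlim.congr fun t => ?_
  rw [intervalIntegral.integral_mul_const]

/-- The expansion at real `z = t`, divided by sinh(πt): since t(coth(πt) - 1) → 0, the cosh term
contributes exactly ω/t, and the constant κ is all that survives. -/
lemma tendsto_charFn_real_axis (hac : AbsolutelyContinuousOnInterval q 0 Real.pi)
    (hq : Continuous q) :
    Tendsto (fun t : ℝ => (t : ℂ) ^ 2 * (charFn hq h h₁ h₂ H H₁ H₂ (-(t : ℂ) ^ 2) /
      ((t : ℂ) ^ 5 * Complex.sinh (t * Real.pi)) - 1 - (slOmega q h H : ℂ) / t)) atTop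
      (𝓝 ((slKappa q h h₁ H H₁ + (q 0 + q Real.pi) / 4 : ℝ) : ℂ)) := by
  set κ : ℂ := ((slKappa q h h₁ H H₁ + (q 0 + q Real.pi) / 4 : ℝ) : ℂ) with hκ
  set ω : ℂ := (slOmega q h H : ℂ) with hω
  set I : ℝ → ℂ := fun t => ∫ s in (0 : ℝ)..Real.pi, ((deriv q s : ℝ) : ℂ) *
      Complex.sinh (t * (2 * s - Real.pi)) with hI
  obtain ⟨C, hC0, hC⟩ := (isBigO_charFn_sub (h := h) (h₁ := h₁) (h₂ := h₂) (H := H) (H₁ := H₁)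
    (H₂ := H₂) hac hq).exists_pos
  have hreal : Tendsto (fun t : ℝ => (t : ℂ)) atTop (Bornology.cobounded ℂ) := by
    rw [← tendsto_norm_atTop_iff_cobounded]
    simpa only [Complex.norm_real] using tendsto_norm_atTop_atTop
  set E : ℝ → ℂ := fun t => charFn hq h h₁ h₂ H H₁ H₂ (-(t : ℂ) ^ 2) / (t : ℂ) ^ 5 -
    (Complex.sinh (t * Real.pi) * (1 + κ * (t : ℂ)⁻¹ ^ 2) +
      Complex.cosh (t * Real.pi) * (ω * (t : ℂ)⁻¹) - (t : ℂ)⁻¹ ^ 2 / 4 * I t) with hE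
  have hEb : ∀ᶠ t : ℝ in atTop, ‖E t‖ ≤ C * (t⁻¹ ^ 3 * Real.exp (Real.pi * t)) := by
    filter_upwards [hreal.eventually hC.bound, eventually_gt_atTop 0] with t ht ht0
    refine ht.trans (le_of_eq ?_)
    rw [Real.norm_of_nonneg (by have := expWeight_pos (t : ℂ); positivity), Complex.norm_real,
      Real.norm_of_nonneg ht0.le, expWeight, Complex.ofReal_re, abs_of_pos ht0, mul_comm t]
  have hcoth1 : Tendsto (fun t : ℝ => Real.cosh (Real.pi * t) / Real.sinh (Real.pi * t)) atTop
      (𝓝 1) := by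
    have h1 := (tendsto_inv_atTop_zero.mul tendsto_mul_coth_sub_one).add_const 1
    rw [mul_zero, zero_add] at h1
    refine h1.congr' ?_
    filter_upwards [eventually_gt_atTop 0] with t ht
    field_simp
    ring
  have hexp : Tendsto (fun t : ℝ => Real.exp (Real.pi * t) / Real.sinh (Real.pi * t)) atTop
      (𝓝 2) := by
    have h1 := hcoth1.add_const 1
    rw [one_add_one_eq_two] at h1
    refine h1.congr' ?_
    filter_upwards [eventually_gt_atTop 0] with t ht
    have hs0 : Real.sinh (Real.pi * t) ≠ 0 := (Real.sinh_pos_iff.2 (by positivity)).ne'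
    rw [← Real.cosh_add_sinh]
    field_simp
  have hS : ∀ t : ℝ, Complex.sinh (t * Real.pi) = (Real.sinh (Real.pi * t) : ℂ) := fun t => by
    push_cast; rw [mul_comm]
  have hCo : ∀ t : ℝ, Complex.cosh (t * Real.pi) = (Real.cosh (Real.pi * t) : ℂ) := fun t => by
    push_cast; rw [mul_comm]
  have t1 : Tendsto (fun t : ℝ => (t : ℂ) ^ 2 * E t / (Real.sinh (Real.pi * t) : ℂ)) atTop
      (𝓝 0) := by
    have h1 : Tendsto (fun t : ℝ => C * (t⁻¹ * (Real.exp (Real.pi * t) / Real.sinh (Real.pi * t))))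
        atTop (𝓝 0) := by
      have := (tendsto_inv_atTop_zero.mul hexp).const_mul C
      simpa using this
    refine squeeze_zero_norm' ?_ h1
    filter_upwards [hEb, eventually_gt_atTop 0] with t ht ht0
    have hs0 : 0 < Real.sinh (Real.pi * t) := Real.sinh_pos_iff.2 (by positivity)
    rw [norm_div, norm_mul, norm_pow, Complex.norm_real, Complex.norm_real,
      Real.norm_of_nonneg ht0.le, Real.norm_of_nonneg hs0.le]
    calc _ ≤ t ^ 2 * (C * (t⁻¹ ^ 3 * Real.exp (Real.pi * t))) / Real.sinh (Real.pi * t) := by gcongr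
      _ = _ := by field_simp
  have t2 : Tendsto (fun t : ℝ => I t / (Real.sinh (Real.pi * t) : ℂ)) atTop (𝓝 0) := by
    have h1 := (tendsto_integral_deriv_mul_sinh hac).mul
      ((Complex.continuous_ofReal.tendsto _).comp hexp)
    rw [zero_mul] at h1
    refine h1.congr fun t => ?_
    simp only [Function.comp_apply, Complex.ofReal_div]
    have h2 : (Real.exp (-(Real.pi * t)) : ℂ) * Real.exp (Real.pi * t) = 1 := by
      rw [← Complex.ofReal_mul, ← Real.exp_add, neg_add_cancel, Real.exp_zero, Complex.ofReal_one]
    calc _ = I t * ((Real.exp (-(Real.pi * t)) : ℂ) * Real.exp (Real.pi * t)) /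
          (Real.sinh (Real.pi * t) : ℂ) := by ring
      _ = _ := by rw [h2, mul_one]
  have t3 : Tendsto (fun t : ℝ => ω *
      ((t * (Real.cosh (Real.pi * t) / Real.sinh (Real.pi * t) - 1) : ℝ) : ℂ)) atTop (𝓝 0) := by
    have h1 := ((Complex.continuous_ofReal.tendsto _).comp tendsto_mul_coth_sub_one).const_mul ω
    simpa using h1
  have hfin := ((t1.add_const κ).add t3).sub (t2.div_const 4)
  rw [zero_add, add_zero, zero_div, sub_zero] at hfin
  refine hfin.congr' ?_
  filter_upwards [eventually_gt_atTop 0] with t ht0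
  have htC : (t : ℂ) ≠ 0 := by exact_mod_cast ht0.ne'
  have hs0 : (Real.sinh (Real.pi * t) : ℂ) ≠ 0 := by
    exact_mod_cast (Real.sinh_pos_iff.2 (by positivity : 0 < Real.pi * t)).ne'
  rw [hE]
  beta_reduce
  rw [hS, hCo]
  generalize charFn hq h h₁ h₂ H H₁ H₂ (-(t : ℂ) ^ 2) = c
  rw [Complex.ofReal_mul, Complex.ofReal_sub, Complex.ofReal_div, Complex.ofReal_one]
  generalize (Real.sinh (Real.pi * t) : ℂ) = S at *
  field_simp
  ring

end Trace

/-! ### Independence of the values of q outside [0,π], and assembly. -/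

section Main

open Filter Asymptotics Topology

variable {q : ℝ → ℝ} {h h₁ h₂ H H₁ H₂ : ℝ}

lemma AbsolutelyContinuousOnInterval.congr {f g : ℝ → ℝ} {a b : ℝ}
    (hf : AbsolutelyContinuousOnInterval f a b) (hfg : EqOn f g (uIcc a b)) :
    AbsolutelyContinuousOnInterval g a b := by
  rw [absolutelyContinuousOnInterval_iff] at hf ⊢
  intro ε hε
  obtain ⟨δ, hδ, hfδ⟩ := hf ε hε
  refine ⟨δ, hδ, fun E hE hlt => ?_⟩
  have h1 := hfδ E hE hlt
  refine lt_of_le_of_lt (le_of_eq (Finset.sum_congr rfl fun i hi => ?_)) h1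
  rw [hfg (hE.1 i hi).1, hfg (hE.1 i hi).2]

/-- At `0` and `π` the two-sided `deriv` depends on values outside the interval, but these two
points form a null set. -/
lemma MemW21.congr {p : ℝ → ℝ} (hq : MemW21 q) (hqp : EqOn q p (Icc 0 Real.pi)) : MemW21 p := by
  refine ⟨hq.1.congr (by rwa [uIcc_of_le Real.pi_pos.le]), (memLp_congr_ae ?_).1 hq.2⟩
  rw [← restrict_Ioo_eq_restrict_Icc]
  filter_upwards [ae_restrict_mem measurableSet_Ioo] with x hx
  refine EventuallyEq.deriv_eq ?_
  filter_upwards [Ioo_mem_nhds hx.1 hx.2] with y hy using hqp (Ioo_subset_Icc_self hy)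

lemma IsSLEigenvalue.congr {p : ℝ → ℝ} {μ : ℂ} (hμ : IsSLEigenvalue q h h₁ h₂ H H₁ H₂ μ)
    (hqp : EqOn q p (Icc 0 Real.pi)) : IsSLEigenvalue p h h₁ h₂ H H₁ H₂ μ := by
  obtain ⟨y, dy, hy, hrest⟩ := hμ
  refine ⟨y, dy, fun x hx => ?_, hrest⟩
  rw [← hqp hx]
  exact hy x hx

/-- |J|/m ≤ J² + 1/m² gives the first sum. The factor `m + 2` in the second is the index `n = m + 2`
multiplying the remainder in ξ_n. -/
theorem summable_of_bound {ε J : ℕ → ℝ} {B : ℝ} {N : ℕ} (hJ : Summable fun m => J m ^ 2)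
    (hε : ∀ m : ℕ, N ≤ m → |ε m| ≤ B * (|J m| / m + 1 / (m : ℝ) ^ 2)) :
    Summable ε ∧ Summable fun m : ℕ => (((m : ℝ) + 2) * ε m) ^ 2 := by
  have h2 : Summable fun m : ℕ => 1 / (m : ℝ) ^ 2 := Real.summable_one_div_nat_pow.2 one_lt_two
  have hpos : ∀ m : ℕ, max N 1 ≤ m → (1 : ℝ) ≤ m := fun m hm => by
    exact_mod_cast (le_max_right _ _).trans hm
  have hB : ∀ m : ℕ, max N 1 ≤ m → 0 ≤ B := fun m hm => by
    by_contra! hcon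
    have h3 := hε m ((le_max_left _ _).trans hm)
    have h4 := hpos m hm
    have h5 : 0 < |J m| / m + 1 / (m : ℝ) ^ 2 := by positivity
    nlinarith [abs_nonneg (ε m)]
  constructor
  · refine Summable.of_norm_bounded_eventually_nat ((hJ.add (h2.mul_left 2)).mul_left B) ?_
    filter_upwards [eventually_ge_atTop (max N 1)] with m hm
    refine (hε m ((le_max_left _ _).trans hm)).trans ?_
    have h4 := hpos m hm
    have hB0 := hB m hm
    refine mul_le_mul_of_nonneg_left ?_ hB0
    have e : |J m| / m = |J m| * (1 / m) := by ring
    have e2 : 1 / (m : ℝ) ^ 2 = (1 / (m : ℝ)) ^ 2 := by ring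
    rw [e, e2, ← sq_abs (J m)]
    nlinarith [sq_nonneg (|J m| - 1 / (m : ℝ)), sq_nonneg (|J m|)]
  · refine Summable.of_norm_bounded_eventually_nat ((hJ.add h2).mul_left (18 * B ^ 2)) ?_
    filter_upwards [eventually_ge_atTop (max N 1)] with m hm
    have h3 := hε m ((le_max_left _ _).trans hm)
    have h4 := hpos m hm
    have hm0 : (0 : ℝ) < m := by linarith
    have hB0 := hB m hm
    rw [Real.norm_of_nonneg (sq_nonneg _), mul_pow, ← sq_abs (ε m)]
    calc ((m : ℝ) + 2) ^ 2 * |ε m| ^ 2 ≤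
        (3 * m) ^ 2 * (B * (|J m| / m + 1 / (m : ℝ) ^ 2)) ^ 2 := by
          gcongr
          linarith
      _ = 9 * B ^ 2 * (|J m| + 1 / m) ^ 2 := by field_simp; ring
      _ ≤ 9 * B ^ 2 * (2 * (|J m| ^ 2 + (1 / m) ^ 2)) := by
          gcongr
          linarith [sq_nonneg (|J m| - 1 / (m : ℝ)), sq_nonneg (|J m| + 1 / (m : ℝ)),
            add_sq (|J m|) (1 / (m : ℝ)), sub_sq (|J m|) (1 / (m : ℝ))]
      _ = _ := by rw [sq_abs]; ring

theorem spectrum_of_continuous (hq2 : MemW21 q) (hq : Continuous q)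
    (hδ : 0 < h * h₁ - h₂) (hρ : 0 < H * H₁ - H₂) :
    ∃ lam : ℕ → ℝ, StrictMono lam ∧
      {μ : ℂ | IsSLEigenvalue q h h₁ h₂ H H₁ H₂ μ} = range (fun n : ℕ => (lam n : ℂ)) ∧
      (Summable fun m : ℕ => lam (m + 2) - (m : ℝ) ^ 2 - 2 * slOmega q h H / Real.pi) ∧
      (Summable fun m : ℕ =>
        (((m : ℝ) + 2) * (lam (m + 2) - (m : ℝ) ^ 2 - 2 * slOmega q h H / Real.pi)) ^ 2) ∧
      lam 0 + lam 1 + ∑' m : ℕ, (lam (m + 2) - (m : ℝ) ^ 2 - 2 * slOmega q h H / Real.pi) =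
        slKappa q h h₁ H H₁ + (q 0 + q Real.pi) / 4 - slOmega q h H ^ 2 / 2 -
          slOmega q h H / Real.pi := by
  have hac := hq2.1
  obtain ⟨m₀, σ, B, hm₀, hB0, hσ⟩ := exists_zeros_near_integers (h := h) (h₁ := h₁) (h₂ := h₂)
    (H := H) (H₁ := H₁) (H₂ := H₂) hq2 hq
  set ω := slOmega q h H with hω
  set K := ∫ t in (0 : ℝ)..Real.pi, |deriv q t| with hK
  have hσC : ∀ m : ℕ, m₀ ≤ m → |σ m ^ 2 - (m : ℝ) ^ 2| ≤ B * (K + 1) + |2 * ω / Real.pi| := by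
    intro m hm
    have h1 := (hσ m hm).2.2
    have hm1 : (1 : ℝ) ≤ m := by exact_mod_cast hm₀.trans hm
    have h2 : |derivSine q m| / m ≤ K :=
      (div_le_self (abs_nonneg _) hm1).trans (abs_derivSine_le hac m)
    have h3 : 1 / (m : ℝ) ^ 2 ≤ 1 := by
      rw [div_le_one (by positivity)]; exact one_le_pow₀ hm1
    have h4 : B * (|derivSine q m| / m + 1 / (m : ℝ) ^ 2) ≤ B * (K + 1) := by gcongr
    have h5 := abs_add_le (σ m ^ 2 - (m : ℝ) ^ 2 - 2 * ω / Real.pi) (2 * ω / Real.pi)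
    rw [sub_add_cancel] at h5
    linarith
  obtain ⟨lam, hlam, hzero, ⟨N, hN⟩, ⟨C, hC⟩, hprod⟩ := exists_enumeration
    (differentiable_charFn (h := h) (h₁ := h₁) (h₂ := h₂) (H := H) (H₁ := H₁) (H₂ := H₂) hq)
    (fun w hw => conj_eq_of_charFn_eq_zero hq hδ hρ hw)
    (fun w hw => deriv_charFn_ne_zero hq hδ hρ hw) (tendsto_charFn_circleFilter hac hq) hm₀
    (fun m hm => (hσ m hm).1) (fun m hm => (hσ m hm).2.1) hσC
  obtain ⟨hs1, hs2⟩ := summable_of_bound (N := max N m₀)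
    (ε := fun m : ℕ => lam (m + 2) - (m : ℝ) ^ 2 - 2 * ω / Real.pi)
    (summable_derivSine_sq hq2) (fun m hm => by
      rw [hN m ((le_max_left _ _).trans hm)]
      exact (hσ m ((le_max_right _ _).trans hm)).2.2)
  refine ⟨lam, hlam, ?_, hs1, hs2, ?_⟩
  · ext μ
    exact (isSLEigenvalue_iff hq hδ μ).trans (hzero μ)
  · have hslb : ∀ m, lam (m + 2) - slBase (m + 2) - 2 * ω / Real.pi =
        lam (m + 2) - (m : ℝ) ^ 2 - 2 * ω / Real.pi := fun m => by rw [slBase_add_two]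
    have h1 := trace_of_tendsto (d := fun n => lam n - slBase n) hC
      (κ := slKappa q h h₁ H H₁ + (q 0 + q Real.pi) / 4) (ω := ω) (hs1.congr fun m => (hslb m).symm)
      ?_
    · rw [← h1]
      simp [slBase]
    · have h2 := (Complex.continuous_re.tendsto _).comp (tendsto_charFn_real_axis (h := h)
        (h₁ := h₁) (h₂ := h₂) (H := H) (H₁ := H₁) (H₂ := H₂) hac hq)
      rw [Complex.ofReal_re] at h2
      refine h2.congr' ?_
      filter_upwards [eventually_ge_atTop 1] with t ht
      have ht0 : 0 < t := by linarith
      have htC : (t : ℂ) ≠ 0 := by exact_mod_cast ht0.ne'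
      have ht2 : 1 ≤ t ^ 2 := one_le_pow₀ ht
      have hpos : ∀ n, 0 < slBase n + t ^ 2 := fun n => by
        have := slBase_nonneg n
        positivity
      have hsum : Summable fun n => |(lam n - slBase n) / (slBase n + t ^ 2)| := by
        refine (summable_slBase.mul_left C).of_nonneg_of_le (fun _ => abs_nonneg _) fun n => ?_
        rw [abs_div, abs_of_pos (hpos n), div_eq_mul_inv]
        have := slBase_nonneg n
        exact mul_le_mul (hC n) (inv_anti₀ (by positivity) (by linarith))
          (inv_nonneg.2 (hpos n).le) ((abs_nonneg _).trans (hC n))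
      have hterm : ∀ n, ((lam n : ℂ) - slBase n) / (slBase n - -(t : ℂ) ^ 2) =
          (((lam n - slBase n) / (slBase n + t ^ 2) : ℝ) : ℂ) := fun n => by
        push_cast
        rw [sub_neg_eq_add]
      have hcast : ∏' n, (1 + ((lam n : ℂ) - slBase n) / (slBase n - -(t : ℂ) ^ 2)) =
          ((∏' n, (1 + (lam n - slBase n) / (slBase n + t ^ 2)) : ℝ) : ℂ) := by
        have h3 := (Real.multipliable_one_add_of_summable hsum.of_abs).map_tprod
          Complex.ofRealHom Complex.continuous_ofReal
        refine Eq.trans ?_ h3.symm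
        refine tprod_congr fun n => ?_
        rw [hterm]
        simp
      have hsinh : Complex.sinh (t * Real.pi) ≠ 0 := by
        rw [← Complex.ofReal_mul, ← Complex.ofReal_sinh, Complex.ofReal_ne_zero]
        exact (Real.sinh_pos_iff.2 (mul_pos ht0 Real.pi_pos)).ne'
      have hval : charFn hq h h₁ h₂ H H₁ H₂ (-(t : ℂ) ^ 2) / ((t : ℂ) ^ 5 * Complex.sinh (t * Real.pi)) =
          ((∏' n, (1 + (lam n - slBase n) / (slBase n + t ^ 2)) : ℝ) : ℂ) := by
        rw [hprod, canProd_eq_mul isBaseSeq_slBase, canProd_slBase htC, hcast]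
        · have := sinh_pi_ne_zero
          field_simp
        · intro n hn
          have h4 : ((slBase n + t ^ 2 : ℝ) : ℂ) = 0 := by push_cast; rw [hn]; ring
          exact (hpos n).ne' (Complex.ofReal_eq_zero.1 h4)
        · refine hsum.congr fun n => ?_
          rw [hterm, Complex.norm_real, Real.norm_eq_abs]
      rw [Function.comp_apply, hval]
      norm_cast

end Main

theorem mainTheorem1 (q : ℝ → ℝ) (hq : MemW21 q) (h h₁ h₂ H H₁ H₂ : ℝ)
    (hδ : 0 < h * h₁ - h₂) (hρ : 0 < H * H₁ - H₂) :
    ∃ lam : ℕ → ℝ,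
      StrictMono lam ∧
      {μ : ℂ | IsSLEigenvalue q h h₁ h₂ H H₁ H₂ μ} = Set.range (fun n : ℕ => (lam n : ℂ)) ∧
      (∃ ξ : ℕ → ℝ, Summable (fun n : ℕ => ξ n ^ 2) ∧
        ∀ n : ℕ, 1 ≤ n →
          lam n = ((n : ℝ) - 2) ^ 2 + 2 * slOmega q h H / Real.pi + ξ n / (n : ℝ)) ∧
      Summable (fun n : ℕ =>
        lam (n + 2) - (((n + 2 : ℕ) : ℝ) - 2) ^ 2 - 2 * slOmega q h H / Real.pi) ∧
      lam 0 + lam 1 + ∑' n : ℕ,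
          (lam (n + 2) - (((n + 2 : ℕ) : ℝ) - 2) ^ 2 - 2 * slOmega q h H / Real.pi) =
        h₁ + H₁ + (q 0 + q Real.pi) / 4 - (h + H) / Real.pi - (h ^ 2 + H ^ 2) / 2 -
          1 / (2 * Real.pi) * ∫ x in (0 : ℝ)..Real.pi, q x := by
  -- The problem sees `q` only on `[0,π]`, where it is continuous, whereas the solutions were built
  -- for a potential continuous on the whole line; `q` is therefore continued by its boundary
  -- values.
  set p : ℝ → ℝ := IccExtend Real.pi_pos.le ((Icc 0 Real.pi).domRestrict q) with hp
  have hqp : EqOn q p (Icc 0 Real.pi) := fun x hx => by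
    rw [hp, IccExtend_of_mem _ _ hx, domRestrict_apply]
  have hpc : Continuous p := by
    refine Continuous.Icc_extend' (continuousOn_iff_continuous_domRestrict.1 ?_)
    have := hq.1.continuousOn
    rwa [uIcc_of_le Real.pi_pos.le] at this
  have hint : ∫ x in (0 : ℝ)..Real.pi, p x = ∫ x in (0 : ℝ)..Real.pi, q x :=
    intervalIntegral.integral_congr fun x hx => by
      rw [uIcc_of_le Real.pi_pos.le] at hx
      exact (hqp hx).symm
  have hω : slOmega p h H = slOmega q h H := by rw [slOmega, slOmega, hint]
  obtain ⟨lam, hlam, hset, hs1, hs2, htr⟩ := spectrum_of_continuous (hq.congr hqp) hpc hδ hρ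
  rw [hω] at hs1 hs2 htr
  have hidx : ∀ n : ℕ, (((n + 2 : ℕ) : ℝ) - 2) ^ 2 = (n : ℝ) ^ 2 := fun n => by
    push_cast; ring
  simp only [hidx]
  -- At `n = 1` the term (n - 2)² is 1, whereas `slBase 1 = 0`; the difference is absorbed in ξ₁.
  -- Square summability depends only on `n ≥ 2`, where the two agree.
  refine ⟨lam, hlam, ?_, ⟨fun n => n * (lam n - ((n : ℝ) - 2) ^ 2 - 2 * slOmega q h H / Real.pi),
    (summable_nat_add_iff 2).1 (hs2.congr fun m => ?_), fun n hn => ?_⟩, hs1, htr.trans ?_⟩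
  · rw [← hset]
    ext μ
    exact ⟨fun hμ => hμ.congr hqp, fun hμ => hμ.congr hqp.symm⟩
  · beta_reduce
    rw [hidx]
    push_cast
    rfl
  · have hn0 : (n : ℝ) ≠ 0 := by positivity
    rw [mul_div_cancel_left₀ _ hn0]
    ring
  -- ω²/2 cancels the terms of `slKappa` in hH, (h + H)∫q and (∫q)², leaving -(h² + H²)/2; and -ω/π
  -- supplies the remaining two terms.
  · rw [slKappa, hint, ← hqp zero_mem_Icc_pi, ← hqp pi_mem_Icc_pi, slOmega]
    field_simp
    ring
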